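/- Let $X_{\mathbb R}=L^1(\mathbb R)\cap L^2(\mathbb R)$ be the Banach space of real-valued functions with norm $\|F\|_X=\|F\|_{L^1}+\|F\|_{L^2}$, and let $(X_{\mathbb R})_1=\{F\in X_{\mathbb R}:\|\widehat F\|_\infty<1\}$, where $\widehat F(s)=\int_{\mathbb R}e^{-isx}F(x)\,dx$. For $u\in X_{\mathbb R}$ and $s\in\mathbb R$ consider the ZS-AKNS system $$\Psi'=is\sigma\Psi+\begin{pmatrix}0&u(x)\\ \overline{u(x)}&0\end{pmatrix}\Psi,\qquad \sigma=\tfrac12\begin{pmatrix}1&0\\0&-1\end{pmatrix},$$ with $2\times2$ matrix-valued, locally absolutely continuous $\Psi$ and the equation holding almost everywhere. (The function $u$ is the Riccati representative of the Miura potential $q=u'+u^2$, and the maps below are, by definition, the scattering maps for the Schrödinger operator with potential $q$, parametrized by $u$.) There are Jost solutions $\Psi_\pm(\cdot,s)$ with $\Psi_\pm(x,s)-e^{isx\sigma}\to0$ as $x\to\pm\infty$, and a unique matrix $$A(s)=\begin{pmatrix}a(s)&\overline{b(s)}\\ b(s)&\overline{a(s)}\end{pmatrix},\qquad |a(s)|^2-|b(s)|^2=1,$$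 such that $\Psi_+(x,s)=\Psi_-(x,s)A(s)$ for all $x$. Put $\mathcal S_+u=r_+:=-\overline b/a$ and $\mathcal S_-u=r_-:=b/a$; these functions belong to $L^2(\mathbb R)$. Let $(\mathcal F_\pm f)(x)=\frac1{2\pi}\int_{\mathbb R}e^{\pm isx}f(s)\,ds$ be the Fourier transforms on $L^2(\mathbb R)$. Then each of the maps $\mathcal F_+\circ\mathcal S_+$ and $\mathcal F_-\circ\mathcal S_-$ restricts to a real-analytic bijection from $X_{\mathbb R}$ onto $(X_{\mathbb R})_1$ whose inverse is real-analytic as well. Moreover, $$(\mathcal F_+\circ\mathcal S_+)^{-1}=I+\Phi_+,\qquad(\mathcal F_-\circ\mathcal S_-)^{-1}=-I+\Phi_-,$$ where $I$ is the identity map and $\Phi_\pm:(X_{\mathbb R})_1\to L^1(\mathbb R)\cap C(\mathbb R)$. -/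

import Mathlib

open MeasureTheory Filter Topology Complex
open scoped ENNReal FourierTransform ComplexConjugate

noncomputable section

namespace MiuraScattering

/-! ### Function spaces -/

/-- `L¹(ℝ) ∩ L²(ℝ)`, real-valued, as the pairs `(f, g)` with `f ∈ L¹`, `g ∈ L²` and `f = g` a.e. -/
def XRSubmodule : Submodule ℝ
    (WithLp 1 (Lp ℝ 1 (volume : Measure ℝ) × Lp ℝ 2 (volume : Measure ℝ))) where
  carrier := {p | (p.fst : ℝ → ℝ) =ᵐ[volume] (p.snd : ℝ → ℝ)}
  zero_mem' := (Lp.coeFn_zero ℝ 1 volume).trans (Lp.coeFn_zero ℝ 2 volume).symm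
  add_mem' := fun {p q} (hp : p.fst =ᵐ[volume] p.snd) (hq : q.fst =ᵐ[volume] q.snd) =>
    (Lp.coeFn_add p.fst q.fst).trans ((hp.add hq).trans (Lp.coeFn_add p.snd q.snd).symm)
  smul_mem' := fun c p (hp : p.fst =ᵐ[volume] p.snd) =>
    (Lp.coeFn_smul c p.fst).trans ((hp.const_smul c).trans (Lp.coeFn_smul c p.snd).symm)

/-- The space `X_ℝ = L¹(ℝ) ∩ L²(ℝ)` of real-valued functions, with the norm
`‖F‖_X = ‖F‖₁ + ‖F‖₂`. -/
abbrev XR : Type := XRSubmodule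

/-- A representative of an element of `X_ℝ` (well defined up to a null set). -/
def XR.toFun (F : XR) : ℝ → ℝ := F.1.fst

/-- The same function, regarded as complex-valued. -/
def XR.toComplex (F : XR) : ℝ → ℂ := fun x => (F.toFun x : ℂ)

/-- The norm of `X_ℝ` is `‖F‖₁ + ‖F‖₂`. -/
theorem XR.norm_eq (F : XR) :
    ‖F‖ = (eLpNorm F.toFun 1 volume).toReal + (eLpNorm F.toFun 2 volume).toReal := by
  have h : eLpNorm F.toFun 2 volume = eLpNorm F.1.snd 2 volume :=
    eLpNorm_congr_ae F.2
  rw [h]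
  exact WithLp.prod_norm_eq_of_L1 _

/-- Every function in `L¹ ∩ L²` is represented by an element of `X_ℝ`. -/
theorem XR.exists_toFun_ae_eq {f : ℝ → ℝ} (h₁ : MemLp f 1 volume) (h₂ : MemLp f 2 volume) :
    ∃ F : XR, F.toFun =ᵐ[volume] f :=
  ⟨⟨WithLp.toLp 1 (h₁.toLp f, h₂.toLp f), h₁.coeFn_toLp.trans h₂.coeFn_toLp.symm⟩,
    h₁.coeFn_toLp⟩

/-- `F̂(s) = ∫ e^{-isx} F(x) dx`. -/
def hat (F : ℝ → ℂ) (s : ℝ) : ℂ := ∫ x : ℝ, cexp (-(I * s * x)) * F x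

/-- `(X_ℝ)₁ = {F ∈ X_ℝ : ‖F̂‖_∞ < 1}`. -/
def XROne : Set XR := {F | (⨆ s : ℝ, ‖hat F.toComplex s‖ₑ) < 1}

/-- `L¹(ℝ) ∩ C(ℝ)`, real-valued. -/
def L1C : Set C(ℝ, ℝ) := {φ | Integrable φ volume}

/-! ### The ZS-AKNS system, Jost solutions and reflection coefficients -/

/-- `σ = ½ diag(1, -1)`. -/
def sigma : Matrix (Fin 2) (Fin 2) ℂ := !![1 / 2, 0; 0, -(1 / 2)]

/-- `Q(x) = (0, u(x); conj u(x), 0)`. -/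
def Q (u : ℝ → ℂ) (x : ℝ) : Matrix (Fin 2) (Fin 2) ℂ := !![0, u x; conj (u x), 0]

/-- `exp(i s x σ)`. -/
def expSigma (s x : ℝ) : Matrix (Fin 2) (Fin 2) ℂ :=
  !![cexp (I * s * x / 2), 0; 0, cexp (-(I * s * x / 2))]

/-- `Ψ` solves `Ψ' = i s σ Ψ + Q(x) Ψ` on the line. For locally integrable `u` the system is
understood in the Carathéodory sense, written in integrated form. -/
def IsAKNSSolution (u : ℝ → ℂ) (s : ℝ) (Ψ : ℝ → Matrix (Fin 2) (Fin 2) ℂ) : Prop :=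
  Continuous Ψ ∧ ∀ (x y : ℝ) (i j : Fin 2),
    Ψ y i j - Ψ x i j = ∫ t in x..y, (((I * s) • sigma + Q u t) * Ψ t) i j

/-- The Jost solution `Ψ₊`: `Ψ₊(x) - exp(i s x σ) → 0` as `x → +∞`. -/
def IsJostPlus (u : ℝ → ℂ) (s : ℝ) (Ψ : ℝ → Matrix (Fin 2) (Fin 2) ℂ) : Prop :=
  IsAKNSSolution u s Ψ ∧ Tendsto (fun x => Ψ x - expSigma s x) atTop (𝓝 0)

/-- The Jost solution `Ψ₋`: `Ψ₋(x) - exp(i s x σ) → 0` as `x → -∞`. -/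
def IsJostMinus (u : ℝ → ℂ) (s : ℝ) (Ψ : ℝ → Matrix (Fin 2) (Fin 2) ℂ) : Prop :=
  IsAKNSSolution u s Ψ ∧ Tendsto (fun x => Ψ x - expSigma s x) atBot (𝓝 0)

/-- `A = (a, conj b; b, conj a)` with `|a|² - |b|² = 1` and `Ψ₊(x) = Ψ₋(x) A`. -/
def IsScatteringMatrix (u : ℝ → ℂ) (s : ℝ) (A : Matrix (Fin 2) (Fin 2) ℂ) : Prop :=
  A 0 1 = conj (A 1 0) ∧ A 1 1 = conj (A 0 0) ∧ ‖A 0 0‖ ^ 2 - ‖A 1 0‖ ^ 2 = 1 ∧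
    ∃ Ψp Ψm : ℝ → Matrix (Fin 2) (Fin 2) ℂ,
      IsJostPlus u s Ψp ∧ IsJostMinus u s Ψm ∧ ∀ x, Ψp x = Ψm x * A

/-- The scattering matrix `A(s)` of `u`; its existence and uniqueness for `u ∈ X_ℝ` are part of
the theorem. -/
def scatteringMatrix (u : ℝ → ℂ) (s : ℝ) : Matrix (Fin 2) (Fin 2) ℂ :=
  Classical.epsilon (IsScatteringMatrix u s)

/-- `a(s)`. -/
def coeffA (u : ℝ → ℂ) (s : ℝ) : ℂ := scatteringMatrix u s 0 0

/-- `b(s)`. -/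
def coeffB (u : ℝ → ℂ) (s : ℝ) : ℂ := scatteringMatrix u s 1 0

/-- The right scattering map `S₊ : u ↦ r₊ = -conj b / a`. -/
def SPlus (u : ℝ → ℂ) (s : ℝ) : ℂ := -conj (coeffB u s) / coeffA u s

/-- The left scattering map `S₋ : u ↦ r₋ = b / a`. -/
def SMinus (u : ℝ → ℂ) (s : ℝ) : ℂ := coeffB u s / coeffA u s

/-! ### The Fourier transforms `𝓕₊` and `𝓕₋` on `L²(ℝ)` -/

open Classical in
/-- `(𝓕₊ f)(x) = (1/2π) ∫ e^{isx} f(s) ds` on `L²(ℝ)`, in the sense of Plancherel. With `s = 2πt`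
this is `∫ e^{2πitx} f(2πt) dt`, Mathlib's inverse `L²` Fourier transform of `t ↦ f(2πt)`.
(The value is `0` if `f` is not square-integrable.) -/
def fourierPlus (f : ℝ → ℂ) : Lp ℂ 2 (volume : Measure ℝ) :=
  if h : MemLp (fun t : ℝ => f (2 * Real.pi * t)) 2 volume then 𝓕⁻ (h.toLp) else 0

open Classical in
/-- `(𝓕₋ f)(x) = (1/2π) ∫ e^{-isx} f(s) ds` on `L²(ℝ)`, in the sense of Plancherel. With `s = 2πt`
this is `∫ e^{-2πitx} f(2πt) dt`, Mathlib's `L²` Fourier transform of `t ↦ f(2πt)`.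
(The value is `0` if `f` is not square-integrable.) -/
def fourierMinus (f : ℝ → ℂ) : Lp ℂ 2 (volume : Measure ℝ) :=
  if h : MemLp (fun t : ℝ => f (2 * Real.pi * t)) 2 volume then 𝓕 (h.toLp) else 0

end MiuraScattering

end

open MeasureTheory Filter Topology Complex
open scoped ENNReal FourierTransform ComplexConjugate BoundedContinuousFunction

noncomputable section

namespace MiuraScattering

/-! ### Operations on `X_ℝ` -/

/-! Direct map. In the rotating frame the system is y' = u e^{isx} z, z' = u e^{-isx} y. Its
solution normalised at +∞ is (1 + k̂₁(x), k̂₂(x)), where `ker₁` and `ker₂` are bounded continuous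
X-valued functions of x solving a Volterra system. Volterra operators are quasi-nilpotent, so the
system is solvable for every u, analytically in u. The limits at -∞ are `alpha` and `-beta`, and the
scattering matrix is read off from them: a = conj(1 + α̂), r₊ = β̂/a. Since |a| ≥ 1, Wiener's lemma
in the algebra `W` = ℝ ⊕ X permits division by a. Hence 𝓕₊ ∘ S₊ is an analytic self-map `scat` of X
with derivative the identity at 0, and |r₊|² = 1 - |a|⁻² puts its values in the ball sup |F̂| < 1,
which is convex.

Inverse map. It is obtained from a global inverse function theorem (`exists_analytic_inverse`): if
an analytic map into a connected set has an invertible derivative somewhere, and its inverse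
satisfies a local Lipschitz bound near each point of that set, then it is bianalytic onto it. The
bound prevents the derivative from losing invertibility and makes the range relatively closed.
Everything reduces to the estimate ‖u - v‖ ≤ C ‖scat u - scat v‖ for data near a fixed F
(`exists_norm_sub_le`), proved on three pieces of the line.

Right end. By the Marchenko equations, u on (c,∞) depends only on its data on (c,∞). For large c
these data are small, and the inverse function theorem at 0 applies. Left end. The same argument is
applied to the reversed potential -u(-x), whose data are -(conj a / a) conj r₊; the Lipschitz
dependence of conj a / a on r₊ comes from a perturbation estimate for the factorization 1 - |r₊|² =
1/(a conj a) into causal and anti-causal factors. Middle. The Marchenko system is a contraction in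
L², because sup |F̂| < 1. Therefore in u = `scat u` + `corr u` the continuous term `corr u` is
Lipschitz in the data in the sup norm, which suffices on a bounded interval.

The same formula u = `scat u` + `corr u` supplies Φ₊. The statement for r₋ follows by reversing the
potential. -/

/-- The space `X_ℝ` again, as a type of its own: instance search does not see through it to the
product of Lebesgue spaces in which `XR` is a subspace. -/
def X : Type := XR

instance : NormedAddCommGroup X := inferInstanceAs (NormedAddCommGroup XR)

instance : NormedSpace ℝ X := inferInstanceAs (NormedSpace ℝ XR)

namespace X

/-- The pair of Lebesgue classes of an element of `X_ℝ`. -/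
def toXR (F : X) : XR := F

/-- A representative. -/
def toFun (F : X) : ℝ → ℝ := F.toXR.toFun

/-- The same function, regarded as complex-valued. -/
def toComplex (F : X) : ℝ → ℂ := fun x => (F.toFun x : ℂ)

theorem norm_eq (F : X) :
    ‖F‖ = (eLpNorm F.toFun 1 volume).toReal + (eLpNorm F.toFun 2 volume).toReal :=
  XR.norm_eq F.toXR

theorem toFun_ae_snd (F : X) : F.toFun =ᵐ[volume] F.toXR.1.snd := F.toXR.2

theorem memLp_one (F : X) : MemLp F.toFun 1 volume := Lp.memLp F.toXR.1.fst

theorem memLp_two (F : X) : MemLp F.toFun 2 volume :=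
  (memLp_congr_ae F.toFun_ae_snd).2 (Lp.memLp F.toXR.1.snd)

theorem integrable (F : X) : Integrable F.toFun volume := memLp_one_iff_integrable.1 F.memLp_one

theorem ext_ae {F G : X} (h : F.toFun =ᵐ[volume] G.toFun) : F = G := by
  apply Subtype.ext
  apply (WithLp.equiv 1 _).injective
  refine Prod.ext (Lp.ext h) (Lp.ext ?_)
  exact F.toFun_ae_snd.symm.trans (h.trans G.toFun_ae_snd)

theorem toFun_zero : (0 : X).toFun =ᵐ[volume] 0 := Lp.coeFn_zero ℝ 1 volume

theorem toFun_add (F G : X) : (F + G).toFun =ᵐ[volume] F.toFun + G.toFun :=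
  Lp.coeFn_add F.toXR.1.fst G.toXR.1.fst

theorem toFun_sub (F G : X) : (F - G).toFun =ᵐ[volume] F.toFun - G.toFun :=
  Lp.coeFn_sub F.toXR.1.fst G.toXR.1.fst

theorem toFun_neg (F : X) : (-F).toFun =ᵐ[volume] -F.toFun :=
  Lp.coeFn_neg F.toXR.1.fst

theorem toFun_smul (c : ℝ) (F : X) : (c • F).toFun =ᵐ[volume] c • F.toFun :=
  Lp.coeFn_smul c F.toXR.1.fst

/-- The element of `X_ℝ` represented by a function in `L¹ ∩ L²`. -/
def ofMemLp (f : ℝ → ℝ) (h₁ : MemLp f 1 volume) (h₂ : MemLp f 2 volume) : X :=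
  id (α := XR) ⟨WithLp.toLp 1 (h₁.toLp f, h₂.toLp f), h₁.coeFn_toLp.trans h₂.coeFn_toLp.symm⟩

theorem toFun_ofMemLp {f : ℝ → ℝ} (h₁ : MemLp f 1 volume) (h₂ : MemLp f 2 volume) :
    (ofMemLp f h₁ h₂).toFun =ᵐ[volume] f := h₁.coeFn_toLp

/-- The inclusion `X_ℝ ⊆ L¹`. -/
def toL1 : X →L[ℝ] Lp ℝ 1 (volume : Measure ℝ) :=
  LinearMap.mkContinuous
    { toFun := fun F => F.toXR.1.fst
      map_add' := fun _ _ => rfl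
      map_smul' := fun _ _ => rfl } 1 fun F => by
    rw [one_mul]
    change ‖F.toXR.1.fst‖ ≤ ‖F.toXR.1‖
    rw [WithLp.prod_norm_eq_of_L1]
    exact le_add_of_nonneg_right (norm_nonneg _)

/-- The inclusion `X_ℝ ⊆ L²`. -/
def toL2 : X →L[ℝ] Lp ℝ 2 (volume : Measure ℝ) :=
  LinearMap.mkContinuous
    { toFun := fun F => F.toXR.1.snd
      map_add' := fun _ _ => rfl
      map_smul' := fun _ _ => rfl } 1 fun F => by
    rw [one_mul]
    change ‖F.toXR.1.snd‖ ≤ ‖F.toXR.1‖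
    rw [WithLp.prod_norm_eq_of_L1]
    exact le_add_of_nonneg_left (norm_nonneg _)

theorem toL2_ae (F : X) : toL2 F =ᵐ[volume] F.toFun := F.toFun_ae_snd.symm

theorem norm_eq_add (F : X) : ‖F‖ = ‖toL1 F‖ + ‖toL2 F‖ := WithLp.prod_norm_eq_of_L1 _

theorem norm_toL1_le (F : X) : ‖toL1 F‖ ≤ ‖F‖ := by
  rw [norm_eq_add]; exact le_add_of_nonneg_right (norm_nonneg _)

theorem norm_toL2_le (F : X) : ‖toL2 F‖ ≤ ‖F‖ := by
  rw [norm_eq_add]; exact le_add_of_nonneg_left (norm_nonneg _)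

theorem norm_toL1_eq_integral (F : X) : ‖toL1 F‖ = ∫ x, |F.toFun x| := by
  rw [L1.norm_eq_integral_norm]; rfl

theorem toL2_injective : Function.Injective toL2 := fun F G h =>
  ext_ae ((toL2_ae F).symm.trans (h ▸ toL2_ae G))

theorem continuous_of_toLp {Z : Type*} [TopologicalSpace Z] {f : Z → X}
    (h₁ : Continuous fun z => toL1 (f z)) (h₂ : Continuous fun z => toL2 (f z)) :
    Continuous f := by
  refine continuous_induced_rng.2 ?_
  exact (WithLp.prod_continuous_toLp 1 _ _).comp (h₁.prodMk h₂)

/-- Convergence in L¹ and in L² both imply convergence in measure, so the two components of a limit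
pair agree almost everywhere and the subspace is closed. -/
instance : CompleteSpace X := by
  have hc : IsClosed (XRSubmodule : Set (WithLp 1 (Lp ℝ 1 (volume : Measure ℝ) ×
      Lp ℝ 2 (volume : Measure ℝ)))) := by
    refine IsSeqClosed.isClosed fun p q hp hq => ?_
    have h1 : Tendsto (fun n => (p n).fst) atTop (𝓝 q.fst) :=
      ((WithLp.prod_continuous_ofLp 1 _ _).fst.tendsto q).comp hq
    have h2 : Tendsto (fun n => (p n).snd) atTop (𝓝 q.snd) :=
      ((WithLp.prod_continuous_ofLp 1 _ _).snd.tendsto q).comp hq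
    have t1 := tendstoInMeasure_of_tendsto_Lp h1
    have t2 := tendstoInMeasure_of_tendsto_Lp h2
    have t1' : TendstoInMeasure volume (fun n => ((p n).snd : ℝ → ℝ)) atTop q.fst :=
      t1.congr (fun n => hp n) EventuallyEq.rfl
    exact tendstoInMeasure_ae_unique t1' t2
  exact hc.completeSpace_coe

/-! #### Translation and reflection -/

/-- Composition with a measure preserving map. -/
def comp (φ : ℝ → ℝ) (hφ : MeasurePreserving φ volume volume) : X →ₗᵢ[ℝ] X where
  toFun F := id (α := XR) ⟨WithLp.toLp 1 (Lp.compMeasurePreserving φ hφ F.toXR.1.fst,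
      Lp.compMeasurePreserving φ hφ F.toXR.1.snd),
    (Lp.coeFn_compMeasurePreserving _ hφ).trans
      ((hφ.quasiMeasurePreserving.ae_eq_comp F.toXR.2).trans
        (Lp.coeFn_compMeasurePreserving _ hφ).symm)⟩
  map_add' F G := by
    apply Subtype.ext
    apply (WithLp.equiv 1 _).injective
    exact Prod.ext (map_add (Lp.compMeasurePreserving φ hφ) F.toXR.1.fst G.toXR.1.fst)
      (map_add (Lp.compMeasurePreserving φ hφ) F.toXR.1.snd G.toXR.1.snd)
  map_smul' c F := by
    apply Subtype.ext
    apply (WithLp.equiv 1 _).injective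
    exact Prod.ext ((Lp.compMeasurePreservingₗ ℝ φ hφ).map_smul c F.toXR.1.fst)
      ((Lp.compMeasurePreservingₗ ℝ φ hφ).map_smul c F.toXR.1.snd)
  norm_map' F := by
    rw [norm_eq_add, norm_eq_add]
    exact congrArg₂ (· + ·) (Lp.norm_compMeasurePreserving F.toXR.1.fst hφ)
      (Lp.norm_compMeasurePreserving F.toXR.1.snd hφ)

theorem toFun_comp (φ : ℝ → ℝ) (hφ : MeasurePreserving φ volume volume) (F : X) :
    (comp φ hφ F).toFun =ᵐ[volume] F.toFun ∘ φ :=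
  Lp.coeFn_compMeasurePreserving _ hφ

theorem norm_toL2_comp (φ : ℝ → ℝ) (hφ : MeasurePreserving φ volume volume) (F : X) :
    ‖toL2 (comp φ hφ F)‖ = ‖toL2 F‖ := Lp.norm_compMeasurePreserving F.toXR.1.snd hφ

/-- Translation, `(τ_t F)(x) = F(x - t)`. -/
def transl (t : ℝ) : X →ₗᵢ[ℝ] X := comp (fun x => x - t) (measurePreserving_sub_right volume t)

/-- Reflection, `(R F)(x) = F(-x)`. -/
def refl : X →ₗᵢ[ℝ] X := comp (fun x => -x) (Measure.measurePreserving_neg volume)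

theorem toFun_transl (t : ℝ) (F : X) :
    (transl t F).toFun =ᵐ[volume] fun x => F.toFun (x - t) := toFun_comp _ _ F

theorem toFun_refl (F : X) : (refl F).toFun =ᵐ[volume] fun x => F.toFun (-x) := toFun_comp _ _ F

theorem norm_toL2_transl (t : ℝ) (F : X) : ‖toL2 (transl t F)‖ = ‖toL2 F‖ := norm_toL2_comp _ _ F

theorem norm_toL2_refl (F : X) : ‖toL2 (refl F)‖ = ‖toL2 F‖ := norm_toL2_comp _ _ F

theorem refl_refl (F : X) : refl (refl F) = F := by
  apply ext_ae
  have h := (Measure.measurePreserving_neg (volume : Measure ℝ)).quasiMeasurePreserving.ae_eq_comp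
    (toFun_refl F)
  refine (toFun_refl (refl F)).trans (h.trans (Eventually.of_forall fun x => ?_))
  simp

/-- This joint continuity makes the integrands defining `J` measurable and the correlations below
continuous. -/
theorem continuous_transl : Continuous fun p : ℝ × X => transl p.1 p.2 := by
  have hg : Continuous fun p : ℝ × X => (⟨fun x => x - p.1, by fun_prop⟩ : C(ℝ, ℝ)) := by
    have : Continuous fun t : ℝ => (⟨fun x => x - t, by fun_prop⟩ : C(ℝ, ℝ)) :=
      (ContinuousMap.mk (fun a : ℝ × ℝ => a.2 - a.1) (by fun_prop)).curry.continuous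
    exact this.comp continuous_fst
  refine continuous_of_toLp ?_ ?_
  · exact Continuous.compMeasurePreservingLp (toL1.continuous.comp continuous_snd) hg
      (fun p => measurePreserving_sub_right volume p.1) ENNReal.one_ne_top
  · exact Continuous.compMeasurePreservingLp (toL2.continuous.comp continuous_snd) hg
      (fun p => measurePreserving_sub_right volume p.1) ENNReal.ofNat_ne_top

/-! #### Restriction to a measurable set -/

/-- Multiplication by the indicator function of a measurable set. -/
def cut (S : Set ℝ) (hS : MeasurableSet S) : X →L[ℝ] X :=
  LinearMap.mkContinuous
    { toFun := fun F => ofMemLp (S.indicator F.toFun) (F.memLp_one.indicator hS)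
        (F.memLp_two.indicator hS)
      map_add' := fun F G => by
        apply ext_ae
        filter_upwards [toFun_ofMemLp ((F + G).memLp_one.indicator hS)
          ((F + G).memLp_two.indicator hS), toFun_ofMemLp (F.memLp_one.indicator hS)
          (F.memLp_two.indicator hS), toFun_ofMemLp (G.memLp_one.indicator hS)
          (G.memLp_two.indicator hS), toFun_add F G,
          toFun_add (ofMemLp _ (F.memLp_one.indicator hS) (F.memLp_two.indicator hS))
            (ofMemLp _ (G.memLp_one.indicator hS) (G.memLp_two.indicator hS))] with x h1 h2 h3 h4 h5
        rw [h1, h5, Pi.add_apply, h2, h3]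
        by_cases hx : x ∈ S <;> simp [hx, h4]
      map_smul' := fun c F => by
        apply ext_ae
        filter_upwards [toFun_ofMemLp ((c • F).memLp_one.indicator hS)
          ((c • F).memLp_two.indicator hS), toFun_ofMemLp (F.memLp_one.indicator hS)
          (F.memLp_two.indicator hS), toFun_smul c F,
          toFun_smul c (ofMemLp _ (F.memLp_one.indicator hS) (F.memLp_two.indicator hS))]
          with x h1 h2 h3 h4
        rw [h1, RingHom.id_apply, h4, Pi.smul_apply, h2]
        by_cases hx : x ∈ S <;> simp [hx, h3] } 1 fun F => by
    rw [one_mul, norm_eq, norm_eq]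
    refine add_le_add (ENNReal.toReal_mono F.memLp_one.eLpNorm_ne_top ?_)
      (ENNReal.toReal_mono F.memLp_two.eLpNorm_ne_top ?_)
    · exact (eLpNorm_congr_ae (toFun_ofMemLp (F.memLp_one.indicator hS)
        (F.memLp_two.indicator hS))).trans_le (eLpNorm_indicator_le _)
    · exact (eLpNorm_congr_ae (toFun_ofMemLp (F.memLp_one.indicator hS)
        (F.memLp_two.indicator hS))).trans_le (eLpNorm_indicator_le _)

theorem toFun_cut {S : Set ℝ} (hS : MeasurableSet S) (F : X) :
    (cut S hS F).toFun =ᵐ[volume] S.indicator F.toFun :=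
  toFun_ofMemLp (F.memLp_one.indicator hS) (F.memLp_two.indicator hS)

theorem norm_toL1_eq (F : X) : ‖toL1 F‖ = (eLpNorm F.toFun 1 volume).toReal := rfl

theorem norm_toL2_eq (F : X) : ‖toL2 F‖ = (eLpNorm F.toFun 2 volume).toReal := by
  rw [eLpNorm_congr_ae F.toFun_ae_snd]; rfl

theorem norm_toL1_le_of_ae {F G : X} (h : ∀ᵐ x, |F.toFun x| ≤ |G.toFun x|) :
    ‖toL1 F‖ ≤ ‖toL1 G‖ :=
  ENNReal.toReal_mono G.memLp_one.eLpNorm_ne_top (eLpNorm_mono_ae h)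

theorem norm_toL2_le_of_ae {F G : X} (h : ∀ᵐ x, |F.toFun x| ≤ |G.toFun x|) :
    ‖toL2 F‖ ≤ ‖toL2 G‖ := by
  rw [norm_toL2_eq, norm_toL2_eq]
  exact ENNReal.toReal_mono G.memLp_two.eLpNorm_ne_top (eLpNorm_mono_ae h)

theorem norm_le_of_ae {F G : X} (h : ∀ᵐ x, |F.toFun x| ≤ |G.toFun x|) : ‖F‖ ≤ ‖G‖ := by
  rw [norm_eq_add, norm_eq_add]
  exact add_le_add (norm_toL1_le_of_ae h) (norm_toL2_le_of_ae h)

theorem abs_cut_le {S : Set ℝ} (hS : MeasurableSet S) (F : X) :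
    ∀ᵐ x, |(cut S hS F).toFun x| ≤ |F.toFun x| := by
  filter_upwards [toFun_cut hS F] with x hx
  rw [hx]
  by_cases h : x ∈ S <;> simp [h]

theorem norm_cut_le {S : Set ℝ} (hS : MeasurableSet S) (F : X) : ‖cut S hS F‖ ≤ ‖F‖ :=
  norm_le_of_ae (abs_cut_le hS F)

theorem norm_toL2_cut_le {S : Set ℝ} (hS : MeasurableSet S) (F : X) :
    ‖toL2 (cut S hS F)‖ ≤ ‖toL2 F‖ := norm_toL2_le_of_ae (abs_cut_le hS F)

theorem tendsto_eLpNorm_indicator {ι : Type*} {l : Filter ι} [l.IsCountablyGenerated]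
    {f : ℝ → ℝ} {p : ℝ≥0∞} (hp0 : p ≠ 0) (hp : p ≠ ∞) (hf : MemLp f p volume) {S : ι → Set ℝ}
    (hS : ∀ i, MeasurableSet (S i)) (h : ∀ᵐ x, ∀ᶠ i in l, x ∉ S i) :
    Tendsto (fun i => eLpNorm ((S i).indicator f) p volume) l (𝓝 0) := by
  have hpos : 0 < p.toReal := ENNReal.toReal_pos hp0 hp
  have key : Tendsto (fun i => ∫⁻ x, ‖(S i).indicator f x‖ₑ ^ p.toReal) l (𝓝 (∫⁻ _ : ℝ, 0)) := by
    refine tendsto_lintegral_filter_of_dominated_convergence' (fun x => ‖f x‖ₑ ^ p.toReal) ?_ ?_ ?_ ?_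
    · exact Eventually.of_forall fun i =>
        ((hf.1.indicator (hS i)).enorm.pow_const _)
    · refine Eventually.of_forall fun i => Eventually.of_forall fun x => ?_
      gcongr
      exact enorm_indicator_le_enorm_self _ _
    · exact (lintegral_rpow_enorm_lt_top_of_eLpNorm_lt_top hp0 hp hf.2).ne
    · filter_upwards [h] with x hx
      refine tendsto_const_nhds.congr' ?_
      filter_upwards [hx] with i hi
      simp [hi, hpos]
  have h2 := key.ennrpow_const (1 / p.toReal)
  simp only [lintegral_zero] at h2
  rw [ENNReal.zero_rpow_of_pos (by positivity)] at h2
  refine h2.congr fun i => ?_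
  rw [eLpNorm_eq_lintegral_rpow_enorm_toReal hp0 hp]

theorem tendsto_cut_zero {ι : Type*} {l : Filter ι} [l.IsCountablyGenerated] (F : X)
    {S : ι → Set ℝ} (hS : ∀ i, MeasurableSet (S i)) (h : ∀ᵐ x, ∀ᶠ i in l, x ∉ S i) :
    Tendsto (fun i => cut (S i) (hS i) F) l (𝓝 0) := by
  rw [tendsto_zero_iff_norm_tendsto_zero]
  have h1 := tendsto_eLpNorm_indicator one_ne_zero ENNReal.one_ne_top F.memLp_one hS h
  have h2 := tendsto_eLpNorm_indicator two_ne_zero ENNReal.ofNat_ne_top F.memLp_two hS h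
  have h3 := ((ENNReal.tendsto_toReal ENNReal.zero_ne_top).comp h1).add
    ((ENNReal.tendsto_toReal ENNReal.zero_ne_top).comp h2)
  simp only [ENNReal.toReal_zero, add_zero] at h3
  refine h3.congr fun i => ?_
  rw [norm_eq, eLpNorm_congr_ae (toFun_cut (hS i) F), eLpNorm_congr_ae (toFun_cut (hS i) F)]
  rfl

theorem cut_cut {S T : Set ℝ} (hS : MeasurableSet S) (hT : MeasurableSet T) (F : X) :
    cut S hS (cut T hT F) = cut (S ∩ T) (hS.inter hT) F := by
  apply ext_ae
  filter_upwards [toFun_cut hS (cut T hT F), toFun_cut hT F, toFun_cut (hS.inter hT) F]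
    with x h1 h2 h3
  rw [h1, h3, ← Set.indicator_indicator]
  by_cases hx : x ∈ S <;> simp [hx, h2]

theorem cut_congr_ae {S T : Set ℝ} (hS : MeasurableSet S) (hT : MeasurableSet T)
    (h : S =ᵐ[volume] T) : cut S hS = cut T hT := by
  ext1 F
  apply ext_ae
  exact (toFun_cut hS F).trans ((indicator_ae_eq_of_ae_eq_set h).trans (toFun_cut hT F).symm)

/-- Restriction to the half-line `(c, ∞)`. -/
def tail (c : ℝ) : X →L[ℝ] X := cut (Set.Ioi c) measurableSet_Ioi

theorem toFun_tail (c : ℝ) (F : X) : (tail c F).toFun =ᵐ[volume] (Set.Ioi c).indicator F.toFun :=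
  toFun_cut _ F

theorem norm_tail_le (c : ℝ) (F : X) : ‖tail c F‖ ≤ ‖F‖ := norm_cut_le _ F

theorem tail_tail (c d : ℝ) (F : X) : tail c (tail d F) = tail (max c d) F := by
  unfold tail
  rw [cut_cut]
  congr 2
  exact Set.Ioi_inter_Ioi

theorem tendsto_tail_atTop (F : X) : Tendsto (fun c => tail c F) atTop (𝓝 0) := by
  refine tendsto_cut_zero F (fun _ => measurableSet_Ioi) (Eventually.of_forall fun x => ?_)
  filter_upwards [eventually_ge_atTop x] with c hc
  simpa using hc

theorem sub_tail (c : ℝ) (F : X) : F - tail c F = cut (Set.Iic c) measurableSet_Iic F := by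
  apply ext_ae
  filter_upwards [toFun_sub F (tail c F), toFun_tail c F,
    toFun_cut measurableSet_Iic F (S := Set.Iic c)] with x h1 h2 h3
  rw [h1, h3, Pi.sub_apply, h2]
  by_cases hx : x ≤ c
  · simp [hx]
  · simp [hx, not_le.1 hx]

theorem tendsto_tail_atBot (F : X) : Tendsto (fun c => tail c F) atBot (𝓝 F) := by
  have h : Tendsto (fun c => cut (Set.Iic c) measurableSet_Iic F) atBot (𝓝 0) := by
    refine tendsto_cut_zero F (fun _ => measurableSet_Iic) (Eventually.of_forall fun x => ?_)
    filter_upwards [eventually_lt_atBot x] with c hc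
    simpa using hc
  have := (tendsto_const_nhds (x := F)).sub h
  rw [sub_zero] at this
  refine this.congr fun c => ?_
  rw [← sub_tail, sub_sub_cancel]

theorem tail_sub_tail {c d : ℝ} (h : c ≤ d) (F : X) :
    tail c F - tail d F = cut (Set.Ioc c d) measurableSet_Ioc F := by
  apply ext_ae
  filter_upwards [toFun_sub (tail c F) (tail d F), toFun_tail c F, toFun_tail d F,
    toFun_cut measurableSet_Ioc F (S := Set.Ioc c d)] with x h1 h2 h3 h4
  rw [h1, h4, Pi.sub_apply, h2, h3]
  by_cases hx : c < x
  · by_cases hd : d < x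
    · simp [hx, hd]
    · simp [hx, hd, not_lt.1 hd]
  · have hd : ¬ d < x := fun hd => hx (h.trans_lt hd)
    simp [hx, hd]

/-- Moving the endpoint from c to d changes the function by its restriction to the interval between
them, and every point other than c eventually leaves that interval. -/
theorem continuous_tail (F : X) : Continuous fun c => tail c F := by
  refine continuous_iff_continuousAt.2 fun c => ?_
  have h : Tendsto (fun d => cut (Set.uIoc c d) measurableSet_uIoc F) (𝓝 c) (𝓝 0) := by
    refine tendsto_cut_zero F (fun _ => measurableSet_uIoc) ?_
    have : ∀ᵐ x : ℝ, x ≠ c := by simp [ae_iff]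
    filter_upwards [this] with x hx
    rcases lt_or_gt_of_ne hx with hx | hx
    · filter_upwards [lt_mem_nhds hx] with d hd
      simp only [Set.mem_uIoc, not_or, not_and, not_le]
      exact ⟨fun h => absurd (h.trans hx) (lt_irrefl _), fun h => absurd (h.trans hd) (lt_irrefl _)⟩
    · filter_upwards [gt_mem_nhds hx] with d hd
      simp only [Set.mem_uIoc, not_or, not_and, not_le]
      exact ⟨fun _ => hd, fun _ => hx⟩
  rw [tendsto_zero_iff_norm_tendsto_zero] at h
  rw [ContinuousAt, tendsto_iff_norm_sub_tendsto_zero]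
  refine h.congr fun d => ?_
  rcases le_total c d with hcd | hcd
  · rw [norm_sub_rev, tail_sub_tail hcd]
    congr 2
    exact cut_congr_ae _ _ (.of_eq (Set.uIoc_of_le hcd))
  · rw [tail_sub_tail hcd]
    congr 2
    exact cut_congr_ae _ _ (.of_eq (Set.uIoc_of_ge hcd))

theorem cut_transl {S : Set ℝ} (hS : MeasurableSet S) (t : ℝ) (F : X) :
    cut S hS (transl t F) =
      transl t (cut ((fun x => x + t) ⁻¹' S) (measurable_add_const t hS) F) := by
  apply ext_ae
  have h := (measurePreserving_sub_right (volume : Measure ℝ) t).quasiMeasurePreserving.ae_eq_comp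
    (toFun_cut (measurable_add_const t hS) F)
  filter_upwards [toFun_cut hS (transl t F), toFun_transl t F, toFun_transl t
    (cut ((fun x => x + t) ⁻¹' S) (measurable_add_const t hS) F), h] with x h1 h2 h3 h4
  rw [h1, h3]
  simp only [Function.comp_apply] at h4
  rw [h4]
  by_cases hx : x ∈ S
  · simp [hx, h2]
  · simp [hx]

theorem tail_transl (c t : ℝ) (F : X) : tail c (transl t F) = transl t (tail (c - t) F) := by
  unfold tail
  rw [cut_transl]
  congr 2
  exact cut_congr_ae _ _ (.of_eq (Set.ext fun x => by simp [sub_lt_iff_lt_add]))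

/-- Reflection turns the half-line (c,∞) into (-∞,-c), the complement of (-c,∞) up to one point. -/
theorem refl_tail (c : ℝ) (F : X) : refl (tail c F) = refl F - tail (-c) (refl F) := by
  apply ext_ae
  have h := (Measure.measurePreserving_neg (volume : Measure ℝ)).quasiMeasurePreserving.ae_eq_comp
    (toFun_tail c F)
  have hne : ∀ᵐ x : ℝ, x ≠ -c := by simp [ae_iff]
  filter_upwards [toFun_sub (refl F) (tail (-c) (refl F)), toFun_tail (-c) (refl F),
    toFun_refl F, toFun_refl (tail c F), h, hne] with x h1 h2 h3 h4 h5 h6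
  simp only [Function.comp_apply] at h5
  rw [h4, h5, h1, Pi.sub_apply, h2, h3]
  by_cases hx : -c < x
  · have : ¬ c < -x := by linarith
    simp [hx, this, h3]
  · have hx' : c < -x := by
      have := lt_of_le_of_ne (not_lt.1 hx) h6
      linarith
    simp [hx, hx']

end X

/-! ### The Fourier transform on `X_ℝ` -/

/-- It suffices to pair both sides with smooth compactly supported functions. The L² transform is
dual to the transform of Schwartz functions, and the integral transform satisfies the same exchange
formula. -/
theorem fourier_toLp_ae_eq {f : ℝ → ℂ} (h₁ : Integrable f volume) (h₂ : MemLp f 2 volume) :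
    (𝓕 (h₂.toLp f) : Lp ℂ 2 (volume : Measure ℝ)) =ᵐ[volume] 𝓕 f := by
  have hc : Continuous (𝓕 f) := VectorFourier.fourierIntegral_continuous
    Real.continuous_fourierChar (by exact continuous_inner) h₁
  refine ae_eq_of_integral_contDiff_smul_eq
    ((Lp.memLp (𝓕 (h₂.toLp f))).locallyIntegrable (by norm_num)) hc.locallyIntegrable ?_
  intro g g_smooth g_cpt
  have hg₁ : HasCompactSupport (Complex.ofRealCLM ∘ g) := g_cpt.comp_left rfl
  have hg₂ : ContDiff ℝ (⊤ : ℕ∞) (Complex.ofRealCLM ∘ g) := Complex.ofRealCLM.contDiff.comp g_smooth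
  set φ := hg₁.toSchwartzMap hg₂ with hφ
  have hφg : ∀ x, φ x = (g x : ℂ) := fun x => by simp [hφ]
  have e1 : ∫ x, g x • (𝓕 (h₂.toLp f) : Lp ℂ 2 (volume : Measure ℝ)) x
      = ∫ x, 𝓕 φ x • f x := by
    have h := congrArg (fun T => T φ) (Lp.fourier_toTemperedDistribution_eq (h₂.toLp f))
    simp only [TemperedDistribution.fourier_apply, Lp.toTemperedDistribution_apply] at h
    have h' : ∫ x, 𝓕 φ x • (h₂.toLp f) x = ∫ x, 𝓕 φ x • f x := by
      refine integral_congr_ae ?_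
      filter_upwards [h₂.coeFn_toLp] with x hx
      rw [hx]
    rw [← h', h]
    refine integral_congr_ae (Eventually.of_forall fun x => ?_)
    simp [hφg]
  rw [e1, SchwartzMap.fourier_coe]
  have h3 := VectorFourier.integral_fourierIntegral_smul_eq_flip (L := innerₗ ℝ)
    (μ := volume) (ν := volume) Real.continuous_fourierChar
    (by exact continuous_inner) (φ.integrable (μ := volume)) h₁
  rw [flip_innerₗ] at h3
  refine Eq.trans h3 (integral_congr_ae (Eventually.of_forall fun x => ?_))
  simp only [hφg]
  rfl

theorem fourierInv_toLp_ae_eq {f : ℝ → ℂ} (h₁ : Integrable f volume) (h₂ : MemLp f 2 volume) :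
    (𝓕⁻ (h₂.toLp f) : Lp ℂ 2 (volume : Measure ℝ)) =ᵐ[volume] 𝓕⁻ f := by
  have hinv : 𝓕⁻ f = 𝓕 fun x => f (-x) := Real.fourierInv_eq_fourier_comp_neg f
  have h₁' : Integrable (fun x => f (-x)) volume := h₁.comp_neg
  have hc : Continuous (𝓕⁻ f) := hinv ▸ VectorFourier.fourierIntegral_continuous
    Real.continuous_fourierChar (by exact continuous_inner) h₁'
  refine ae_eq_of_integral_contDiff_smul_eq
    ((Lp.memLp (𝓕⁻ (h₂.toLp f))).locallyIntegrable (by norm_num)) hc.locallyIntegrable ?_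
  intro g g_smooth g_cpt
  have hg₁ : HasCompactSupport (Complex.ofRealCLM ∘ g) := g_cpt.comp_left rfl
  have hg₂ : ContDiff ℝ (⊤ : ℕ∞) (Complex.ofRealCLM ∘ g) :=
    Complex.ofRealCLM.contDiff.comp g_smooth
  set φ := hg₁.toSchwartzMap hg₂ with hφ
  have hφg : ∀ x, φ x = (g x : ℂ) := fun x => by simp [hφ]
  have e1 : ∫ x, g x • (𝓕⁻ (h₂.toLp f) : Lp ℂ 2 (volume : Measure ℝ)) x
      = ∫ x, 𝓕⁻ φ x • f x := by
    have h := congrArg (fun T => T φ) (Lp.fourierInv_toTemperedDistribution_eq (h₂.toLp f))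
    simp only [TemperedDistribution.fourierInv_apply, Lp.toTemperedDistribution_apply] at h
    have h' : ∫ x, 𝓕⁻ φ x • (h₂.toLp f) x = ∫ x, 𝓕⁻ φ x • f x := by
      refine integral_congr_ae ?_
      filter_upwards [h₂.coeFn_toLp] with x hx
      rw [hx]
    rw [← h', h]
    refine integral_congr_ae (Eventually.of_forall fun x => ?_)
    simp [hφg]
  -- The substitution x ↦ -x turns the inverse transform of φ into the forward one, so that the
  -- exchange formula applies to φ and f(-x).
  rw [e1, SchwartzMap.fourierInv_coe, ← integral_neg_eq_self]
  have h3 := VectorFourier.integral_fourierIntegral_smul_eq_flip (L := innerₗ ℝ)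
    (μ := volume) (ν := volume) Real.continuous_fourierChar
    (by exact continuous_inner) (φ.integrable (μ := volume)) h₁'
  rw [flip_innerₗ] at h3
  refine Eq.trans (integral_congr_ae (Eventually.of_forall fun x => ?_))
    (Eq.trans h3 (integral_congr_ae (Eventually.of_forall fun x => ?_)))
  · simp only [Real.fourierInv_eq_fourier_neg, neg_neg]
    rfl
  · simp only [hφg, hinv]
    rfl

namespace X

theorem continuous_expI (s : ℝ) : Continuous fun x : ℝ => cexp (-(I * s * x)) := by fun_prop

theorem norm_expI (s x : ℝ) : ‖cexp (-(I * s * x))‖ = 1 := by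
  rw [show -(I * s * x) = ((-(s * x) : ℝ) : ℂ) * I by push_cast; ring]
  exact Complex.norm_exp_ofReal_mul_I _

theorem integrable_toComplex (F : X) : Integrable F.toComplex volume := F.integrable.ofReal

theorem integrable_expI_mul {f : ℝ → ℂ} (hf : Integrable f volume) (s : ℝ) :
    Integrable (fun x : ℝ => cexp (-(I * s * x)) * f x) volume :=
  hf.bdd_mul (continuous_expI s).aestronglyMeasurable
    (Eventually.of_forall fun x => (norm_expI s x).le)

/-- The Fourier transform at frequency `s` as a functional on `X_ℝ`. -/
def ft (s : ℝ) : X →L[ℝ] ℂ :=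
  LinearMap.mkContinuous
    { toFun := fun F => hat F.toComplex s
      map_add' := fun F G => by
        rw [hat, hat, hat, ← integral_add (integrable_expI_mul F.integrable_toComplex s)
          (integrable_expI_mul G.integrable_toComplex s)]
        refine integral_congr_ae ?_
        filter_upwards [toFun_add F G] with x hx
        simp [toComplex, hx, mul_add]
      map_smul' := fun c F => by
        rw [hat, hat, RingHom.id_apply, ← integral_smul]
        refine integral_congr_ae ?_
        filter_upwards [toFun_smul c F] with x hx
        simp [toComplex, hx]
        ring } 1 fun F => by
    rw [one_mul]
    refine le_trans ?_ (norm_toL1_le F)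
    rw [norm_toL1_eq_integral]
    refine (norm_integral_le_integral_norm _).trans_eq ?_
    simp [norm_expI, toComplex]

theorem ft_apply (s : ℝ) (F : X) : ft s F = ∫ x : ℝ, cexp (-(I * s * x)) * (F.toFun x : ℂ) := rfl

theorem norm_ft_le (s : ℝ) (F : X) : ‖ft s F‖ ≤ ‖F‖ := by
  refine le_trans ?_ (norm_toL1_le F)
  rw [norm_toL1_eq_integral, ft_apply]
  refine (norm_integral_le_integral_norm _).trans_eq ?_
  simp [norm_expI]

theorem ft_transl (s t : ℝ) (F : X) : ft s (transl t F) = cexp (-(I * s * t)) * ft s F := by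
  rw [ft_apply, ft_apply, ← integral_const_mul]
  rw [← integral_sub_right_eq_self (fun x : ℝ => cexp (-(I * s * t)) *
    (cexp (-(I * s * x)) * (F.toFun x : ℂ))) t]
  refine integral_congr_ae ?_
  filter_upwards [toFun_transl t F] with x hx
  rw [hx, ← mul_assoc, ← Complex.exp_add]
  congr 2
  push_cast; ring

theorem ft_refl (s : ℝ) (F : X) : ft s (refl F) = conj (ft s F) := by
  rw [ft_apply, ft_apply, ← integral_conj, ← integral_neg_eq_self]
  have h := (Measure.measurePreserving_neg (volume : Measure ℝ)).quasiMeasurePreserving.ae_eq_comp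
    (toFun_refl F)
  refine integral_congr_ae ?_
  filter_upwards [h] with x hx
  simp only [Function.comp_apply, neg_neg] at hx
  rw [hx, map_mul, ← Complex.exp_conj]
  simp

theorem fourier_toComplex (F : X) (t : ℝ) : 𝓕 F.toComplex t = ft (2 * Real.pi * t) F := by
  rw [Real.fourier_real_eq_integral_exp_smul F.toComplex t, ft_apply]
  refine integral_congr_ae (Eventually.of_forall fun x => ?_)
  simp only [smul_eq_mul, toComplex]
  congr 2
  push_cast; ring

theorem memLp_two_toComplex (F : X) : MemLp F.toComplex 2 volume := F.memLp_two.ofReal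

theorem fourier_toLp (F : X) :
    (𝓕 (F.memLp_two_toComplex.toLp) : Lp ℂ 2 (volume : Measure ℝ)) =ᵐ[volume]
      fun t => ft (2 * Real.pi * t) F :=
  (fourier_toLp_ae_eq F.integrable_toComplex F.memLp_two_toComplex).trans
    (Eventually.of_forall fun t => fourier_toComplex F t)

theorem memLp_two_ft_scaled (F : X) : MemLp (fun t : ℝ => ft (2 * Real.pi * t) F) 2 volume :=
  (memLp_congr_ae F.fourier_toLp).1 (Lp.memLp _)

theorem norm_toL2_eq_ft (F : X) :
    ‖toL2 F‖ = (eLpNorm (fun t : ℝ => ft (2 * Real.pi * t) F) 2 volume).toReal := by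
  rw [← eLpNorm_congr_ae F.fourier_toLp, ← Lp.norm_def, Lp.norm_fourier_eq, Lp.norm_toLp,
    norm_toL2_eq]
  congr 1
  refine eLpNorm_congr_norm_ae (Eventually.of_forall fun x => ?_)
  simp [toComplex]

/-- Plancherel. This is how sup |F̂| < 1 becomes a contraction in L². -/
theorem norm_toL2_le_of_norm_ft_le {F G : X} {ρ : ℝ} (hρ : 0 ≤ ρ)
    (h : ∀ s, ‖ft s F‖ ≤ ρ * ‖ft s G‖) : ‖toL2 F‖ ≤ ρ * ‖toL2 G‖ := by
  rw [norm_toL2_eq_ft, norm_toL2_eq_ft, ← ENNReal.toReal_ofReal hρ, ← ENNReal.toReal_mul]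
  refine ENNReal.toReal_mono (ENNReal.mul_ne_top ENNReal.ofReal_ne_top
    G.memLp_two_ft_scaled.eLpNorm_ne_top) ?_
  exact eLpNorm_le_mul_eLpNorm_of_ae_le_mul (Eventually.of_forall fun t => h _) 2

/-- Injectivity of the Fourier transform, by Plancherel. It reduces identities between convolutions
and reflections to identities of numbers for each s. -/
theorem ext_ft {F G : X} (h : ∀ s, ft s F = ft s G) : F = G := by
  have h0 : ‖toL2 (F - G)‖ ≤ 0 * ‖toL2 (0 : X)‖ :=
    norm_toL2_le_of_norm_ft_le le_rfl fun s => by simp [h s]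
  rw [zero_mul, norm_le_zero_iff, map_sub, sub_eq_zero] at h0
  exact toL2_injective h0

theorem memLp_two_ft (F : X) : MemLp (fun s : ℝ => ft s F) 2 volume := by
  have h : (volume : Measure ℝ).map (fun t => 2 * Real.pi * t)
      = ENNReal.ofReal |(2 * Real.pi)⁻¹| • volume := Real.map_volume_mul_left (by positivity)
  have hm := F.memLp_two_ft_scaled
  have e : MeasurableEmbedding fun t : ℝ => 2 * Real.pi * t :=
    (Homeomorph.mulLeft₀ (2 * Real.pi) (by positivity)).measurableEmbedding
  have h2 : MemLp (fun s : ℝ => ft s F) 2 ((volume : Measure ℝ).map (fun t => 2 * Real.pi * t)) :=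
    e.memLp_map_measure_iff.2 hm
  rw [h] at h2
  have h3 := h2.smul_measure (c := ENNReal.ofReal (2 * Real.pi)) ENNReal.ofReal_ne_top
  rwa [smul_smul, ← ENNReal.ofReal_mul (by positivity), abs_of_pos (by positivity),
    mul_inv_cancel₀ (by positivity), ENNReal.ofReal_one, one_smul] at h3

theorem toComplex_ae_fourierPlus (F : X) :
    F.toComplex =ᵐ[volume] fourierPlus fun s => ft s F := by
  have hm := F.memLp_two_ft_scaled
  rw [fourierPlus, dif_pos hm]
  have : hm.toLp = 𝓕 (F.memLp_two_toComplex.toLp) := by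
    refine Lp.ext ?_
    exact hm.coeFn_toLp.trans F.fourier_toLp.symm
  rw [this, FourierTransform.fourierInv_fourier_eq]
  exact F.memLp_two_toComplex.coeFn_toLp.symm

theorem fourierInv_toComplex_refl (F : X) (t : ℝ) :
    𝓕⁻ (refl F).toComplex t = ft (2 * Real.pi * t) F := by
  rw [Real.fourierInv_eq_fourier_neg, fourier_toComplex, ft_refl, ft_apply, ft_apply,
    ← integral_conj]
  refine integral_congr_ae (Eventually.of_forall fun x => ?_)
  simp only [map_mul, ← Complex.exp_conj, conj_ofReal]
  congr 2
  simp [show (starRingEnd ℂ) 2 = 2 from map_ofNat _ 2]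

/-- The kernel of `fourierMinus` has the sign of the transform itself, so applying it to F̂ returns
F(-x). -/
theorem toComplex_refl_ae_fourierMinus (F : X) :
    (refl F).toComplex =ᵐ[volume] fourierMinus fun s => ft s F := by
  have hm := F.memLp_two_ft_scaled
  rw [fourierMinus, dif_pos hm]
  have : hm.toLp = 𝓕⁻ ((refl F).memLp_two_toComplex.toLp) := by
    refine Lp.ext (hm.coeFn_toLp.trans ?_)
    refine EventuallyEq.trans ?_ (fourierInv_toLp_ae_eq (refl F).integrable_toComplex
      (refl F).memLp_two_toComplex).symm
    exact Eventually.of_forall fun t => (fourierInv_toComplex_refl F t).symm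
  rw [this, FourierTransform.fourier_fourierInv_eq]
  exact (refl F).memLp_two_toComplex.coeFn_toLp.symm

end X

/-! ### Indefinite integrals -/

section IsPrim

variable {𝕜 : Type*} [RCLike 𝕜]

/-- `f` is an indefinite integral of the locally integrable function `f'`. -/
structure IsPrim (f f' : ℝ → 𝕜) : Prop where
  intervalIntegrable : ∀ a b, IntervalIntegrable f' volume a b
  sub_eq : ∀ a b, f b - f a = ∫ t in a..b, f' t

namespace IsPrim

variable {f f' g g' : ℝ → 𝕜}

theorem eq_add (hf : IsPrim f f') (a : ℝ) : f = fun x => f a + ∫ t in a..x, f' t := by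
  funext x
  rw [← hf.sub_eq]; ring

theorem locallyIntegrable (hf : IsPrim f f') : LocallyIntegrable f' volume := by
  rw [locallyIntegrable_iff]
  intro K hK
  obtain ⟨r, hr⟩ := hK.isBounded.subset_closedBall 0
  rw [Real.closedBall_eq_Icc] at hr
  refine IntegrableOn.mono_set ?_ hr
  rcases le_or_gt (0 - r) (0 + r) with h | h
  · exact (intervalIntegrable_iff_integrableOn_Icc_of_le h).1 (hf.intervalIntegrable _ _)
  · rw [Set.Icc_eq_empty (not_le.2 h)]
    exact integrableOn_empty

theorem continuous (hf : IsPrim f f') : Continuous f := by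
  rw [hf.eq_add 0]
  exact continuous_const.add
    (intervalIntegral.continuous_primitive (fun a b => hf.intervalIntegrable a b) 0)

theorem ae_hasDerivAt (hf : IsPrim f f') : ∀ᵐ x, HasDerivAt f (f' x) x := by
  filter_upwards [LocallyIntegrable.ae_hasDerivAt_integral hf.locallyIntegrable] with x hx
  have h := (hx 0).const_add (f 0)
  rwa [← hf.eq_add 0] at h

theorem absolutelyContinuousOnInterval (hf : IsPrim f f') (a b : ℝ) :
    AbsolutelyContinuousOnInterval f a b := by
  have h := (hf.intervalIntegrable a b).norm.absolutelyContinuousOnInterval_intervalIntegral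
    (c := a) Set.left_mem_uIcc
  refine squeeze_zero (fun t => Finset.sum_nonneg fun i _ => dist_nonneg) (fun t => ?_) h
  refine Finset.sum_le_sum fun i _ => ?_
  rw [dist_comm, dist_comm (∫ v in a..(t.2 i).1, _), dist_eq_norm, dist_eq_norm, hf.sub_eq,
    intervalIntegral.integral_interval_sub_left (hf.intervalIntegrable _ _).norm
      (hf.intervalIntegrable _ _).norm]
  exact intervalIntegral.norm_integral_le_abs_integral_norm

/-- The product minus the integral of the Leibniz expression is absolutely continuous with
derivative zero almost everywhere, hence constant. The Wronskian identities rest on this. -/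
theorem mul (hf : IsPrim f f') (hg : IsPrim g g') :
    IsPrim (fun x => f x * g x) fun x => f' x * g x + f x * g' x := by
  have hi : ∀ a b, IntervalIntegrable (fun x => f' x * g x + f x * g' x) volume a b := fun a b =>
    ((hf.intervalIntegrable a b).mul_continuousOn hg.continuous.continuousOn).add
      ((hg.intervalIntegrable a b).continuousOn_mul hf.continuous.continuousOn)
  refine ⟨hi, fun a b => ?_⟩
  have hp : IsPrim (fun x => ∫ t in a..x, (f' t * g t + f t * g' t))
      fun x => f' x * g x + f x * g' x :=
    ⟨hi, fun c d => intervalIntegral.integral_interval_sub_left (hi _ _) (hi _ _)⟩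
  have hac : AbsolutelyContinuousOnInterval
      (fun x => f x • g x - ∫ t in a..x, (f' t * g t + f t * g' t)) a b :=
    ((hf.absolutelyContinuousOnInterval a b).fun_smul
      (hg.absolutelyContinuousOnInterval a b)).fun_sub (hp.absolutelyContinuousOnInterval a b)
  obtain ⟨C, hC⟩ := hac.const_of_ae_hasDerivAt_zero (by
    filter_upwards [hf.ae_hasDerivAt, hg.ae_hasDerivAt, hp.ae_hasDerivAt] with x h1 h2 h3 _
    have := (h1.mul h2).sub h3
    rw [sub_self] at this
    exact this)
  have ha := hC a Set.left_mem_uIcc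
  have hb := hC b Set.right_mem_uIcc
  simp only [intervalIntegral.integral_same, sub_zero, smul_eq_mul] at ha hb
  rw [ha, ← hb]
  ring

theorem congr (hf : IsPrim f f') (h : f' = g') : IsPrim f g' := h ▸ hf

theorem congr_fun (hf : IsPrim f f') (h : f = g) : IsPrim g f' := h ▸ hf

theorem add (hf : IsPrim f f') (hg : IsPrim g g') :
    IsPrim (fun x => f x + g x) fun x => f' x + g' x :=
  ⟨fun a b => (hf.intervalIntegrable a b).add (hg.intervalIntegrable a b), fun a b => by
    rw [intervalIntegral.integral_add (hf.intervalIntegrable a b) (hg.intervalIntegrable a b),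
      ← hf.sub_eq, ← hg.sub_eq]; ring⟩

theorem const_mul (c : 𝕜) (hf : IsPrim f f') : IsPrim (fun x => c * f x) fun x => c * f' x :=
  ⟨fun a b => (hf.intervalIntegrable a b).const_mul c, fun a b => by
    rw [intervalIntegral.integral_const_mul, ← hf.sub_eq]; ring⟩

theorem neg (hf : IsPrim f f') : IsPrim (fun x => -f x) fun x => -f' x := by
  simpa using hf.const_mul (-1)

theorem sub (hf : IsPrim f f') (hg : IsPrim g g') :
    IsPrim (fun x => f x - g x) fun x => f' x - g' x := by
  simpa [sub_eq_add_neg] using hf.add hg.neg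

theorem const (c : 𝕜) : IsPrim (fun _ => c) fun _ => 0 := ⟨fun a b => by simp, fun a b => by simp⟩

theorem star (hf : IsPrim f f') : IsPrim (fun x => conj (f x)) fun x => conj (f' x) := by
  refine ⟨fun a b => ?_, fun a b => ?_⟩
  · have := hf.intervalIntegrable a b
    exact ⟨(RCLike.conjCLE (K := 𝕜)).toContinuousLinearMap.integrable_comp this.1,
      (RCLike.conjCLE (K := 𝕜)).toContinuousLinearMap.integrable_comp this.2⟩
  · have := (RCLike.conjCLE (K := 𝕜)).toContinuousLinearMap.intervalIntegral_comp_comm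
      (hf.intervalIntegrable a b)
    rw [← map_sub, hf.sub_eq]
    exact this.symm

theorem comp_neg (hf : IsPrim f f') : IsPrim (fun x => f (-x)) fun x => -f' (-x) := by
  refine ⟨fun a b => ?_, fun a b => ?_⟩
  · have := (hf.intervalIntegrable (-a) (-b)).comp_sub_left 0
    simp only [zero_sub, neg_neg] at this
    exact this.neg
  · rw [intervalIntegral.integral_neg, intervalIntegral.integral_comp_neg, hf.sub_eq,
      intervalIntegral.integral_symm]

theorem of_hasDerivAt (h : ∀ x, HasDerivAt f (f' x) x) (hc : Continuous f') : IsPrim f f' :=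
  ⟨fun a b => hc.intervalIntegrable a b, fun a b =>
    (intervalIntegral.integral_eq_sub_of_hasDerivAt (fun x _ => h x)
      (hc.intervalIntegrable a b)).symm⟩

theorem eq_of_zero (hf : IsPrim f fun _ => 0) (a b : ℝ) : f a = f b := by
  have := hf.sub_eq b a
  simpa [sub_eq_zero] using this

theorem pow (hf : IsPrim f f') (n : ℕ) :
    IsPrim (fun x => f x ^ (n + 1)) fun x => (n + 1) * f x ^ n * f' x := by
  induction n with
  | zero => simpa using hf
  | succ n ih =>
    refine ((ih.mul hf).congr_fun ?_).congr ?_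
    · funext x; ring
    · funext x; push_cast; ring

end IsPrim

theorem isPrim_integral_Ioi {g : ℝ → 𝕜} (hg : Integrable g volume) :
    IsPrim (fun x => ∫ t in Set.Ioi x, g t) fun x => -g x :=
  ⟨fun _ _ => hg.neg.intervalIntegrable, fun a b => by
    rw [intervalIntegral.integral_neg, ← intervalIntegral.integral_Ioi_sub_Ioi' hg.integrableOn
      hg.integrableOn]; ring⟩

/-- `∫_x^∞ |u(t)| (∫_t^∞ |u|)^m dt ≤ (∫_x^∞ |u|)^(m+1) / (m+1)`. -/
theorem integral_abs_mul_tail_pow_le {u : ℝ → ℝ} (hu : Integrable u volume) (m : ℕ) (x : ℝ) :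
    ∫ t in Set.Ioi x, |u t| * (∫ r in Set.Ioi t, |u r|) ^ m ≤
      (∫ r in Set.Ioi x, |u r|) ^ (m + 1) / (m + 1) := by
  set U : ℝ → ℝ := fun t => ∫ r in Set.Ioi t, |u r| with hU
  have hpos : ∀ t, 0 ≤ U t := fun t => integral_nonneg fun r => abs_nonneg _
  have hle : ∀ t, U t ≤ ∫ r, |u r| := fun t =>
    setIntegral_le_integral hu.abs (Eventually.of_forall fun r => abs_nonneg _)
  have hp : IsPrim U fun t => -|u t| := isPrim_integral_Ioi hu.abs
  have hint : Integrable (fun t => |u t| * U t ^ m) volume := by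
    refine hu.abs.mul_bdd (c := (∫ r, |u r|) ^ m)
      ((hp.continuous.pow m).aestronglyMeasurable) (Eventually.of_forall fun t => ?_)
    rw [Real.norm_of_nonneg (pow_nonneg (hpos t) m)]
    exact pow_le_pow_left₀ (hpos t) (hle t) m
  refine le_of_tendsto' (intervalIntegral_tendsto_integral_Ioi x hint.integrableOn tendsto_id) ?_
  intro b
  have h := (hp.pow m).sub_eq x b
  have h2 : ∫ t in x..b, ((m : ℝ) + 1) * U t ^ m * -|u t|
      = -((m : ℝ) + 1) * ∫ t in x..b, |u t| * U t ^ m := by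
    rw [← intervalIntegral.integral_const_mul]
    congr 1; funext t; ring
  rw [h2] at h
  have h3 : 0 ≤ U b ^ (m + 1) := pow_nonneg (hpos b) _
  simp only [id]
  rw [le_div_iff₀ (by positivity)]
  nlinarith

end IsPrim

/-! ### Weighted superpositions of translates -/


/-- 1 - a is a commuting factor of the unit 1 - aⁿ = (1 - a)(1 + a + ⋯ + aⁿ⁻¹). This serves both the
Volterra equation and Wiener's lemma. -/
theorem isUnit_one_sub_of_norm_pow_lt_one {R : Type*} [NormedRing R] [CompleteSpace R] {a : R}
    {n : ℕ} (h : ‖a ^ n‖ < 1) : IsUnit (1 - a) := by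
  have h1 : IsUnit (1 - a ^ n) := (Units.oneSub (a ^ n) h).isUnit
  rw [← mul_neg_geom_sum] at h1
  have hc : Commute (1 - a) (∑ i ∈ Finset.range n, a ^ i) :=
    Commute.sum_right _ _ _ fun i _ =>
      (Commute.one_left _).sub_left ((Commute.refl a).pow_right i)
  exact (hc.isUnit_mul_iff.1 h1).1

theorem analyticAt_clm_apply {E F G : Type*} [NormedAddCommGroup E] [NormedSpace ℝ E]
    [NormedAddCommGroup F] [NormedSpace ℝ F] [NormedAddCommGroup G] [NormedSpace ℝ G]
    {f : E → F →L[ℝ] G} {g : E → F} {x : E} (hf : AnalyticAt ℝ f x) (hg : AnalyticAt ℝ g x) :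
    AnalyticAt ℝ (fun y => f y (g y)) x :=
  ((ContinuousLinearMap.id ℝ (F →L[ℝ] G)).analyticAt_bilinear _).comp₂ hf hg

namespace X

theorem integrable_smul_transl (σ : ℝ) (u : X) (k : ℝ →ᵇ X) :
    Integrable (fun t => u.toFun t • transl (σ * t) (k t)) volume := by
  have hc : Continuous fun t => transl (σ * t) (k t) :=
    continuous_transl.comp ((continuous_const.mul continuous_id).prodMk k.continuous)
  refine u.integrable.smul_bdd ‖k‖ hc.aestronglyMeasurable (Eventually.of_forall fun t => ?_)
  rw [LinearIsometry.norm_map]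
  exact k.norm_coe_le_norm t

theorem norm_integral_smul_transl_le (σ : ℝ) (u : X) (k : ℝ → X) :
    ‖∫ t, u.toFun t • transl (σ * t) (k t)‖ ≤ ∫ t, |u.toFun t| * ‖k t‖ := by
  refine (norm_integral_le_integral_norm _).trans_eq ?_
  simp [norm_smul]

/-- `J_σ(u) k = ∫ u(t) τ_{σt} k(t) dt`. -/
def J (σ : ℝ) : X →L[ℝ] (ℝ →ᵇ X) →L[ℝ] X :=
  LinearMap.mkContinuous₂
    (LinearMap.mk₂ ℝ (fun (u : X) (k : ℝ →ᵇ X) => ∫ t, u.toFun t • transl (σ * t) (k t))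
      (fun u v k => by
        rw [← integral_add (integrable_smul_transl σ u k) (integrable_smul_transl σ v k)]
        refine integral_congr_ae ?_
        filter_upwards [toFun_add u v] with t ht
        rw [ht, Pi.add_apply, add_smul])
      (fun c u k => by
        rw [← integral_smul]
        refine integral_congr_ae ?_
        filter_upwards [toFun_smul c u] with t ht
        rw [ht, Pi.smul_apply, smul_assoc])
      (fun u k l => by
        rw [← integral_add (integrable_smul_transl σ u k) (integrable_smul_transl σ u l)]
        refine integral_congr_ae (Eventually.of_forall fun t => ?_)
        simp [smul_add])
      (fun c u k => by
        rw [← integral_smul]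
        refine integral_congr_ae (Eventually.of_forall fun t => ?_)
        simp [smul_comm c])) 1 fun u k => by
    rw [one_mul, LinearMap.mk₂_apply]
    refine (norm_integral_smul_transl_le σ u k).trans ?_
    refine le_trans ?_ (mul_le_mul_of_nonneg_right (norm_toL1_le u) (norm_nonneg k))
    rw [norm_toL1_eq_integral, ← integral_mul_const]
    refine integral_mono_of_nonneg (Eventually.of_forall fun t => by positivity)
      (u.integrable.abs.mul_const _) (Eventually.of_forall fun t => ?_)
    exact mul_le_mul_of_nonneg_left (k.norm_coe_le_norm t) (abs_nonneg _)

theorem J_apply (σ : ℝ) (u : X) (k : ℝ →ᵇ X) :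
    J σ u k = ∫ t, u.toFun t • transl (σ * t) (k t) := rfl

theorem norm_J_le_integral (σ : ℝ) (u : X) (k : ℝ →ᵇ X) :
    ‖J σ u k‖ ≤ ∫ t, |u.toFun t| * ‖k t‖ := norm_integral_smul_transl_le σ u k

theorem norm_J_le (σ : ℝ) (u : X) (k : ℝ →ᵇ X) : ‖J σ u k‖ ≤ ‖u‖ * ‖k‖ := by
  refine (norm_J_le_integral σ u k).trans ?_
  refine le_trans ?_ (mul_le_mul_of_nonneg_right (norm_toL1_le u) (norm_nonneg k))
  rw [norm_toL1_eq_integral, ← integral_mul_const]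
  refine integral_mono_of_nonneg (Eventually.of_forall fun t => by positivity)
    (u.integrable.abs.mul_const _) (Eventually.of_forall fun t => ?_)
  exact mul_le_mul_of_nonneg_left (k.norm_coe_le_norm t) (abs_nonneg _)

theorem ft_J (s σ : ℝ) (u : X) (k : ℝ →ᵇ X) :
    ft s (J σ u k) = ∫ t : ℝ, (u.toFun t : ℂ) * (cexp (-(I * s * (σ * t))) * ft s (k t)) := by
  rw [J_apply, ← ContinuousLinearMap.integral_comp_comm _ (integrable_smul_transl σ u k)]
  refine integral_congr_ae (Eventually.of_forall fun t => ?_)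
  simp only [map_smul, ft_transl, Complex.real_smul]
  push_cast
  ring

theorem integral_tail_smul {E : Type*} [NormedAddCommGroup E] [NormedSpace ℝ E] (x : ℝ) (u : X)
    (g : ℝ → E) :
    ∫ t, (tail x u).toFun t • g t = ∫ t in Set.Ioi x, u.toFun t • g t := by
  rw [← integral_indicator measurableSet_Ioi]
  refine integral_congr_ae ?_
  filter_upwards [toFun_tail x u] with t ht
  rw [ht]
  by_cases h : t ∈ Set.Ioi x <;> simp [h]

/-- The function `x ↦ 1_{(x,∞)} u`. -/
def tails : X →L[ℝ] (ℝ →ᵇ X) :=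
  LinearMap.mkContinuous
    { toFun := fun u => BoundedContinuousFunction.ofNormedAddCommGroup (fun x => tail x u)
        (continuous_tail u) ‖u‖ fun x => norm_tail_le x u
      map_add' := fun u v => by ext1 x; exact map_add (tail x) u v
      map_smul' := fun c u => by ext1 x; exact map_smul (tail x) c u } 1 fun u => by
    rw [one_mul]
    exact BoundedContinuousFunction.norm_ofNormedAddCommGroup_le _ (norm_nonneg _)
      fun x => norm_tail_le x u

theorem tails_apply (u : X) (x : ℝ) : tails u x = tail x u := rfl

theorem norm_J_tail_le (σ : ℝ) (u : X) (k : ℝ →ᵇ X) (x : ℝ) :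
    ‖J σ (tail x u) k‖ ≤ ‖u‖ * ‖k‖ :=
  (norm_J_le σ (tail x u) k).trans
    (mul_le_mul_of_nonneg_right (norm_tail_le x u) (norm_nonneg k))

/-- The Volterra operator `(V_σ(u) k)(x) = ∫_x^∞ u(t) τ_{σt} k(t) dt`. -/
def volterra (σ : ℝ) : X →L[ℝ] (ℝ →ᵇ X) →L[ℝ] (ℝ →ᵇ X) :=
  LinearMap.mkContinuous₂
    (LinearMap.mk₂ ℝ (fun (u : X) (k : ℝ →ᵇ X) =>
      BoundedContinuousFunction.ofNormedAddCommGroup (fun x => J σ (tail x u) k)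
        (((J σ).flip k).continuous.comp (continuous_tail u)) (‖u‖ * ‖k‖)
        (norm_J_tail_le σ u k))
      (fun u v k => by
        ext1 x
        simp [map_add]
        rfl)
      (fun c u k => by
        ext1 x
        simp [map_smul]
        rfl)
      (fun u k l => by
        ext1 x
        simp [map_add]
        rfl)
      (fun c u k => by
        ext1 x
        simp [map_smul]
        rfl)) 1 fun u k => by
    rw [one_mul]
    exact BoundedContinuousFunction.norm_ofNormedAddCommGroup_le _ (by positivity)
      (norm_J_tail_le σ u k)

theorem volterra_apply (σ : ℝ) (u : X) (k : ℝ →ᵇ X) (x : ℝ) :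
    volterra σ u k x = J σ (tail x u) k := rfl

/-- With U(t) = ∫_t^∞ |u| one has U' = -|u| almost everywhere, so integrating |u| U^m / m! over
(x,∞) raises both exponent and factorial by one. Translations are isometries, so σ does not enter.
-/
theorem norm_volterra_apply_le (σ : ℝ) (u : X) (k : ℝ →ᵇ X) {c : ℝ} {m : ℕ} (hc : 0 ≤ c)
    (hk : ∀ t, ‖k t‖ ≤ c * ((∫ r in Set.Ioi t, |u.toFun r|) ^ m / m.factorial)) (x : ℝ) :
    ‖volterra σ u k x‖ ≤
      c * ((∫ r in Set.Ioi x, |u.toFun r|) ^ (m + 1) / (m + 1).factorial) := by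
  set U : ℝ → ℝ := fun t => ∫ r in Set.Ioi t, |u.toFun r| with hU
  have hUc : Continuous U := (isPrim_integral_Ioi u.integrable.abs).continuous
  have hpos : ∀ t, 0 ≤ U t := fun t => integral_nonneg fun r => abs_nonneg _
  have hle : ∀ t, U t ≤ ∫ r, |u.toFun r| := fun t =>
    setIntegral_le_integral u.integrable.abs (Eventually.of_forall fun r => abs_nonneg _)
  have hint : Integrable (fun t => |u.toFun t| * U t ^ m) volume := by
    refine u.integrable.abs.mul_bdd (c := (∫ r, |u.toFun r|) ^ m)
      ((hUc.pow m).aestronglyMeasurable) (Eventually.of_forall fun t => ?_)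
    rw [Real.norm_of_nonneg (pow_nonneg (hpos t) m)]
    exact pow_le_pow_left₀ (hpos t) (hle t) m
  have h1 : ‖volterra σ u k x‖ ≤ ∫ t in Set.Ioi x, |u.toFun t| * ‖k t‖ := by
    rw [volterra_apply]
    refine (norm_J_le_integral σ _ k).trans_eq ?_
    rw [← integral_indicator measurableSet_Ioi]
    refine integral_congr_ae ?_
    filter_upwards [toFun_tail x u] with t ht
    rw [ht]
    by_cases h : t ∈ Set.Ioi x <;> simp [h]
  have h2 : ∫ t in Set.Ioi x, |u.toFun t| * ‖k t‖ ≤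
      ∫ t in Set.Ioi x, c / m.factorial * (|u.toFun t| * U t ^ m) := by
    refine integral_mono_of_nonneg (Eventually.of_forall fun t => by positivity)
      (hint.const_mul _).integrableOn (Eventually.of_forall fun t => ?_)
    refine (mul_le_mul_of_nonneg_left (hk t) (abs_nonneg _)).trans_eq ?_
    ring
  rw [integral_const_mul] at h2
  refine h1.trans (h2.trans ?_)
  refine (mul_le_mul_of_nonneg_left (integral_abs_mul_tail_pow_le u.integrable m x)
    (by positivity)).trans_eq ?_
  rw [Nat.factorial_succ]
  push_cast
  field_simp

/-! ### The kernels of the Jost solutions -/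

/-- The operator `V₋(u) V₊(u)`. -/
def volterraSq (u : X) : (ℝ →ᵇ X) →L[ℝ] (ℝ →ᵇ X) := (volterra (-1) u).comp (volterra 1 u)

theorem norm_volterraSq_pow_apply_le (u : X) (k : ℝ →ᵇ X) (n : ℕ) (x : ℝ) :
    ‖(volterraSq u ^ n) k x‖ ≤
      ‖k‖ * ((∫ r in Set.Ioi x, |u.toFun r|) ^ (2 * n) / (2 * n).factorial) := by
  induction n generalizing x with
  | zero => simpa using k.norm_coe_le_norm x
  | succ n ih =>
    rw [pow_succ']
    exact norm_volterra_apply_le (-1) u _ (norm_nonneg k)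
      (norm_volterra_apply_le 1 u _ (norm_nonneg k) ih) x

theorem tendsto_volterraSq_pow (u : X) : Tendsto (fun n => volterraSq u ^ n) atTop (𝓝 0) := by
  rw [tendsto_zero_iff_norm_tendsto_zero]
  have h := (FloorSemiring.tendsto_pow_div_factorial_atTop (∫ r, |u.toFun r|)).comp
    (tendsto_id.const_mul_atTop' (r := 2) two_pos)
  refine squeeze_zero (fun n => norm_nonneg _) (fun n => ?_) h
  have hI : 0 ≤ ∫ r, |u.toFun r| := integral_nonneg fun r => abs_nonneg _
  refine ContinuousLinearMap.opNorm_le_bound _ (by simp; positivity) fun k => ?_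
  refine (BoundedContinuousFunction.norm_le (by simp; positivity)).2 fun x => ?_
  refine (norm_volterraSq_pow_apply_le u k n x).trans ?_
  rw [mul_comm]
  refine mul_le_mul_of_nonneg_right ?_ (norm_nonneg _)
  simp only [Function.comp_apply, id]
  have h0 : 0 ≤ ∫ r in Set.Ioi x, |u.toFun r| := integral_nonneg fun r => abs_nonneg _
  have hle : ∫ r in Set.Ioi x, |u.toFun r| ≤ ∫ r, |u.toFun r| :=
    setIntegral_le_integral u.integrable.abs (Eventually.of_forall fun r => abs_nonneg _)
  exact div_le_div_of_nonneg_right (pow_le_pow_left₀ h0 hle _) (by positivity)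

/-- The powers decay like those of a Volterra operator, so some power has norm below 1 without any
smallness of u. -/
theorem isUnit_one_sub_volterraSq (u : X) : IsUnit (1 - volterraSq u) := by
  have h := (tendsto_volterraSq_pow u).norm
  rw [norm_zero] at h
  obtain ⟨n, hn⟩ := (h.eventually (gt_mem_nhds one_pos)).exists
  exact isUnit_one_sub_of_norm_pow_lt_one hn

/-- The diagonal kernel `k₁`, whose Fourier transform is `conj (Ψ₊)₁₁ e^{isx/2} - 1`. -/
def ker₁ (u : X) : ℝ →ᵇ X :=
  Ring.inverse (1 - volterraSq u) (volterra (-1) u (tails u))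

/-- The off-diagonal kernel `k₂`. -/
def ker₂ (u : X) : ℝ →ᵇ X := -(tails u + volterra 1 u (ker₁ u))

/-- The coupled system is k₁ = -V₋k₂, k₂ = -(1_{(x,∞)}u + V₊k₁). Eliminating k₂ gives the equation
(1 - V₋V₊)k₁ = V₋(1_{(x,∞)}u) that defines `ker₁`. -/
theorem ker₁_eq (u : X) : ker₁ u = -volterra (-1) u (ker₂ u) := by
  have h : (1 - volterraSq u) (ker₁ u) = volterra (-1) u (tails u) := by
    rw [ker₁, ← mul_apply_eq_comp,
      Ring.mul_inverse_cancel _ (isUnit_one_sub_volterraSq u)]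
    rfl
  have h2 : (1 - volterraSq u) (ker₁ u)
      = ker₁ u - volterra (-1) u (volterra 1 u (ker₁ u)) := rfl
  rw [h2, sub_eq_iff_eq_add] at h
  rw [ker₂, map_neg, neg_neg, map_add]
  exact h

theorem ker₁_apply (u : X) (x : ℝ) : ker₁ u x = -J (-1) (tail x u) (ker₂ u) := by
  conv_lhs => rw [ker₁_eq]
  rfl

theorem ker₂_apply (u : X) (x : ℝ) : ker₂ u x = -(tail x u + J 1 (tail x u) (ker₁ u)) := rfl

/-- A closed subspace invariant under `V₋V₊` which contains `V₋ 1_{(x,∞)}u` contains `k₁`. -/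
theorem ker₁_mem (u : X) (S : Submodule ℝ (ℝ →ᵇ X)) (hS : IsClosed (S : Set (ℝ →ᵇ X)))
    (h0 : volterra (-1) u (tails u) ∈ S) (hV : ∀ k ∈ S, volterraSq u k ∈ S) : ker₁ u ∈ S := by
  set b := volterra (-1) u (tails u) with hb
  have hpow : ∀ n, (volterraSq u ^ n) b ∈ S := fun n => by
    induction n with
    | zero => simpa using h0
    | succ n ih => rw [pow_succ']; exact hV _ ih
  have hs : ∀ n : ℕ, (∑ i ∈ Finset.range n, volterraSq u ^ i) b ∈ S := fun n => by
    rw [_root_.sum_apply]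
    exact S.sum_mem fun i _ => hpow i
  have he : ∀ n : ℕ, (∑ i ∈ Finset.range n, volterraSq u ^ i) b
      = (1 - volterraSq u ^ n) (ker₁ u) := fun n => by
    rw [← geom_sum_mul_neg, mul_apply_eq_comp]
    congr 1
    rw [ker₁, ← mul_apply_eq_comp (1 - volterraSq u),
      Ring.mul_inverse_cancel _ (isUnit_one_sub_volterraSq u)]
    rfl
  have ht : Tendsto (fun n : ℕ => (1 - volterraSq u ^ n) (ker₁ u)) atTop (𝓝 (ker₁ u)) := by
    have h1 := (tendsto_const_nhds (x := (1 : (ℝ →ᵇ X) →L[ℝ] (ℝ →ᵇ X)))).sub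
      (tendsto_volterraSq_pow u)
    have h2 := ((ContinuousLinearMap.apply ℝ (ℝ →ᵇ X) (ker₁ u)).continuous.tendsto _).comp h1
    rw [sub_zero] at h2
    exact h2
  exact hS.mem_of_tendsto ht (Eventually.of_forall fun n => he n ▸ hs n)

theorem tail_J_eq_self {c σ : ℝ} {u : X} {k : ℝ →ᵇ X}
    (h : ∀ᵐ t, u.toFun t ≠ 0 → tail c (transl (σ * t) (k t)) = transl (σ * t) (k t)) :
    tail c (J σ u k) = J σ u k := by
  rw [J_apply, ← ContinuousLinearMap.integral_comp_comm _ (integrable_smul_transl σ u k)]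
  refine integral_congr_ae ?_
  filter_upwards [h] with t ht
  rw [map_smul]
  by_cases h0 : u.toFun t = 0
  · simp [h0]
  · rw [ht h0]

theorem lt_of_toFun_tail_ne_zero (x : ℝ) (u : X) : ∀ᵐ t, (tail x u).toFun t ≠ 0 → x < t := by
  filter_upwards [toFun_tail x u] with t ht h
  by_contra hx
  exact h (by rw [ht]; simp [not_lt.1 hx])

/-- Only t > x contribute, and translation by such t moves [0,∞) into [x,∞). -/
theorem tail_volterra_one {u : X} {k : ℝ →ᵇ X} (hk : ∀ t, tail 0 (k t) = k t) (x : ℝ) :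
    tail x (volterra 1 u k x) = volterra 1 u k x := by
  rw [volterra_apply]
  refine tail_J_eq_self ?_
  filter_upwards [lt_of_toFun_tail_ne_zero x u] with t ht h
  rw [one_mul, tail_transl, ← hk t, tail_tail, max_eq_right (by linarith [ht h])]

/-- Translation by -t moves [t,∞) exactly onto [0,∞). -/
theorem tail_volterra_neg_one {u : X} {k : ℝ →ᵇ X} (hk : ∀ t, tail t (k t) = k t) (x : ℝ) :
    tail 0 (volterra (-1) u k x) = volterra (-1) u k x := by
  rw [volterra_apply]
  refine tail_J_eq_self (Eventually.of_forall fun t _ => ?_)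
  rw [tail_transl, show (0 : ℝ) - -1 * t = t by ring, hk t]

/-- Support in [0,∞) is a closed condition preserved by V₋V₊: V₊ takes it to support in [x,∞), and
V₋ takes it back. -/
theorem tail_ker₁ (u : X) (x : ℝ) : tail 0 (ker₁ u x) = ker₁ u x := by
  let S : Submodule ℝ (ℝ →ᵇ X) :=
    { carrier := {k | ∀ x, tail 0 (k x) = k x}
      zero_mem' := fun x => map_zero _
      add_mem' := fun {k l} hk hl x => by
        rw [BoundedContinuousFunction.add_apply, map_add, hk x, hl x]
      smul_mem' := fun c k hk x => by
        rw [BoundedContinuousFunction.smul_apply, map_smul, hk x] }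
  have hS : IsClosed (S : Set (ℝ →ᵇ X)) := by
    have : (S : Set (ℝ →ᵇ X)) = ⋂ x, {k : ℝ →ᵇ X | tail 0 (k x) = k x} := by
      ext k; rw [Set.mem_iInter]; exact Iff.rfl
    rw [this]
    exact isClosed_iInter fun x => isClosed_eq
      ((tail 0).continuous.comp (BoundedContinuousFunction.evalCLM ℝ x).continuous)
      (BoundedContinuousFunction.evalCLM ℝ x).continuous
  refine ker₁_mem u S hS ?_ ?_ x
  · exact fun x => tail_volterra_neg_one (fun t => by rw [tails_apply, tail_tail, max_self]) x
  · exact fun k hk x => tail_volterra_neg_one (fun t => tail_volterra_one hk t) x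

theorem tail_ker₂ (u : X) (x : ℝ) : tail x (ker₂ u x) = ker₂ u x := by
  have h := tail_volterra_one (u := u) (tail_ker₁ u) x
  rw [volterra_apply] at h
  rw [ker₂_apply, map_neg, map_add, tail_tail, max_self, h]

/-! ### Limits of the kernels at both ends, and analytic dependence on the potential -/

/-- The limit of `k₁` at `-∞`. -/
def alpha (u : X) : X := -J (-1) u (ker₂ u)

/-- Minus the limit of `k₂` at `-∞`. -/
def beta (u : X) : X := u + J 1 u (ker₁ u)

theorem tendsto_ker₁_atBot (u : X) : Tendsto (ker₁ u) atBot (𝓝 (alpha u)) := by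
  refine Tendsto.congr (fun x => (ker₁_apply u x).symm) ?_
  exact ((((J (-1)).flip (ker₂ u)).continuous.tendsto u).comp (tendsto_tail_atBot u)).neg

theorem tendsto_ker₁_atTop (u : X) : Tendsto (ker₁ u) atTop (𝓝 0) := by
  refine Tendsto.congr (fun x => (ker₁_apply u x).symm) ?_
  have := ((((J (-1)).flip (ker₂ u)).continuous.tendsto 0).comp (tendsto_tail_atTop u)).neg
  rw [map_zero, neg_zero] at this
  exact this

theorem tendsto_ker₂_atBot (u : X) : Tendsto (ker₂ u) atBot (𝓝 (-beta u)) := by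
  refine Tendsto.congr (fun x => (ker₂_apply u x).symm) ?_
  exact ((tendsto_tail_atBot u).add
    ((((J 1).flip (ker₁ u)).continuous.tendsto u).comp (tendsto_tail_atBot u))).neg

theorem tendsto_ker₂_atTop (u : X) : Tendsto (ker₂ u) atTop (𝓝 0) := by
  refine Tendsto.congr (fun x => (ker₂_apply u x).symm) ?_
  have := ((tendsto_tail_atTop u).add
    ((((J 1).flip (ker₁ u)).continuous.tendsto 0).comp (tendsto_tail_atTop u))).neg
  rw [map_zero, add_zero, neg_zero] at this
  exact this

theorem tail_alpha (u : X) : tail 0 (alpha u) = alpha u :=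
  tendsto_nhds_unique (((tail 0).continuous.tendsto _).comp (tendsto_ker₁_atBot u))
    ((tendsto_ker₁_atBot u).congr fun x => (tail_ker₁ u x).symm)

/-- Inversion in a Banach algebra is analytic on units; all other ingredients are bounded linear or
bilinear in u. -/
theorem analyticAt_ker₁ (u : X) : AnalyticAt ℝ ker₁ u := by
  have hV : ∀ σ, AnalyticAt ℝ (volterra σ) u := fun σ => (volterra σ).analyticAt u
  have hsq : AnalyticAt ℝ volterraSq u :=
    ((ContinuousLinearMap.compL ℝ (ℝ →ᵇ X) (ℝ →ᵇ X) (ℝ →ᵇ X)).analyticAt_bilinear _).comp₂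
      (hV (-1)) (hV 1)
  have hinv : AnalyticAt ℝ (fun u : X => Ring.inverse (1 - volterraSq u)) u := by
    obtain ⟨z, hz⟩ := isUnit_one_sub_volterraSq u
    have h := analyticAt_inverse (𝕜 := ℝ) z
    rw [hz] at h
    exact h.comp (f := fun u : X => 1 - volterraSq u) (analyticAt_const.sub hsq)
  have hb : AnalyticAt ℝ (fun u : X => volterra (-1) u (tails u)) u :=
    analyticAt_clm_apply (hV (-1)) (tails.analyticAt u)
  exact analyticAt_clm_apply hinv hb

theorem analyticAt_ker₂ (u : X) : AnalyticAt ℝ ker₂ u :=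
  ((tails.analyticAt u).add (analyticAt_clm_apply ((volterra 1).analyticAt u) (analyticAt_ker₁ u))).neg

theorem analyticAt_alpha (u : X) : AnalyticAt ℝ alpha u :=
  (analyticAt_clm_apply ((J (-1)).analyticAt u) (analyticAt_ker₂ u)).neg

theorem analyticAt_beta (u : X) : AnalyticAt ℝ beta u :=
  analyticAt_id.add (analyticAt_clm_apply ((J 1).analyticAt u) (analyticAt_ker₁ u))

end X

/-! ### The ZS-AKNS system in the rotating frame -/


/-- `y' = u e^{isx} z`, `z' = u e^{-isx} y`, in integrated form. -/
structure IsRotSol (u : ℝ → ℝ) (s : ℝ) (y z : ℝ → ℂ) : Prop where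
  fst : IsPrim y fun x => (u x : ℂ) * (cexp (I * s * x) * z x)
  snd : IsPrim z fun x => (u x : ℂ) * (cexp (-(I * s * x)) * y x)

namespace IsRotSol

variable {u : ℝ → ℝ} {s : ℝ} {y z y₁ z₁ y₂ z₂ : ℝ → ℂ}

theorem conj_exp (s x : ℝ) : conj (cexp (I * s * x)) = cexp (-(I * s * x)) := by
  rw [← Complex.exp_conj]; simp

theorem conj_exp_neg (s x : ℝ) : conj (cexp (-(I * s * x))) = cexp (I * s * x) := by
  rw [← Complex.exp_conj]; simp

theorem star (h : IsRotSol u s y z) : IsRotSol u s (fun x => conj (z x)) fun x => conj (y x) where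
  fst := h.snd.star.congr (by
    funext x; simp only [map_mul, conj_exp_neg, conj_ofReal])
  snd := h.fst.star.congr (by
    funext x; simp only [map_mul, conj_exp, conj_ofReal])

theorem add (h₁ : IsRotSol u s y₁ z₁) (h₂ : IsRotSol u s y₂ z₂) :
    IsRotSol u s (fun x => y₁ x + y₂ x) fun x => z₁ x + z₂ x where
  fst := (h₁.fst.add h₂.fst).congr (by funext x; ring)
  snd := (h₁.snd.add h₂.snd).congr (by funext x; ring)

theorem const_mul (c : ℂ) (h : IsRotSol u s y z) :
    IsRotSol u s (fun x => c * y x) fun x => c * z x where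
  fst := (h.fst.const_mul c).congr (by funext x; ring)
  snd := (h.snd.const_mul c).congr (by funext x; ring)

theorem sub (h₁ : IsRotSol u s y₁ z₁) (h₂ : IsRotSol u s y₂ z₂) :
    IsRotSol u s (fun x => y₁ x - y₂ x) fun x => z₁ x - z₂ x := by
  simpa [sub_eq_add_neg] using h₁.add (h₂.const_mul (-1))

/-- The coefficient matrix in the rotating frame has zero trace, so the determinant of two solutions
is constant. -/
theorem wronskian (h₁ : IsRotSol u s y₁ z₁) (h₂ : IsRotSol u s y₂ z₂) (a b : ℝ) :
    y₁ a * z₂ a - z₁ a * y₂ a = y₁ b * z₂ b - z₁ b * y₂ b := by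
  have h := ((h₁.fst.mul h₂.snd).sub (h₁.snd.mul h₂.fst)).congr (g' := fun _ => 0) (by
    funext x; ring)
  exact h.eq_of_zero a b

/-- Reflection `x ↦ -x`, `u(x) ↦ -u(-x)`. -/
theorem comp_neg {v : ℝ → ℝ} (h : IsRotSol u s y z) (hv : ∀ᵐ x, v x = -u (-x)) :
    IsRotSol v s (fun x => conj (y (-x))) fun x => conj (z (-x)) := by
  have h1 := h.fst.comp_neg.star
  have h2 := h.snd.comp_neg.star
  have e1 : (fun x => conj (-((u (-x) : ℂ) * (cexp (I * s * (-x : ℝ)) * z (-x))))) =ᵐ[volume]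
      fun x => (v x : ℂ) * (cexp (I * s * x) * conj (z (-x))) := by
    filter_upwards [hv] with x hx
    simp only [map_neg, map_mul, conj_exp, conj_ofReal, hx]
    push_cast
    ring_nf
  have e2 : (fun x => conj (-((u (-x) : ℂ) * (cexp (-(I * s * (-x : ℝ))) * y (-x))))) =ᵐ[volume]
      fun x => (v x : ℂ) * (cexp (-(I * s * x)) * conj (y (-x))) := by
    filter_upwards [hv] with x hx
    simp only [map_neg, map_mul, conj_exp_neg, conj_ofReal, hx]
    push_cast
    ring_nf
  refine ⟨⟨fun a b => (h1.intervalIntegrable a b).congr_ae (ae_restrict_of_ae e1), fun a b => ?_⟩,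
    ⟨fun a b => (h2.intervalIntegrable a b).congr_ae (ae_restrict_of_ae e2), fun a b => ?_⟩⟩
  · rw [h1.sub_eq]
    exact intervalIntegral.integral_congr_ae (e1.mono fun x hx _ => hx)
  · rw [h2.sub_eq]
    exact intervalIntegral.integral_congr_ae (e2.mono fun x hx _ => hx)

end IsRotSol

namespace X

/-- The first component of the Jost solution in the rotating frame. -/
def jost₁ (u : X) (s x : ℝ) : ℂ := 1 + ft s (ker₁ u x)

/-- The second component of the Jost solution in the rotating frame. -/
def jost₂ (u : X) (s x : ℝ) : ℂ := ft s (ker₂ u x)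

theorem integrable_mul_ft (s σ : ℝ) (u : X) (k : ℝ →ᵇ X) :
    Integrable (fun t : ℝ => (u.toFun t : ℂ) * (cexp (-(I * s * (σ * t))) * ft s (k t))) volume := by
  have h := (ft s).integrable_comp (integrable_smul_transl σ u k)
  refine h.congr (Eventually.of_forall fun t => ?_)
  simp only [map_smul, ft_transl, Complex.real_smul]
  push_cast
  ring

/-- These are the Fourier transforms of the Volterra equations: `ft s` replaces translation by σt
with the factor e^{-isσt}, leaving integrals over (x,∞) with the integrands of the rotating system.
-/
theorem isRotSol_jost (u : X) (s : ℝ) : IsRotSol u.toFun s (jost₁ u s) (jost₂ u s) where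
  fst := by
    have hi := integrable_mul_ft s (-1) u (ker₂ u)
    have h := (IsPrim.const (1 : ℂ)).add (isPrim_integral_Ioi hi).neg
    refine (h.congr_fun ?_).congr ?_
    · funext x
      rw [jost₁, ker₁_apply, map_neg, ft_J]
      congr 2
      have h2 := integral_tail_smul x u fun t : ℝ => cexp (-(I * s * ((-1 : ℝ) * t))) * ft s (ker₂ u t)
      simp only [Complex.real_smul] at h2
      exact h2.symm
    · funext x
      simp only [zero_add, neg_neg, jost₂]
      congr 3
      push_cast; ring
  snd := by
    have hi := integrable_mul_ft s 1 u (ker₁ u)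
    have hi0 := integrable_expI_mul u.integrable_toComplex s
    have h := ((isPrim_integral_Ioi hi0).add (isPrim_integral_Ioi hi)).neg
    refine (h.congr_fun ?_).congr ?_
    · funext x
      rw [jost₂, ker₂_apply, map_neg, map_add, ft_J, ft_apply]
      congr 2
      · have h2 := integral_tail_smul x u fun t : ℝ => cexp (-(I * s * t))
        simp only [Complex.real_smul, toComplex] at h2 ⊢
        simp only [mul_comm (cexp _)]
        exact h2.symm
      · have h2 := integral_tail_smul x u fun t : ℝ => cexp (-(I * s * ((1 : ℝ) * t))) * ft s (ker₁ u t)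
        simp only [Complex.real_smul] at h2
        exact h2.symm
    · funext x
      simp only [jost₁, toComplex]
      push_cast
      rw [one_mul]
      ring

theorem tendsto_jost₁_atTop (u : X) (s : ℝ) : Tendsto (jost₁ u s) atTop (𝓝 1) := by
  have := (((ft s).continuous.tendsto _).comp (tendsto_ker₁_atTop u)).const_add 1
  rw [map_zero, add_zero] at this
  exact this

theorem tendsto_jost₂_atTop (u : X) (s : ℝ) : Tendsto (jost₂ u s) atTop (𝓝 0) := by
  have := ((ft s).continuous.tendsto _).comp (tendsto_ker₂_atTop u)
  rw [map_zero] at this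
  exact this

theorem tendsto_jost₁_atBot (u : X) (s : ℝ) :
    Tendsto (jost₁ u s) atBot (𝓝 (1 + ft s (alpha u))) :=
  (((ft s).continuous.tendsto _).comp (tendsto_ker₁_atBot u)).const_add 1

theorem tendsto_jost₂_atBot (u : X) (s : ℝ) : Tendsto (jost₂ u s) atBot (𝓝 (-ft s (beta u))) := by
  have := ((ft s).continuous.tendsto _).comp (tendsto_ker₂_atBot u)
  rw [map_neg] at this
  exact this

theorem tendsto_mul_conj_self {l : Filter ℝ} {f : ℝ → ℂ} {a : ℂ} (h : Tendsto f l (𝓝 a)) :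
    Tendsto (fun x => f x * conj (f x)) l (𝓝 (a * conj a)) :=
  h.mul ((Complex.continuous_conj.tendsto a).comp h)

/-- The Wronskian of the Jost solution with its conjugated and swapped partner is constant, with
value 1 at +∞. -/
theorem jost_det (u : X) (s x : ℝ) :
    jost₁ u s x * conj (jost₁ u s x) - jost₂ u s x * conj (jost₂ u s x) = 1 := by
  have h := (isRotSol_jost u s).wronskian (isRotSol_jost u s).star
  have ht := (tendsto_mul_conj_self (tendsto_jost₁_atTop u s)).sub
    (tendsto_mul_conj_self (tendsto_jost₂_atTop u s))
  have hc : Tendsto (fun y => jost₁ u s y * conj (jost₁ u s y) - jost₂ u s y * conj (jost₂ u s y))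
      atTop (𝓝 (jost₁ u s x * conj (jost₁ u s x) - jost₂ u s x * conj (jost₂ u s x))) :=
    tendsto_const_nhds.congr fun y => h x y
  simpa using tendsto_nhds_unique hc ht

/-- The constant Wronskian `jost_det` evaluated at -∞; this is |a|² - |b|² = 1. -/
theorem alpha_beta_det (u : X) (s : ℝ) :
    (1 + ft s (alpha u)) * conj (1 + ft s (alpha u)) - ft s (beta u) * conj (ft s (beta u)) = 1 := by
  have ht := (tendsto_mul_conj_self (tendsto_jost₁_atBot u s)).sub
    (tendsto_mul_conj_self (tendsto_jost₂_atBot u s))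
  have hc : Tendsto (fun y => jost₁ u s y * conj (jost₁ u s y) - jost₂ u s y * conj (jost₂ u s y))
      atBot (𝓝 1) := tendsto_const_nhds.congr fun y => (jost_det u s y).symm
  simpa using (tendsto_nhds_unique hc ht).symm

theorem one_le_norm_one_add_ft_alpha (u : X) (s : ℝ) : 1 ≤ ‖1 + ft s (alpha u)‖ := by
  have h := alpha_beta_det u s
  rw [Complex.mul_conj, Complex.mul_conj, Complex.normSq_eq_norm_sq, Complex.normSq_eq_norm_sq] at h
  have h' : ‖1 + ft s (alpha u)‖ ^ 2 - ‖ft s (beta u)‖ ^ 2 = 1 := by exact_mod_cast h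
  nlinarith [sq_nonneg ‖ft s (beta u)‖, norm_nonneg (1 + ft s (alpha u))]

/-- A solution which vanishes at one end of the line, where the Jost solution is bounded, vanishes
identically. -/
theorem rotSol_eq_zero {u : X} {s : ℝ} {y z : ℝ → ℂ} (h : IsRotSol u.toFun s y z) {l : Filter ℝ}
    [l.NeBot] {a b : ℂ} (h1 : Tendsto (jost₁ u s) l (𝓝 a)) (h2 : Tendsto (jost₂ u s) l (𝓝 b))
    (hy : Tendsto y l (𝓝 0)) (hz : Tendsto z l (𝓝 0)) (x : ℝ) : y x = 0 ∧ z x = 0 := by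
  have hJ := isRotSol_jost u s
  have w1 : y x * jost₂ u s x - z x * jost₁ u s x = 0 := by
    have ht := (hy.mul h2).sub (hz.mul h1)
    rw [zero_mul, zero_mul, sub_zero] at ht
    exact tendsto_nhds_unique (tendsto_const_nhds.congr fun t => h.wronskian hJ x t) ht
  have w2 : y x * conj (jost₁ u s x) - z x * conj (jost₂ u s x) = 0 := by
    have ht := (hy.mul ((Complex.continuous_conj.tendsto a).comp h1)).sub
      (hz.mul ((Complex.continuous_conj.tendsto b).comp h2))
    rw [zero_mul, zero_mul, sub_zero] at ht
    exact tendsto_nhds_unique (tendsto_const_nhds.congr fun t => h.wronskian hJ.star x t) ht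
  have hd := jost_det u s x
  constructor
  · linear_combination (-(y x)) * hd + jost₁ u s x * w2 - conj (jost₂ u s x) * w1
  · linear_combination (-(z x)) * hd + jost₂ u s x * w2 - conj (jost₁ u s x) * w1

end X

/-! ### The scattering matrix -/

theorem isPrim_exp (c : ℂ) : IsPrim (fun x : ℝ => cexp (c * x)) fun x => c * cexp (c * x) := by
  refine IsPrim.of_hasDerivAt (fun x => ?_) (by fun_prop)
  have h : HasDerivAt (fun x : ℝ => c * (x : ℂ)) c x := by
    simpa using (Complex.ofRealCLM.hasDerivAt (x := x)).const_mul c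
  have := h.cexp
  rwa [mul_comm] at this

/-- A column of a solution of the ZS-AKNS system. -/
structure IsColSol (u : ℝ → ℝ) (s : ℝ) (f g : ℝ → ℂ) : Prop where
  fst : IsPrim f fun x => I * s / 2 * f x + u x * g x
  snd : IsPrim g fun x => -(I * s / 2) * g x + u x * f x

theorem IsRotSol.toColSol {u : ℝ → ℝ} {s : ℝ} {y z : ℝ → ℂ} (h : IsRotSol u s y z) :
    IsColSol u s (fun x => cexp (I * s / 2 * x) * z x) fun x => cexp (-(I * s / 2) * x) * y x where
  fst := ((isPrim_exp (I * s / 2)).mul h.snd).congr (by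
    funext x
    rw [show -(I * s / 2) * (x : ℂ) = I * s / 2 * x + -(I * s * x) by ring, Complex.exp_add]
    ring)
  snd := ((isPrim_exp (-(I * s / 2))).mul h.fst).congr (by
    funext x
    rw [show I * s / 2 * (x : ℂ) = -(I * s / 2) * x + I * s * x by ring, Complex.exp_add]
    ring)

theorem IsColSol.toRotSol {u : ℝ → ℝ} {s : ℝ} {f g : ℝ → ℂ} (h : IsColSol u s f g) :
    IsRotSol u s (fun x => cexp (I * s / 2 * x) * g x) fun x => cexp (-(I * s / 2) * x) * f x where
  fst := ((isPrim_exp (I * s / 2)).mul h.snd).congr (by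
    funext x
    have : cexp (I * s * x) * cexp (-(I * s / 2) * x) = cexp (I * s / 2 * x) := by
      rw [← Complex.exp_add]; congr 1; ring
    linear_combination (-(u x : ℂ) * f x) * this)
  snd := ((isPrim_exp (-(I * s / 2))).mul h.fst).congr (by
    funext x
    have : cexp (-(I * s * x)) * cexp (I * s / 2 * x) = cexp (-(I * s / 2) * x) := by
      rw [← Complex.exp_add]; congr 1; ring
    linear_combination (-(u x : ℂ) * g x) * this)

theorem IsColSol.sub {u : ℝ → ℝ} {s : ℝ} {f g f' g' : ℝ → ℂ} (h : IsColSol u s f g)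
    (h' : IsColSol u s f' g') :
    IsColSol u s (fun x => f x - f' x) fun x => g x - g' x where
  fst := (h.fst.sub h'.fst).congr (by funext x; ring)
  snd := (h.snd.sub h'.snd).congr (by funext x; ring)

theorem AKNS_apply_zero (u : ℝ → ℝ) (s x : ℝ) (M : Matrix (Fin 2) (Fin 2) ℂ) (j : Fin 2) :
    (((I * s) • sigma + Q (fun x => (u x : ℂ)) x) * M) 0 j = I * s / 2 * M 0 j + u x * M 1 j := by
  simp only [Matrix.mul_apply, Fin.sum_univ_two, sigma, Q, Matrix.add_apply, Matrix.smul_apply,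
    Matrix.of_apply, Matrix.cons_val', Matrix.cons_val_zero, Matrix.cons_val_one,
    Matrix.cons_val_fin_one, smul_eq_mul]
  ring

theorem AKNS_apply_one (u : ℝ → ℝ) (s x : ℝ) (M : Matrix (Fin 2) (Fin 2) ℂ) (j : Fin 2) :
    (((I * s) • sigma + Q (fun x => (u x : ℂ)) x) * M) 1 j
      = -(I * s / 2) * M 1 j + u x * M 0 j := by
  simp [Matrix.mul_apply, Fin.sum_univ_two, sigma, Q]
  ring

namespace X

theorem isAKNSSolution_of_isColSol {u : X} {s : ℝ} {Ψ : ℝ → Matrix (Fin 2) (Fin 2) ℂ}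
    (h : ∀ j, IsColSol u.toFun s (fun x => Ψ x 0 j) fun x => Ψ x 1 j) :
    IsAKNSSolution u.toComplex s Ψ := by
  refine ⟨continuous_matrix fun i j => ?_, fun x y i j => ?_⟩
  · fin_cases i
    · exact (h j).fst.continuous
    · exact (h j).snd.continuous
  · fin_cases i
    · exact ((h j).fst.sub_eq x y).trans (intervalIntegral.integral_congr fun t _ =>
        (AKNS_apply_zero u.toFun s t (Ψ t) j).symm)
    · exact ((h j).snd.sub_eq x y).trans (intervalIntegral.integral_congr fun t _ =>
        (AKNS_apply_one u.toFun s t (Ψ t) j).symm)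

theorem intervalIntegrable_mul (u : X) {g : ℝ → ℂ} (hg : Continuous g) (a b : ℝ) :
    IntervalIntegrable (fun t => (u.toFun t : ℂ) * g t) volume a b :=
  (u.integrable_toComplex.intervalIntegrable).mul_continuousOn hg.continuousOn

theorem isColSol_of_isAKNSSolution {u : X} {s : ℝ} {Ψ : ℝ → Matrix (Fin 2) (Fin 2) ℂ}
    (h : IsAKNSSolution u.toComplex s Ψ) (j : Fin 2) :
    IsColSol u.toFun s (fun x => Ψ x 0 j) fun x => Ψ x 1 j := by
  have hc : ∀ i, Continuous fun x => Ψ x i j := fun i => h.1.matrix_elem i j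
  refine ⟨⟨fun a b => ?_, fun a b => ?_⟩, ⟨fun a b => ?_, fun a b => ?_⟩⟩
  · exact ((continuous_const.mul (hc 0)).intervalIntegrable a b).add
      (intervalIntegrable_mul u (hc 1) a b)
  · exact (h.2 a b 0 j).trans (intervalIntegral.integral_congr fun t _ =>
      AKNS_apply_zero u.toFun s t (Ψ t) j)
  · exact ((continuous_const.mul (hc 1)).intervalIntegrable a b).add
      (intervalIntegrable_mul u (hc 0) a b)
  · exact (h.2 a b 1 j).trans (intervalIntegral.integral_congr fun t _ =>
      AKNS_apply_one u.toFun s t (Ψ t) j)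

/-- Solutions of the ZS-AKNS system are determined by their asymptotics at either end. -/
theorem AKNS_unique {u : X} {s : ℝ} {Ψ Ψ' : ℝ → Matrix (Fin 2) (Fin 2) ℂ}
    (h : IsAKNSSolution u.toComplex s Ψ) (h' : IsAKNSSolution u.toComplex s Ψ') {l : Filter ℝ}
    [l.NeBot] {a b : ℂ} (h1 : Tendsto (jost₁ u s) l (𝓝 a)) (h2 : Tendsto (jost₂ u s) l (𝓝 b))
    (hl : Tendsto (fun x => Ψ x - expSigma s x) l (𝓝 0))
    (hl' : Tendsto (fun x => Ψ' x - expSigma s x) l (𝓝 0)) : Ψ = Ψ' := by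
  have hd : ∀ i j, Tendsto (fun x => Ψ x i j - Ψ' x i j) l (𝓝 0) := fun i j => by
    have := hl.sub hl'
    rw [sub_zero] at this
    have := ((continuous_id.matrix_elem i j).tendsto _).comp this
    simpa [Function.comp_def] using this
  have hn : ∀ (c : ℝ) (f : ℝ → ℂ), Tendsto f l (𝓝 0) →
      Tendsto (fun x : ℝ => cexp (I * s / 2 * c * x) * f x) l (𝓝 0) := fun c f hf => by
    rw [tendsto_zero_iff_norm_tendsto_zero] at hf ⊢
    refine hf.congr fun x => ?_
    rw [norm_mul, show I * s / 2 * c * x = ((s / 2 * c * x : ℝ) : ℂ) * I by push_cast; ring,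
      Complex.norm_exp_ofReal_mul_I, one_mul]
  have key : ∀ j x, Ψ x 1 j - Ψ' x 1 j = 0 ∧ Ψ x 0 j - Ψ' x 0 j = 0 := fun j x => by
    have hs := ((isColSol_of_isAKNSSolution h j).sub (isColSol_of_isAKNSSolution h' j)).toRotSol
    have hy := hn 1 _ (hd 1 j)
    have hz := hn (-1) _ (hd 0 j)
    simp only [ofReal_one, mul_one, ofReal_neg, mul_neg] at hy hz
    have := rotSol_eq_zero hs h1 h2 hy (by simpa using hz) x
    simpa [Complex.exp_ne_zero] using this
  funext x
  ext i j
  fin_cases i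
  · exact sub_eq_zero.1 (key j x).2
  · exact sub_eq_zero.1 (key j x).1

/-- The Jost solution `Ψ₊`. -/
def jostPlus (u : X) (s x : ℝ) : Matrix (Fin 2) (Fin 2) ℂ :=
  !![cexp (I * s / 2 * x) * conj (jost₁ u s x), cexp (I * s / 2 * x) * jost₂ u s x;
    cexp (-(I * s / 2) * x) * conj (jost₂ u s x), cexp (-(I * s / 2) * x) * jost₁ u s x]

/-- The scattering matrix in terms of `α` and `β`. -/
def scatMat (u : X) (s : ℝ) : Matrix (Fin 2) (Fin 2) ℂ :=
  !![conj (1 + ft s (alpha u)), -ft s (beta u); -conj (ft s (beta u)), 1 + ft s (alpha u)]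

/-- The inverse of the scattering matrix. -/
def scatMatInv (u : X) (s : ℝ) : Matrix (Fin 2) (Fin 2) ℂ :=
  !![1 + ft s (alpha u), ft s (beta u); conj (ft s (beta u)), conj (1 + ft s (alpha u))]

theorem scatMatInv_mul (u : X) (s : ℝ) : scatMatInv u s * scatMat u s = 1 := by
  have h := alpha_beta_det u s
  rw [scatMatInv, scatMat, Matrix.one_fin_two, Matrix.mul_fin_two]
  congr 1
  congr 1
  · congr 1
    · linear_combination h
    · congr 1; ring
  · congr 1
    congr 1
    · ring
    · congr 1; linear_combination h

theorem scatMat_mul_inv (u : X) (s : ℝ) : scatMat u s * scatMatInv u s = 1 :=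
  mul_eq_one_comm.1 (scatMatInv_mul u s)

theorem isColSol_jostPlus (u : X) (s : ℝ) (j : Fin 2) :
    IsColSol u.toFun s (fun x => jostPlus u s x 0 j) fun x => jostPlus u s x 1 j := by
  fin_cases j
  · exact (isRotSol_jost u s).star.toColSol
  · exact (isRotSol_jost u s).toColSol

/-- Multiplication by `e^{isxσ}`, a matrix of norm one, preserves convergence to zero. -/
theorem tendsto_of_entries {l : Filter ℝ} {s : ℝ} {Ψ : ℝ → Matrix (Fin 2) (Fin 2) ℂ}
    {m : Fin 2 → Fin 2 → ℝ → ℂ}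
    (h0 : ∀ j x, Ψ x 0 j = cexp (I * s / 2 * x) * m 0 j x)
    (h1 : ∀ j x, Ψ x 1 j = cexp (-(I * s / 2) * x) * m 1 j x)
    (hm : ∀ i j, Tendsto (m i j) l (𝓝 ((1 : Matrix (Fin 2) (Fin 2) ℂ) i j))) :
    Tendsto (fun x => Ψ x - expSigma s x) l (𝓝 0) := by
  have hn : ∀ (c : ℝ) (f : ℝ → ℂ), Tendsto f l (𝓝 0) →
      Tendsto (fun x : ℝ => cexp (I * s / 2 * c * x) * f x) l (𝓝 0) := fun c f hf => by
    rw [tendsto_zero_iff_norm_tendsto_zero] at hf ⊢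
    refine hf.congr fun x => ?_
    rw [norm_mul, show I * s / 2 * c * x = ((s / 2 * c * x : ℝ) : ℂ) * I by push_cast; ring,
      Complex.norm_exp_ofReal_mul_I, one_mul]
  have hm' : ∀ i j, Tendsto (fun x => m i j x - (1 : Matrix (Fin 2) (Fin 2) ℂ) i j) l (𝓝 0) :=
    fun i j => by simpa using (hm i j).sub_const ((1 : Matrix (Fin 2) (Fin 2) ℂ) i j)
  refine tendsto_pi_nhds.2 fun i => tendsto_pi_nhds.2 fun j => ?_
  fin_cases i
  · refine (hn 1 _ (hm' 0 j)).congr fun x => ?_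
    simp only [Matrix.sub_apply, Fin.zero_eta, h0, expSigma]
    match j with
    | 0 => simp; ring_nf
    | 1 => simp
  · refine (hn (-1) _ (hm' 1 j)).congr fun x => ?_
    simp only [Matrix.sub_apply, Fin.mk_one, h1, expSigma]
    match j with
    | 0 => simp
    | 1 => simp; ring_nf

theorem isJostPlus_jostPlus (u : X) (s : ℝ) : IsJostPlus u.toComplex s (jostPlus u s) := by
  refine ⟨isAKNSSolution_of_isColSol (isColSol_jostPlus u s), ?_⟩
  have t1 := tendsto_jost₁_atTop u s
  have t2 := tendsto_jost₂_atTop u s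
  have t1' := (Complex.continuous_conj.tendsto _).comp t1
  have t2' := (Complex.continuous_conj.tendsto _).comp t2
  rw [map_one] at t1'
  rw [map_zero] at t2'
  refine tendsto_of_entries (m := fun i j => if i = 0 then (if j = 0 then fun x => conj (jost₁ u s x)
    else jost₂ u s) else (if j = 0 then fun x => conj (jost₂ u s x) else jost₁ u s)) ?_ ?_ ?_
  · intro j x; fin_cases j <;> simp [jostPlus]
  · intro j x; fin_cases j <;> simp [jostPlus]
  · intro i j
    fin_cases i <;> fin_cases j <;> simp
    · exact t1'
    · exact t2
    · exact t2'
    · exact t1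

/-- In the rotating frame Ψ₊ tends to `scatMat u s` at -∞, by the choice of `alpha` and `beta`;
multiplying by the inverse on the right normalises the limit to the identity. -/
theorem isJostMinus_mul_scatMatInv (u : X) (s : ℝ) :
    IsJostMinus u.toComplex s fun x => jostPlus u s x * scatMatInv u s := by
  have hd := alpha_beta_det u s
  set a := 1 + ft s (alpha u) with ha
  set b := ft s (beta u) with hb
  have t1 := tendsto_jost₁_atBot u s
  have t2 := tendsto_jost₂_atBot u s
  have t1' := (Complex.continuous_conj.tendsto _).comp t1
  have t2' := (Complex.continuous_conj.tendsto _).comp t2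
  have hJ := isRotSol_jost u s
  refine ⟨isAKNSSolution_of_isColSol fun j => ?_, ?_⟩
  · fin_cases j
    · have := ((hJ.star.const_mul a).add (hJ.const_mul (conj b))).toColSol
      convert! this using 2
      · simp [jostPlus, scatMatInv, Matrix.mul_apply, Fin.sum_univ_two, ← ha, ← hb]; ring
      · simp [jostPlus, scatMatInv, Matrix.mul_apply, Fin.sum_univ_two, ← ha, ← hb]; ring
    · have := ((hJ.star.const_mul b).add (hJ.const_mul (conj a))).toColSol
      convert! this using 2
      · simp [jostPlus, scatMatInv, Matrix.mul_apply, Fin.sum_univ_two, ← ha, ← hb]; ring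
      · simp [jostPlus, scatMatInv, Matrix.mul_apply, Fin.sum_univ_two, ← ha, ← hb]; ring
  · refine tendsto_of_entries (m := fun i j => if i = 0 then (if j = 0 then
      fun x => conj (jost₁ u s x) * a + jost₂ u s x * conj b
      else fun x => conj (jost₁ u s x) * b + jost₂ u s x * conj a) else (if j = 0 then
      fun x => conj (jost₂ u s x) * a + jost₁ u s x * conj b
      else fun x => conj (jost₂ u s x) * b + jost₁ u s x * conj a)) ?_ ?_ ?_
    · intro j x
      fin_cases j <;> simp [jostPlus, scatMatInv, Matrix.mul_apply, Fin.sum_univ_two, ← ha, ← hb] <;>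
        ring
    · intro j x
      fin_cases j <;> simp [jostPlus, scatMatInv, Matrix.mul_apply, Fin.sum_univ_two, ← ha, ← hb] <;>
        ring
    · intro i j
      fin_cases i <;> fin_cases j <;> simp
      · have := (t1'.mul_const a).add (t2.mul_const (conj b))
        rwa [show conj a * a + -b * conj b = 1 by linear_combination hd] at this
      · have := (t1'.mul_const b).add (t2.mul_const (conj a))
        rwa [show conj a * b + -b * conj a = 0 by ring] at this
      · have := (t2'.mul_const a).add (t1.mul_const (conj b))
        rwa [show conj (-b) * a + a * conj b = 0 by rw [map_neg]; ring] at this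
      · have := (t2'.mul_const b).add (t1.mul_const (conj a))
        rwa [show conj (-b) * b + a * conj a = 1 by rw [map_neg]; linear_combination hd] at this

theorem isScatteringMatrix_scatMat (u : X) (s : ℝ) :
    IsScatteringMatrix u.toComplex s (scatMat u s) := by
  refine ⟨by simp [scatMat], by simp [scatMat], ?_, jostPlus u s, _, isJostPlus_jostPlus u s,
    isJostMinus_mul_scatMatInv u s, fun x => ?_⟩
  · have h := alpha_beta_det u s
    rw [Complex.mul_conj, Complex.mul_conj, Complex.normSq_eq_norm_sq,
      Complex.normSq_eq_norm_sq] at h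
    simp only [scatMat, Matrix.of_apply, Matrix.cons_val_zero, Matrix.cons_val_one,
      Matrix.cons_val', Matrix.cons_val_fin_one, norm_neg, RCLike.norm_conj]
    exact_mod_cast h
  · rw [mul_assoc, scatMatInv_mul, mul_one]

/-- Both Jost solutions are determined by their asymptotics and Ψ₊(0) is invertible, so the relation
at x = 0 alone determines A. -/
theorem isScatteringMatrix_unique {u : X} {s : ℝ} {A : Matrix (Fin 2) (Fin 2) ℂ}
    (h : IsScatteringMatrix u.toComplex s A) : A = scatMat u s := by
  obtain ⟨-, -, -, Ψp, Ψm, hp, hm, hA⟩ := h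
  have e1 : Ψp = jostPlus u s := AKNS_unique hp.1 (isJostPlus_jostPlus u s).1
    (tendsto_jost₁_atTop u s) (tendsto_jost₂_atTop u s) hp.2 (isJostPlus_jostPlus u s).2
  have e2 : Ψm = fun x => jostPlus u s x * scatMatInv u s :=
    AKNS_unique hm.1 (isJostMinus_mul_scatMatInv u s).1
      (tendsto_jost₁_atBot u s) (tendsto_jost₂_atBot u s) hm.2 (isJostMinus_mul_scatMatInv u s).2
  have h0 := hA 0
  rw [e1, e2] at h0
  have hdet : IsUnit (jostPlus u s 0).det := by
    have := jost_det u s 0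
    rw [jostPlus, Matrix.det_fin_two_of]
    simp only [ofReal_zero, mul_zero, Complex.exp_zero, one_mul]
    rw [show conj (jost₁ u s 0) * jost₁ u s 0 - jost₂ u s 0 * conj (jost₂ u s 0) = 1 by
      linear_combination this]
    exact isUnit_one
  have h1 : (1 : Matrix (Fin 2) (Fin 2) ℂ) = scatMatInv u s * A := by
    have hu := (Matrix.isUnit_iff_isUnit_det _).2 hdet
    rw [mul_assoc] at h0
    refine hu.mul_left_cancel ?_
    rw [mul_one]
    exact h0
  calc A = scatMat u s * scatMatInv u s * A := by rw [scatMat_mul_inv, one_mul]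
    _ = scatMat u s := by rw [mul_assoc, ← h1, mul_one]

theorem existsUnique_isScatteringMatrix (u : X) (s : ℝ) :
    ∃! A, IsScatteringMatrix u.toComplex s A :=
  ⟨scatMat u s, isScatteringMatrix_scatMat u s, fun _ h => isScatteringMatrix_unique h⟩

theorem scatteringMatrix_eq (u : X) (s : ℝ) : scatteringMatrix u.toComplex s = scatMat u s :=
  isScatteringMatrix_unique (Classical.epsilon_spec ⟨_, isScatteringMatrix_scatMat u s⟩)

theorem SPlus_eq (u : X) (s : ℝ) :
    SPlus u.toComplex s = ft s (beta u) / conj (1 + ft s (alpha u)) := by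
  simp [SPlus, coeffA, coeffB, scatteringMatrix_eq, scatMat]

theorem SMinus_eq (u : X) (s : ℝ) :
    SMinus u.toComplex s = -conj (ft s (beta u)) / conj (1 + ft s (alpha u)) := by
  simp [SMinus, coeffA, coeffB, scatteringMatrix_eq, scatMat]

end X

/-! ### Convolution -/

namespace X

/-- Convolution on `L¹ ∩ L²`. -/
instance : Mul X := ⟨fun f g => J 1 f (BoundedContinuousFunction.const ℝ g)⟩

theorem mul_def (f g : X) : f * g = J 1 f (BoundedContinuousFunction.const ℝ g) := rfl

theorem ft_mul (s : ℝ) (f g : X) : ft s (f * g) = ft s f * ft s g := by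
  rw [mul_def, ft_J, ft_apply s f, ← integral_mul_const]
  refine integral_congr_ae (Eventually.of_forall fun t => ?_)
  simp only [BoundedContinuousFunction.const_apply, ofReal_one, one_mul]
  ring

theorem norm_mul_le' (f g : X) : ‖f * g‖ ≤ ‖f‖ * ‖g‖ :=
  (norm_J_le 1 f _).trans
    (mul_le_mul_of_nonneg_left (BoundedContinuousFunction.norm_const_le g) (norm_nonneg f))

/-- The ring laws are verified on the Fourier side, where convolution is pointwise multiplication.
-/
instance : NonUnitalNormedCommRing X :=
  { (inferInstance : NormedAddCommGroup X) with
    left_distrib := fun f g h => ext_ft fun s => by simp only [ft_mul, map_add]; ring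
    right_distrib := fun f g h => ext_ft fun s => by simp only [ft_mul, map_add]; ring
    zero_mul := fun f => ext_ft fun s => by simp only [ft_mul, map_zero, zero_mul]
    mul_zero := fun f => ext_ft fun s => by simp only [ft_mul, map_zero, mul_zero]
    mul_assoc := fun f g h => ext_ft fun s => by simp only [ft_mul, mul_assoc]
    mul_comm := fun f g => ext_ft fun s => by simp only [ft_mul, mul_comm]
    norm_mul_le := norm_mul_le' }

instance : IsScalarTower ℝ X X :=
  ⟨fun c f g => ext_ft fun s => by
    simp only [smul_eq_mul, ft_mul, map_smul, Algebra.smul_mul_assoc]⟩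

instance : SMulCommClass ℝ X X :=
  ⟨fun c f g => ext_ft fun s => by
    simp only [smul_eq_mul, ft_mul, map_smul, Algebra.mul_smul_comm]⟩

theorem refl_mul (f g : X) : refl (f * g) = refl f * refl g :=
  ext_ft fun s => by simp only [ft_mul, ft_refl, map_mul]

end X

/-- The algebra `ℝ ⊕ X` of the functions `c + f̂` under pointwise multiplication. -/
def W : Type := WithLp 1 (Unitization ℝ X)

instance : NormedRing W := inferInstanceAs (NormedRing (WithLp 1 (Unitization ℝ X)))

instance : NormedCommRing W :=
  { (inferInstance : NormedRing W) with
    mul_comm := fun x y => (WithLp.ofLp_injective 1)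
      (mul_comm (WithLp.ofLp (p := 1) (V := Unitization ℝ X) x) (WithLp.ofLp y)) }

instance : NormedAlgebra ℝ W :=
  inferInstanceAs (NormedAlgebra ℝ (WithLp 1 (Unitization ℝ X)))

instance : CompleteSpace W := inferInstanceAs (CompleteSpace (WithLp 1 (Unitization ℝ X)))

namespace W

/-- The constant part. -/
def fst (w : W) : ℝ := (WithLp.ofLp (p := 1) (V := Unitization ℝ X) w).fst

/-- The non-constant part. -/
def snd (w : W) : X := (WithLp.ofLp (p := 1) (V := Unitization ℝ X) w).snd

theorem norm_def (w : W) : ‖w‖ = |fst w| + ‖snd w‖ := WithLp.unitization_norm_def w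

@[ext] theorem ext {w z : W} (h₁ : fst w = fst z) (h₂ : snd w = snd z) : w = z :=
  (WithLp.ofLp_injective 1) (Unitization.ext h₁ h₂)

theorem fst_add (w z : W) : fst (w + z) = fst w + fst z := rfl
theorem snd_add (w z : W) : snd (w + z) = snd w + snd z := rfl
theorem fst_sub (w z : W) : fst (w - z) = fst w - fst z := rfl
theorem snd_sub (w z : W) : snd (w - z) = snd w - snd z := rfl
theorem fst_mul (w z : W) : fst (w * z) = fst w * fst z := rfl
theorem snd_mul (w z : W) : snd (w * z) = fst w • snd z + fst z • snd w + snd w * snd z := rfl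
theorem fst_one : fst 1 = 1 := rfl
theorem snd_one : snd 1 = 0 := rfl
theorem fst_zero : fst 0 = 0 := rfl
theorem snd_zero : snd 0 = 0 := rfl
theorem fst_smul (c : ℝ) (w : W) : fst (c • w) = c * fst w := rfl
theorem snd_smul (c : ℝ) (w : W) : snd (c • w) = c • snd w := rfl

/-- The inclusion of `X`. -/
def ι : X →ₗᵢ[ℝ] W where
  toFun f := (WithLp.toLp 1 (Unitization.inr f) : WithLp 1 (Unitization ℝ X))
  map_add' _ _ := ext (add_zero (0 : ℝ)).symm rfl
  map_smul' c _ := ext (mul_zero c).symm rfl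
  norm_map' f := WithLp.unitization_norm_inr f

theorem fst_ι (f : X) : fst (ι f) = 0 := rfl
theorem snd_ι (f : X) : snd (ι f) = f := rfl

instance : NormOneClass W := ⟨by rw [norm_def, fst_one, snd_one]; simp⟩

/-- `snd` as a continuous linear map. -/
def sndL : W →L[ℝ] X :=
  LinearMap.mkContinuous { toFun := snd, map_add' := snd_add, map_smul' := snd_smul } 1 fun w => by
    rw [one_mul, norm_def]; exact le_add_of_nonneg_left (abs_nonneg _)

theorem norm_snd_le (w : W) : ‖snd w‖ ≤ ‖w‖ := by
  rw [norm_def]; exact le_add_of_nonneg_left (abs_nonneg _)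

/-- The symbol, `c + f̂(s)`. -/
def sym (s : ℝ) : W →+* ℂ where
  toFun w := fst w + X.ft s (snd w)
  map_one' := by rw [fst_one, snd_one]; simp
  map_zero' := by rw [fst_zero, snd_zero]; simp
  map_add' w z := by rw [fst_add, snd_add, map_add]; push_cast; ring
  map_mul' w z := by
    rw [fst_mul, snd_mul, map_add, map_add, map_smul, map_smul, X.ft_mul, Complex.real_smul,
      Complex.real_smul]
    push_cast; ring

theorem sym_apply (s : ℝ) (w : W) : sym s w = fst w + X.ft s (snd w) := rfl

theorem sym_ι (s : ℝ) (f : X) : sym s (ι f) = X.ft s f := by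
  rw [sym_apply, fst_ι, snd_ι]; simp

theorem sym_smul (s c : ℝ) (w : W) : sym s (c • w) = c * sym s w := by
  rw [sym_apply, sym_apply, fst_smul, snd_smul, map_smul, Complex.real_smul]
  push_cast; ring

theorem norm_sym_le (s : ℝ) (w : W) : ‖sym s w‖ ≤ ‖w‖ := by
  rw [sym_apply, norm_def]
  refine (norm_add_le _ _).trans (add_le_add ?_ (X.norm_ft_le s _))
  simp

theorem ext_sym {w z : W} (h : fst w = fst z) (hs : ∀ s, sym s w = sym s z) : w = z := by
  refine ext h (X.ext_ft fun s => ?_)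
  have := hs s
  rw [sym_apply, sym_apply, h] at this
  exact add_left_cancel this

/-- Reflection, which conjugates the symbol. -/
def star : W →+* W where
  toFun w := algebraMap ℝ W (fst w) + ι (X.refl (snd w))
  map_one' := by simp [fst_one, snd_one]
  map_zero' := by simp [fst_zero, snd_zero]
  map_add' w z := by simp only [fst_add, snd_add, map_add]; ring
  map_mul' w z := by
    refine ext ?_ ?_
    · simp only [Algebra.algebraMap_eq_smul_one, fst_add, fst_smul, fst_one, fst_ι, fst_mul]; ring
    · simp only [Algebra.algebraMap_eq_smul_one, snd_add, snd_smul, snd_one, snd_ι, fst_mul,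
        fst_add, fst_smul, fst_one, fst_ι, snd_mul, map_add, map_smul, X.refl_mul, smul_zero,
        zero_add, mul_one, add_zero]

theorem fst_star (w : W) : fst (star w) = fst w := by
  change fst (algebraMap ℝ W (fst w) + ι (X.refl (snd w))) = _
  simp only [Algebra.algebraMap_eq_smul_one, fst_add, fst_smul, fst_one, fst_ι]; ring

theorem snd_star (w : W) : snd (star w) = X.refl (snd w) := by
  change snd (algebraMap ℝ W (fst w) + ι (X.refl (snd w))) = _
  simp only [Algebra.algebraMap_eq_smul_one, snd_add, snd_smul, snd_one, snd_ι]; simp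

theorem star_star (w : W) : star (star w) = w :=
  ext (by simp only [fst_star]) (by simp only [snd_star, X.refl_refl])

theorem star_ι (f : X) : star (ι f) = ι (X.refl f) :=
  ext (by simp only [fst_star, fst_ι]) (by simp only [snd_star, snd_ι])

theorem sym_star (s : ℝ) (w : W) : sym s (star w) = conj (sym s w) := by
  rw [sym_apply, sym_apply, fst_star, snd_star, X.ft_refl, map_add, conj_ofReal]

/-- `X` is an ideal of `W`. -/
instance : Module W X where
  smul w f := fst w • f + snd w * f
  one_smul f := by change fst 1 • f + snd 1 * f = f; rw [fst_one, snd_one]; simp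
  mul_smul w z f := by
    change fst (w * z) • f + snd (w * z) * f =
      fst w • (fst z • f + snd z * f) + snd w * (fst z • f + snd z * f)
    refine X.ext_ft fun s => ?_
    simp only [fst_mul, snd_mul, map_add, map_smul, X.ft_mul, Complex.real_smul]
    push_cast; ring
  smul_zero w := by change fst w • (0 : X) + snd w * 0 = 0; simp
  smul_add w f g := by
    change fst w • (f + g) + snd w * (f + g) = fst w • f + snd w * f + (fst w • g + snd w * g)
    rw [smul_add, mul_add]; abel
  add_smul w z f := by
    change fst (w + z) • f + snd (w + z) * f = fst w • f + snd w * f + (fst z • f + snd z * f)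
    rw [fst_add, snd_add, add_smul, add_mul]; abel
  zero_smul f := by change fst 0 • f + snd 0 * f = 0; rw [fst_zero, snd_zero]; simp

theorem smul_def (w : W) (f : X) : w • f = fst w • f + snd w * f := rfl

theorem ι_smul (w : W) (f : X) : ι (w • f) = w * ι f := by
  refine ext ?_ ?_
  · rw [fst_mul, fst_ι, fst_ι, mul_zero]
  · rw [snd_mul, snd_ι, snd_ι, fst_ι, smul_def]; simp

theorem ft_smul (s : ℝ) (w : W) (f : X) : X.ft s (w • f) = sym s w * X.ft s f := by
  rw [← sym_ι, ι_smul, map_mul, sym_ι]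

theorem ι_smul_eq_mul (f g : X) : ι f • g = f * g := by
  rw [smul_def, fst_ι, snd_ι]; simp

theorem norm_smul_le' (w : W) (f : X) : ‖w • f‖ ≤ ‖w‖ * ‖f‖ := by
  rw [← ι.norm_map, ι_smul, ← ι.norm_map f]; exact norm_mul_le _ _

theorem refl_smul (w : W) (f : X) : X.refl (w • f) = star w • X.refl f := by
  refine X.ext_ft fun s => ?_
  rw [X.ft_refl, ft_smul, ft_smul, sym_star, X.ft_refl, map_mul]

theorem norm_toL2_smul_le {w : W} {ρ : ℝ} (h : ∀ s, ‖sym s w‖ ≤ ρ) (f : X) :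
    ‖X.toL2 (w • f)‖ ≤ ρ * ‖X.toL2 f‖ :=
  X.norm_toL2_le_of_norm_ft_le ((norm_nonneg _).trans (h 0)) fun s => by
    rw [ft_smul, norm_mul]; exact mul_le_mul_of_nonneg_right (h s) (norm_nonneg _)

/-- The action of `W` on `X`, as a continuous bilinear map. -/
def smulL : W →L[ℝ] X →L[ℝ] X :=
  LinearMap.mkContinuous₂
    (LinearMap.mk₂ ℝ (fun (w : W) (f : X) => w • f) (fun w z f => add_smul w z f)
      (fun c w f => by
        refine X.ext_ft fun s => ?_
        rw [ft_smul, sym_smul, map_smul, ft_smul, Complex.real_smul]; ring)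
      (fun w f g => smul_add w f g)
      (fun c w f => by
        refine X.ext_ft fun s => ?_
        rw [ft_smul, map_smul, map_smul, ft_smul, Complex.real_smul, Complex.real_smul]; ring)) 1
    fun w f => by rw [one_mul]; exact norm_smul_le' w f

theorem smulL_apply (w : W) (f : X) : smulL w f = w • f := rfl

end W

/-! ### Wiener's lemma -/

namespace X

/-- Restriction to `[-r, r]`. -/
def mid (r : ℝ) : X →L[ℝ] X := cut (Set.Icc (-r) r) measurableSet_Icc

theorem mid_mid {r r' : ℝ} (h : r ≤ r') (f : X) : mid r' (mid r f) = mid r f := by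
  unfold mid
  rw [cut_cut]
  exact congrArg (fun T => T f) (cut_congr_ae _ _ (Set.inter_eq_right.2
    (Set.Icc_subset_Icc (neg_le_neg h) h)).eventuallyEq)

theorem tendsto_mid (f : X) : Tendsto (fun r => mid r f) atTop (𝓝 f) := by
  have h : Tendsto (fun r => cut (Set.Icc (-r) r)ᶜ measurableSet_Icc.compl f) atTop (𝓝 0) := by
    refine tendsto_cut_zero f (fun _ => measurableSet_Icc.compl) (Eventually.of_forall fun x => ?_)
    filter_upwards [eventually_ge_atTop |x|] with r hr
    rw [Set.mem_compl_iff, not_not]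
    exact abs_le.1 hr
  have h2 := h.const_sub f
  rw [sub_zero] at h2
  refine h2.congr fun r => ?_
  apply ext_ae
  filter_upwards [toFun_sub f (cut (Set.Icc (-r) r)ᶜ measurableSet_Icc.compl f),
    toFun_cut (measurableSet_Icc (a := -r) (b := r)).compl f,
    toFun_cut (measurableSet_Icc (a := -r) (b := r)) f] with x h1 h2 h3
  rw [h1, Pi.sub_apply, h2]
  unfold mid
  rw [h3]
  by_cases hx : x ∈ Set.Icc (-r) r
  · simp [hx]
  · simp [hx]

/-- Supports add under convolution: only t in [-a,a] contribute, and each moves [-b,b] by t. -/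
theorem mid_mul {a b : ℝ} {f g : X} (hf : mid a f = f) (hg : mid b g = g) :
    mid (a + b) (f * g) = f * g := by
  rw [mul_def, J_apply, ← ContinuousLinearMap.integral_comp_comm _ (integrable_smul_transl 1 f _)]
  refine integral_congr_ae ?_
  have hf' := toFun_cut (measurableSet_Icc (a := -a) (b := a)) f
  filter_upwards [hf'] with t ht
  change (mid a f).toFun t = _ at ht
  rw [hf] at ht
  rw [map_smul]
  by_cases hta : t ∈ Set.Icc (-a) a
  · congr 1
    simp only [BoundedContinuousFunction.const_apply, one_mul]
    conv_lhs => rw [← hg]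
    conv_rhs => rw [← hg]
    unfold mid
    rw [cut_transl, cut_cut]
    congr 1
    refine congrArg (fun T => T g) (cut_congr_ae _ _ (Set.inter_eq_right.2 fun x hx => ?_).eventuallyEq)
    rw [Set.mem_preimage, Set.mem_Icc]
    rw [Set.mem_Icc] at hx hta
    exact ⟨by linarith [hx.1, hta.1], by linarith [hx.2, hta.2]⟩
  · rw [ht, Set.indicator_of_notMem hta, zero_smul, zero_smul]

/-- Cauchy–Schwarz on an interval of length 2r, with √(2r) ≤ 1 + 2r. Only polynomial growth in r
matters, because r will be replaced by nr for n-th powers. -/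
theorem norm_toL1_le_of_mid {r : ℝ} {f : X} (hr : 0 ≤ r) (hf : mid r f = f) :
    ‖toL1 f‖ ≤ (1 + 2 * r) * ‖toL2 f‖ := by
  have h := toFun_cut (measurableSet_Icc (a := -r) (b := r)) f
  change (mid r f).toFun =ᵐ[volume] _ at h
  rw [hf] at h
  rw [norm_toL1_eq, norm_toL2_eq]
  have h1 : eLpNorm f.toFun 1 volume ≤ ENNReal.ofReal (1 + 2 * r) * eLpNorm f.toFun 2 volume := by
    rw [eLpNorm_congr_ae h, eLpNorm_indicator_eq_eLpNorm_restrict measurableSet_Icc]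
    refine (eLpNorm_le_eLpNorm_mul_rpow_measure_univ (p := 1) (q := 2) (by norm_num)
      f.memLp_two.1.restrict).trans ?_
    rw [mul_comm, ← eLpNorm_indicator_eq_eLpNorm_restrict measurableSet_Icc]
    refine mul_le_mul' ?_ (eLpNorm_indicator_le _)
    rw [Measure.restrict_apply_univ, Real.volume_Icc, ENNReal.ofReal_rpow_of_nonneg (by linarith)
      (by norm_num)]
    refine ENNReal.ofReal_le_ofReal ?_
    rw [show (1 / (1 : ℝ≥0∞).toReal - 1 / (2 : ℝ≥0∞).toReal) = (1 / 2 : ℝ) by norm_num,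
      ← Real.sqrt_eq_rpow]
    refine Real.sqrt_le_iff.2 ⟨by linarith, by nlinarith⟩
  refine (ENNReal.toReal_mono (ENNReal.mul_ne_top ENNReal.ofReal_ne_top
    f.memLp_two.eLpNorm_ne_top) h1).trans_eq ?_
  rw [ENNReal.toReal_mul, ENNReal.toReal_ofReal (by linarith)]

end X

/-! ### Spectral radius estimates in the algebra `W` -/

namespace W

theorem fst_pow (w : W) (n : ℕ) : fst (w ^ n) = fst w ^ n := by
  induction n with
  | zero => rw [pow_zero, pow_zero, fst_one]
  | succ n ih => rw [pow_succ, fst_mul, ih, pow_succ]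

theorem snd_pow_succ (w : W) (n : ℕ) :
    snd (w ^ (n + 1)) = w • snd (w ^ n) + (fst w ^ n) • snd w := by
  rw [pow_succ', snd_mul, fst_pow, smul_def]; abel

/-- Multiplication by w costs a factor ρ in L² by Plancherel, and each step of `snd_pow_succ` adds
one term governed by the constant part; hence the factor n + 1. -/
theorem norm_toL2_snd_pow_le {w : W} {ρ : ℝ} (h : ∀ s, ‖sym s w‖ ≤ ρ) (hc : |fst w| ≤ ρ) (n : ℕ) :
    ‖X.toL2 (snd (w ^ (n + 1)))‖ ≤ (n + 1) * ρ ^ n * ‖snd w‖ := by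
  have h0 : 0 ≤ ρ := (abs_nonneg _).trans hc
  induction n with
  | zero => simpa using X.norm_toL2_le (snd w)
  | succ n ih =>
    rw [snd_pow_succ w (n + 1), map_add, map_smul X.toL2 (fst w ^ (n + 1))]
    refine (norm_add_le _ _).trans ?_
    rw [norm_smul (fst w ^ (n + 1))]
    have h1 := (norm_toL2_smul_le h (snd (w ^ (n + 1)))).trans (mul_le_mul_of_nonneg_left ih h0)
    have h2 : ‖fst w ^ (n + 1)‖ * ‖X.toL2 (snd w)‖ ≤ ρ ^ (n + 1) * ‖snd w‖ := by
      rw [norm_pow]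
      exact mul_le_mul (pow_le_pow_left₀ (norm_nonneg _) hc _) (X.norm_toL2_le _) (norm_nonneg _)
        (by positivity)
    refine (add_le_add h1 h2).trans_eq ?_
    push_cast
    ring

theorem mid_snd_pow {w : W} {r : ℝ} (hr : 0 ≤ r) (hw : X.mid r (snd w) = snd w) (n : ℕ) :
    X.mid (n * r) (snd (w ^ n)) = snd (w ^ n) := by
  induction n with
  | zero => rw [pow_zero, snd_one, map_zero]
  | succ n ih =>
    have hn : 0 ≤ (n : ℝ) * r := by positivity
    rw [pow_succ, snd_mul, map_add, map_add, map_smul, map_smul]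
    congr 1
    · congr 1
      · rw [← hw, X.mid_mid (by push_cast; linarith)]
      · rw [← ih, X.mid_mid (by push_cast; linarith)]
    · have := X.mid_mul ih hw
      rwa [show (n : ℝ) * r + r = ((n + 1 : ℕ) : ℝ) * r by push_cast; ring] at this

/-- Spectral radius bound for elements with compactly supported non-constant part. -/
theorem exists_norm_pow_le {w : W} {r ρ ρ' : ℝ} (hr : 0 ≤ r) (hw : X.mid r (snd w) = snd w)
    (h : ∀ s, ‖sym s w‖ ≤ ρ) (hc : |fst w| ≤ ρ) (hρ : ρ < ρ') :
    ∃ C : ℝ, 0 ≤ C ∧ ∀ n, ‖w ^ n‖ ≤ C * ρ' ^ n := by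
  have h0 : 0 ≤ ρ := (abs_nonneg _).trans hc
  have h0' : 0 < ρ' := h0.trans_lt hρ
  have hlt : |ρ / ρ'| < 1 := by
    rw [abs_of_nonneg (by positivity), div_lt_one h0']; exact hρ
  -- Polynomial factors are absorbed by passing from ρ to the larger ρ'.
  have ht : ∀ k : ℕ, ∃ C, 0 ≤ C ∧ ∀ n : ℕ, (n : ℝ) ^ k * ρ ^ n ≤ C * ρ' ^ n := fun k => by
    obtain ⟨C, hC⟩ := (tendsto_pow_const_mul_const_pow_of_abs_lt_one k hlt).bddAbove_range
    refine ⟨max C 0, le_max_right _ _, fun n => ?_⟩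
    have := hC ⟨n, rfl⟩
    simp only [div_pow] at this
    rw [← mul_div_assoc, div_le_iff₀ (by positivity)] at this
    exact this.trans (mul_le_mul_of_nonneg_right (le_max_left _ _) (by positivity))
  obtain ⟨C0, hC0, h0C⟩ := ht 0
  obtain ⟨C1, hC1, h1C⟩ := ht 1
  obtain ⟨C2, hC2, h2C⟩ := ht 2
  -- The support of the non-constant part of the (n+1)-st power lies in [-(n+1)r, (n+1)r], so its L¹
  -- norm is at most 1 + 2(n+1)r times its L² norm. The coefficients of C0, C1, C2 are those of 1,
  -- n, n² after expansion.
  have key : ∀ n, ‖w ^ (n + 1)‖ ≤ ((2 * ‖snd w‖ + ρ + 2 * r * ‖snd w‖) * C0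
      + (2 * ‖snd w‖ + 4 * r * ‖snd w‖) * C1 + 2 * r * ‖snd w‖ * C2) / ρ' * ρ' ^ (n + 1) := by
    intro n
    rw [norm_def, fst_pow, abs_pow, X.norm_eq_add]
    have a1 : |fst w| ^ (n + 1) ≤ ρ ^ (n + 1) := pow_le_pow_left₀ (abs_nonneg _) hc _
    have a2 := norm_toL2_snd_pow_le h hc n
    have a3 := X.norm_toL1_le_of_mid (by positivity) (mid_snd_pow hr hw (n + 1))
    have a4 : ‖X.toL1 (snd (w ^ (n + 1)))‖ ≤
        (1 + 2 * (((n + 1 : ℕ) : ℝ) * r)) * ((n + 1) * ρ ^ n * ‖snd w‖) :=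
      a3.trans (mul_le_mul_of_nonneg_left a2 (by positivity))
    have e : ρ' ^ (n + 1) / ρ' = ρ' ^ n := by rw [pow_succ]; field_simp
    rw [div_mul_eq_mul_div, mul_div_assoc, e]
    refine (add_le_add a1 (add_le_add a4 a2)).trans ?_
    have b0 := mul_le_mul_of_nonneg_left (h0C n)
      (show 0 ≤ 2 * ‖snd w‖ + ρ + 2 * r * ‖snd w‖ by positivity)
    have b1 := mul_le_mul_of_nonneg_left (h1C n)
      (show 0 ≤ 2 * ‖snd w‖ + 4 * r * ‖snd w‖ by positivity)
    have b2 := mul_le_mul_of_nonneg_left (h2C n) (show 0 ≤ 2 * r * ‖snd w‖ by positivity)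
    refine le_trans (le_of_eq ?_) ((add_le_add (add_le_add b0 b1) b2).trans_eq ?_)
    · push_cast; ring
    · ring
  generalize ((2 * ‖snd w‖ + ρ + 2 * r * ‖snd w‖) * C0
      + (2 * ‖snd w‖ + 4 * r * ‖snd w‖) * C1 + 2 * r * ‖snd w‖ * C2) / ρ' = K at key
  refine ⟨max K 1, le_max_of_le_right zero_le_one, fun n => ?_⟩
  cases n with
  | zero =>
    rw [pow_zero, pow_zero, mul_one, norm_one]
    exact le_max_right _ _
  | succ n => exact (key n).trans (mul_le_mul_of_nonneg_right (le_max_left _ _) (by positivity))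

/-- Truncating the non-constant part to [-r,r] changes w by e with ‖e‖ ≤ ε. The truncated w₀
satisfies the compact-support bound, and the binomial expansion of (w₀ + e)ⁿ gives growth at rate ρ
+ 3ε < 1. One ε pays for the change of symbol, one for the polynomial factors, one for e itself. -/
theorem isUnit_one_sub_of_sym {w : W} {ρ : ℝ} (h : ∀ s, ‖sym s w‖ ≤ ρ) (hc : |fst w| ≤ ρ)
    (hρ : ρ < 1) : IsUnit (1 - w) := by
  set ε := (1 - ρ) / 4 with hε
  have hε0 : 0 < ε := by rw [hε]; linarith
  have h0 : 0 ≤ ρ := (abs_nonneg _).trans hc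
  obtain ⟨r, hr0, hr⟩ := ((eventually_ge_atTop 0).and ((X.tendsto_mid (snd w)).eventually
    (Metric.ball_mem_nhds _ hε0))).exists
  set e : W := ι (snd w - X.mid r (snd w)) with he
  set w₀ := w - e with hw₀
  have hen : ‖e‖ ≤ ε := by
    rw [he, ι.norm_map, ← dist_eq_norm, dist_comm]; exact (Metric.mem_ball.1 hr).le
  have hfst : fst w₀ = fst w := by rw [hw₀, fst_sub, he, fst_ι, sub_zero]
  have hsnd : snd w₀ = X.mid r (snd w) := by rw [hw₀, snd_sub, he, snd_ι, sub_sub_cancel]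
  obtain ⟨C, hC, hCn⟩ := exists_norm_pow_le (w := w₀) (ρ := ρ + ε) (ρ' := ρ + 2 * ε) hr0
    (by rw [hsnd, X.mid_mid le_rfl])
    (fun s => by
      rw [hw₀, map_sub]
      exact (norm_sub_le _ _).trans (add_le_add (h s) ((norm_sym_le s e).trans hen)))
    (by rw [hfst]; linarith) (by linarith)
  have hpow : ∀ n, ‖w ^ n‖ ≤ C * (ρ + 3 * ε) ^ n := fun n => by
    have hw : w = w₀ + e := by rw [hw₀, sub_add_cancel]
    rw [hw, add_pow, show ρ + 3 * ε = (ρ + 2 * ε) + ε by ring, add_pow, Finset.mul_sum]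
    refine (norm_sum_le _ _).trans (Finset.sum_le_sum fun m _ => ?_)
    have h1 : ‖w₀ ^ m * e ^ (n - m) * (n.choose m : W)‖ ≤
        ‖w₀ ^ m‖ * ‖e‖ ^ (n - m) * n.choose m := by
      refine (norm_mul_le _ _).trans (mul_le_mul ((norm_mul_le _ _).trans
        (mul_le_mul_of_nonneg_left (norm_pow_le _ _) (norm_nonneg _))) ?_ (norm_nonneg _)
        (by positivity))
      exact (Nat.norm_cast_le _).trans_eq (by rw [norm_one, mul_one])
    refine h1.trans ?_
    rw [← mul_assoc, ← mul_assoc]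
    have := hCn m
    gcongr
  have hlt : ρ + 3 * ε < 1 := by rw [hε]; linarith
  have ht := (tendsto_pow_atTop_nhds_zero_of_lt_one (by positivity) hlt).const_mul C
  rw [mul_zero] at ht
  obtain ⟨n, hn⟩ := (ht.eventually (gt_mem_nhds one_pos)).exists
  exact isUnit_one_sub_of_norm_pow_lt_one ((hpow n).trans_lt hn)

/-- Wiener's lemma: `1 + f` is invertible if its symbol is bounded away from zero. -/
theorem isUnit_one_add_ι {f : X} {δ : ℝ} (hδ : 0 < δ) (h : ∀ s, δ ≤ ‖1 + X.ft s f‖) :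
    IsUnit (1 + ι f) := by
  set v := 1 + ι f with hv
  have hs : ∀ s, sym s v = 1 + X.ft s f := fun s => by rw [hv, map_add, map_one, sym_ι]
  set M := 1 + ‖v‖ with hM
  have hM1 : 1 < M := by
    have : v ≠ 0 := fun h0 => by
      have := h 0
      rw [← hs, h0, map_zero, norm_zero] at this
      linarith
    have := norm_pos_iff.2 this
    linarith
  -- The symbol of v · `star v` is |1 + f̂|², between δ² and M², so w has real symbol in [0, 1 -
  -- δ²/M²]. Its constant part 1 - M⁻² is bounded separately, whence the maximum below.
  set w : W := 1 - (M ^ 2)⁻¹ • (v * star v) with hw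
  have hδM : δ ≤ M := (h 0).trans (by rw [← hs]; exact (norm_sym_le 0 v).trans (by linarith))
  have hsym : ∀ s, sym s w = ((1 - (M ^ 2)⁻¹ * ‖1 + X.ft s f‖ ^ 2 : ℝ) : ℂ) := fun s => by
    rw [hw, map_sub, map_one, sym_smul, map_mul, sym_star, Complex.mul_conj,
      Complex.normSq_eq_norm_sq, hs]
    push_cast; ring
  have hM2 : 0 < (M ^ 2)⁻¹ := by positivity
  have hfst : fst w = 1 - (M ^ 2)⁻¹ := by
    rw [hw, fst_sub, fst_one, fst_smul, fst_mul, fst_star, hv, fst_add, fst_one, fst_ι]; ring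
  have hMle : (M ^ 2)⁻¹ ≤ 1 := inv_le_one_of_one_le₀ (by nlinarith)
  have hu : IsUnit (1 - w) := by
    refine isUnit_one_sub_of_sym (ρ := max (1 - (M ^ 2)⁻¹ * δ ^ 2) (1 - (M ^ 2)⁻¹)) (fun s => ?_)
      ?_ (max_lt (by nlinarith [mul_pos hM2 (pow_pos hδ 2)]) (by linarith))
    · rw [hsym, Complex.norm_real]
      refine le_max_of_le_left ?_
      have h1 : δ ^ 2 ≤ ‖1 + X.ft s f‖ ^ 2 := pow_le_pow_left₀ hδ.le (h s) 2
      have h2 : (M ^ 2)⁻¹ * ‖1 + X.ft s f‖ ^ 2 ≤ 1 := by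
        rw [inv_mul_le_iff₀ (by positivity), mul_one, ← hs]
        exact pow_le_pow_left₀ (norm_nonneg _) ((norm_sym_le s v).trans (by linarith)) 2
      rw [Real.norm_of_nonneg (by linarith)]
      nlinarith
    · rw [hfst, abs_of_nonneg (by linarith)]; exact le_max_right _ _
  rw [hw, sub_sub_cancel] at hu
  have hu2 : IsUnit (v * star v) := by
    have : v * star v = algebraMap ℝ W (M ^ 2) * ((M ^ 2)⁻¹ • (v * star v)) := by
      rw [← Algebra.smul_def, smul_smul, mul_inv_cancel₀ (by positivity), one_smul]
    rw [this]
    exact ((IsUnit.mk0 (M ^ 2) (by positivity)).map (algebraMap ℝ W)).mul hu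
  exact isUnit_of_mul_isUnit_left hu2

end W

/-! ### The scattering map in `L¹ ∩ L²` -/

namespace X

/-- The Wiener algebra element with symbol `conj a`. -/
def coefA (u : X) : W := 1 + W.ι (alpha u)

theorem sym_coefA (s : ℝ) (u : X) : W.sym s (coefA u) = 1 + ft s (alpha u) := by
  rw [coefA, map_add, map_one, W.sym_ι]

theorem isUnit_coefA (u : X) : IsUnit (coefA u) :=
  W.isUnit_one_add_ι one_pos (one_le_norm_one_add_ft_alpha u)

theorem isUnit_star_coefA (u : X) : IsUnit (W.star (coefA u)) := (isUnit_coefA u).map W.star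

theorem star_coefA (u : X) : W.star (coefA u) = 1 + W.ι (refl (alpha u)) := by
  rw [coefA, map_add, map_one, W.star_ι]

/-- The scattering map `u ↦ 𝓕₊ r₊`. -/
def scat (u : X) : X := Ring.inverse (W.star (coefA u)) • beta u

theorem star_coefA_smul_scat (u : X) : W.star (coefA u) • scat u = beta u := by
  rw [scat, smul_smul, Ring.mul_inverse_cancel _ (isUnit_star_coefA u), one_smul]

theorem one_add_ft_alpha_ne_zero (s : ℝ) (u : X) : 1 + ft s (alpha u) ≠ 0 :=
  norm_pos_iff.1 (one_pos.trans_le (one_le_norm_one_add_ft_alpha u s))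

theorem ft_scat (s : ℝ) (u : X) : ft s (scat u) = ft s (beta u) / conj (1 + ft s (alpha u)) := by
  have h : conj (1 + ft s (alpha u)) ≠ 0 := (map_ne_zero _).2 (one_add_ft_alpha_ne_zero s u)
  rw [eq_div_iff h, ← star_coefA_smul_scat, W.ft_smul, W.sym_star, sym_coefA, mul_comm]

/-- `1 - |r|² = |a|⁻²`, in the Wiener algebra. -/
theorem one_sub_scat_mul (u : X) :
    (1 - W.ι (scat u) * W.ι (refl (scat u))) * (coefA u * W.star (coefA u)) = 1 := by
  have h1 : W.star (coefA u) * W.ι (scat u) = W.ι (beta u) := by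
    rw [← W.ι_smul, star_coefA_smul_scat]
  have h2 : coefA u * W.ι (refl (scat u)) = W.ι (refl (beta u)) := by
    have := congrArg W.star h1
    rwa [map_mul, W.star_star, W.star_ι, W.star_ι] at this
  have h3 : coefA u * W.star (coefA u) - W.ι (beta u) * W.ι (refl (beta u)) = 1 := by
    refine W.ext_sym ?_ fun s => ?_
    · rw [W.fst_sub, W.fst_mul, W.fst_mul, W.fst_star, W.fst_ι, coefA, W.fst_add, W.fst_one,
        W.fst_ι]; ring
    · rw [map_sub, map_mul, map_mul, W.sym_star, sym_coefA, W.sym_ι, W.sym_ι, ft_refl, map_one]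
      exact alpha_beta_det u s
  linear_combination h3 - coefA u * W.ι (refl (scat u)) * h1 - W.ι (beta u) * h2

theorem norm_ft_scat_sq (s : ℝ) (u : X) :
    (1 - ‖ft s (scat u)‖ ^ 2) * ‖1 + ft s (alpha u)‖ ^ 2 = 1 := by
  have h := congrArg (W.sym s) (one_sub_scat_mul u)
  rw [map_mul, map_sub, map_one, map_mul, map_mul, W.sym_star, W.sym_ι, W.sym_ι, ft_refl,
    sym_coefA, Complex.mul_conj, Complex.mul_conj, Complex.normSq_eq_norm_sq,
    Complex.normSq_eq_norm_sq] at h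
  exact_mod_cast h

/-- Here (1 - |r|²)|a|² = 1 and |a| ≤ M, so |r|² ≤ 1 - M⁻² uniformly in s. -/
theorem exists_norm_ft_scat_le (u : X) : ∃ ρ < 1, ∀ s, ‖ft s (scat u)‖ ≤ ρ := by
  set M := 1 + ‖alpha u‖ with hM
  have hM1 : 1 ≤ M := by rw [hM]; linarith [norm_nonneg (alpha u)]
  have hlt : 1 - (M ^ 2)⁻¹ < 1 := by
    have : 0 < (M ^ 2)⁻¹ := by positivity
    linarith
  refine ⟨√(1 - (M ^ 2)⁻¹), (Real.sqrt_lt' one_pos).2 (by linarith), fun s => Real.le_sqrt_of_sq_le ?_⟩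
  have h := norm_ft_scat_sq s u
  have h1 : ‖1 + ft s (alpha u)‖ ≤ M :=
    (norm_add_le _ _).trans (by rw [norm_one]; exact add_le_add le_rfl (norm_ft_le s _))
  have h2 : ‖1 + ft s (alpha u)‖ ^ 2 ≤ M ^ 2 := pow_le_pow_left₀ (norm_nonneg _) h1 2
  have h3 : 1 ≤ (1 - ‖ft s (scat u)‖ ^ 2) * M ^ 2 := by
    refine h.symm.le.trans (mul_le_mul_of_nonneg_left h2 ?_)
    by_contra hneg
    push Not at hneg
    nlinarith [sq_nonneg ‖1 + ft s (alpha u)‖]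
  have h4 : (M ^ 2)⁻¹ ≤ 1 - ‖ft s (scat u)‖ ^ 2 := by
    rw [inv_le_iff_one_le_mul₀ (by positivity)]; exact h3
  linarith

/-! ### Analyticity of the scattering map and its derivative at the zero potential -/

theorem analyticAt_coefA (u : X) : AnalyticAt ℝ coefA u :=
  analyticAt_const.add ((W.ι.toContinuousLinearMap.analyticAt _).comp (analyticAt_alpha u))

theorem analyticAt_star_coefA (u : X) : AnalyticAt ℝ (fun u => W.star (coefA u)) u := by
  have h : AnalyticAt ℝ (fun u => 1 + W.ι (refl (alpha u))) u :=
    analyticAt_const.add (((W.ι.comp refl).toContinuousLinearMap.analyticAt _).comp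
      (analyticAt_alpha u))
  exact h.congr (Eventually.of_forall fun u => (star_coefA u).symm)

theorem analyticAt_inverse_coefA (u : X) : AnalyticAt ℝ (fun u => Ring.inverse (coefA u)) u := by
  obtain ⟨z, hz⟩ := isUnit_coefA u
  have h := analyticAt_inverse (𝕜 := ℝ) z
  rw [hz] at h
  exact h.comp (analyticAt_coefA u)

theorem analyticAt_inverse_star_coefA (u : X) :
    AnalyticAt ℝ (fun u => Ring.inverse (W.star (coefA u))) u := by
  obtain ⟨z, hz⟩ := isUnit_star_coefA u
  have h := analyticAt_inverse (𝕜 := ℝ) z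
  rw [hz] at h
  exact h.comp_of_eq (analyticAt_star_coefA u) rfl

theorem analyticAt_scat (u : X) : AnalyticAt ℝ scat u :=
  analyticAt_clm_apply ((W.smulL.analyticAt _).comp (analyticAt_inverse_star_coefA u))
    (analyticAt_beta u)

theorem ker₁_zero : ker₁ 0 = 0 := by
  rw [ker₁, map_zero, _root_.zero_apply, map_zero]

theorem alpha_zero : alpha 0 = 0 := by
  rw [alpha, map_zero, _root_.zero_apply, neg_zero]

theorem beta_zero : beta 0 = 0 := by
  rw [beta, map_zero, _root_.zero_apply, add_zero]

theorem coefA_zero : coefA 0 = 1 := by rw [coefA, alpha_zero, map_zero, add_zero]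

theorem scat_zero : scat 0 = 0 := by rw [scat, beta_zero, smul_zero]

theorem hasFDerivAt_beta_zero : HasFDerivAt beta (ContinuousLinearMap.id ℝ X) 0 := by
  have h1 : HasFDerivAt (fun u => J 1 u (ker₁ u)) (0 : X →L[ℝ] X) 0 := by
    have h := ((J 1).hasFDerivAt (x := 0)).clm_apply
      (analyticAt_ker₁ 0).differentiableAt.hasFDerivAt
    refine h.congr_fderiv ?_
    ext1 v
    simp [ker₁_zero]
  have h := (hasFDerivAt_id (𝕜 := ℝ) (0 : X)).add h1
  rwa [add_zero] at h

/-- At u = 0 the denominator is 1 and `beta` vanishes, so only the derivative of `beta` survives;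
that is the identity because `ker₁` vanishes at 0. -/
theorem hasFDerivAt_scat_zero : HasFDerivAt scat (ContinuousLinearMap.id ℝ X) 0 := by
  have h := ((W.smulL.analyticAt _).comp
    (analyticAt_inverse_star_coefA 0)).differentiableAt.hasFDerivAt.clm_apply hasFDerivAt_beta_zero
  refine h.congr_fderiv ?_
  ext1 v
  simp [beta_zero, coefA_zero, W.smulL_apply]

/-! ### Supports -/

/-- Throughout, `tail c f = f` encodes support in [c,∞) and `tail c f = 0` support in (-∞,c];
reflection exchanges the two. -/
theorem tail_refl_eq_zero {c : ℝ} {f : X} (h : tail c f = f) : tail (-c) (refl f) = 0 := by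
  have := refl_tail c f
  rw [h] at this
  exact sub_eq_self.1 this.symm

theorem tail_refl_eq_self {c : ℝ} {f : X} (h : tail c f = 0) : tail (-c) (refl f) = refl f := by
  have := refl_tail c f
  rw [h, map_zero] at this
  exact (sub_eq_zero.1 this.symm).symm

theorem tail_mul_eq_self {a b : ℝ} {f g : X} (hf : tail a f = f) (hg : tail b g = g) :
    tail (a + b) (f * g) = f * g := by
  rw [mul_def]
  refine tail_J_eq_self ?_
  have := lt_of_toFun_tail_ne_zero a f
  rw [hf] at this
  filter_upwards [this] with t ht h
  simp only [BoundedContinuousFunction.const_apply, one_mul]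
  rw [tail_transl, ← hg, tail_tail, max_eq_right]
  linarith [ht h]

theorem tail_mul_eq_zero {a b : ℝ} {f g : X} (hf : tail a f = 0) (hg : tail b g = 0) :
    tail (a + b) (f * g) = 0 := by
  have h := tail_refl_eq_zero (tail_mul_eq_self (tail_refl_eq_self hf) (tail_refl_eq_self hg))
  rwa [← refl_mul, refl_refl, neg_add, neg_neg, neg_neg] at h

theorem tail_eq_zero_of_le {a b : ℝ} {f : X} (hab : a ≤ b) (hf : tail a f = 0) : tail b f = 0 := by
  have := tail_tail b a f
  rwa [hf, map_zero, max_eq_left hab, eq_comm] at this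

/-- The elements whose non-constant part is supported in `[0, ∞)`. -/
def causal : Subalgebra ℝ W where
  carrier := {w | tail 0 (W.snd w) = W.snd w}
  zero_mem' := map_zero _
  one_mem' := map_zero _
  add_mem' := fun {w z} hw hz => by
    change tail 0 (W.snd w) = _ at hw
    change tail 0 (W.snd z) = _ at hz
    change tail 0 (W.snd (w + z)) = _
    rw [W.snd_add, map_add, hw, hz]
  mul_mem' := fun {w z} hw hz => by
    change tail 0 (W.snd w) = _ at hw
    change tail 0 (W.snd z) = _ at hz
    change tail 0 (W.snd (w * z)) = _
    have := tail_mul_eq_self hw hz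
    rw [add_zero] at this
    rw [W.snd_mul, map_add, map_add, map_smul, map_smul, hw, hz, this]
  algebraMap_mem' := fun c => by
    change tail 0 (W.snd (algebraMap ℝ W c)) = _
    rw [Algebra.algebraMap_eq_smul_one, W.snd_smul, W.snd_one, smul_zero, map_zero]

theorem mem_causal {w : W} : w ∈ causal ↔ tail 0 (W.snd w) = W.snd w := Iff.rfl

theorem isClosed_causal : IsClosed (causal : Set W) := by
  have : (causal : Set W) = {w | tail 0 (W.sndL w) = W.sndL w} := rfl
  rw [this]
  exact isClosed_eq ((tail 0).continuous.comp W.sndL.continuous) W.sndL.continuous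

theorem coefA_mem_causal (u : X) : coefA u ∈ causal :=
  add_mem (one_mem _) (by rw [mem_causal, W.snd_ι]; exact tail_alpha u)

/-- A connectedness argument in place of analytic continuation to a half-plane. The set of u whose
inverse is causal is closed because `causal` is closed and inversion is continuous, and open because
the units of the Banach algebra `causal` are open. It contains 0, and X is connected. -/
theorem inverse_coefA_mem_causal (u : X) : Ring.inverse (coefA u) ∈ causal := by
  let A : X → causal := fun u => ⟨coefA u, coefA_mem_causal u⟩
  have hcoefA : Continuous coefA := continuous_iff_continuousAt.2 fun u =>
    (analyticAt_coefA u).continuousAt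
  have hA : Continuous A := hcoefA.subtype_mk _
  have : CompleteSpace causal := isClosed_causal.completeSpace_coe
  have hiff : ∀ u, IsUnit (A u) ↔ Ring.inverse (coefA u) ∈ causal := fun u => by
    constructor
    · rintro ⟨z, hz⟩
      have h1 : coefA u * ((z⁻¹ : causalˣ) : causal) = 1 := by
        have := congrArg (Subtype.val) z.mul_inv
        rwa [hz] at this
      have h2 := congrArg (fun y => Ring.inverse (coefA u) * y) h1
      simp only [← mul_assoc, Ring.inverse_mul_cancel _ (isUnit_coefA u), one_mul, mul_one] at h2
      rw [← h2]
      exact Subtype.coe_prop _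
    · intro h
      refine IsUnit.of_mul_eq_one ⟨_, h⟩ (Subtype.ext ?_)
      exact Ring.mul_inverse_cancel _ (isUnit_coefA u)
  have hclopen : IsClopen {u | IsUnit (A u)} := by
    constructor
    · have : {u | IsUnit (A u)} = (fun u => Ring.inverse (coefA u)) ⁻¹' (causal : Set W) :=
        Set.ext fun u => hiff u
      rw [this]
      exact isClosed_causal.preimage (continuous_iff_continuousAt.2 fun u =>
        (analyticAt_inverse_coefA u).continuousAt)
    · exact Units.isOpen.preimage hA
  have huniv := hclopen.eq_univ ⟨0, by
    have : A 0 = 1 := Subtype.ext coefA_zero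
    change IsUnit (A 0)
    rw [this]; exact isUnit_one⟩
  exact (hiff u).1 (huniv ▸ Set.mem_univ u : u ∈ {u | IsUnit (A u)})

theorem star_inverse_coefA (u : X) :
    W.star (Ring.inverse (coefA u)) = Ring.inverse (W.star (coefA u)) := by
  have h : W.star (coefA u) * W.star (Ring.inverse (coefA u)) = 1 := by
    rw [← map_mul, Ring.mul_inverse_cancel _ (isUnit_coefA u), map_one]
  have h2 := congrArg (fun y => Ring.inverse (W.star (coefA u)) * y) h
  simpa only [← mul_assoc, Ring.inverse_mul_cancel _ (isUnit_star_coefA u), one_mul, mul_one]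
    using h2

theorem tail_star_smul_eq_zero {w : W} (hw : w ∈ causal) {c : ℝ} {f : X} (hf : tail c f = 0) :
    tail c (W.star w • f) = 0 := by
  have h1 := tail_refl_eq_zero (mem_causal.1 hw)
  rw [neg_zero] at h1
  have h2 := tail_mul_eq_zero h1 hf
  rw [zero_add] at h2
  rw [W.smul_def, W.snd_star, map_add, map_smul, hf, h2, smul_zero, add_zero]

/-- Division by a is multiplication by the reflection of a causal element, which cannot move a
support to the right. -/
theorem tail_eq_zero_of_star_coefA_smul {u f g : X} {c : ℝ} (h : W.star (coefA u) • f = g)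
    (hg : tail c g = 0) : tail c f = 0 := by
  have : f = W.star (Ring.inverse (coefA u)) • g := by
    rw [← h, smul_smul, ← map_mul, Ring.inverse_mul_cancel _ (isUnit_coefA u), map_one, one_smul]
  rw [this]
  exact tail_star_smul_eq_zero (inverse_coefA_mem_causal u) hg

end X

/-! ### Reflection of the potential -/

namespace X

/-- The potential `x ↦ -u(-x)`. -/
def rev (u : X) : X := -refl u

theorem rev_rev (u : X) : rev (rev u) = u := by
  rw [rev, rev, map_neg, refl_refl, neg_neg]

theorem toFun_rev (u : X) : ∀ᵐ x, u.toFun x = -(rev u).toFun (-x) := by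
  have h : (rev u).toFun =ᵐ[volume] fun x => -u.toFun (-x) := by
    filter_upwards [toFun_neg (refl u), toFun_refl u] with x h1 h2
    rw [rev, h1, Pi.neg_apply, h2]
  have := (Measure.measurePreserving_neg (volume : Measure ℝ)).quasiMeasurePreserving.ae_eq_comp h
  filter_upwards [this] with x hx
  simp only [Function.comp_apply, neg_neg] at hx
  rw [hx, neg_neg]

/-- Reflected and conjugated, the Jost solution of the reversed potential solves the system for u
with limit (1, 0) at -∞. The right-hand side is the combination of the Jost solution and its partner
with the same limit, so the difference vanishes. -/
theorem jost_rev (u : X) (s x : ℝ) :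
    conj (jost₁ (rev u) s (-x)) = conj (1 + ft s (alpha u)) * jost₁ u s x
        + ft s (beta u) * conj (jost₂ u s x) ∧
      conj (jost₂ (rev u) s (-x)) = conj (1 + ft s (alpha u)) * jost₂ u s x
        + ft s (beta u) * conj (jost₁ u s x) := by
  have h1 := (isRotSol_jost (rev u) s).comp_neg (toFun_rev u)
  have hJ := isRotSol_jost u s
  have h2 := (hJ.const_mul (conj (1 + ft s (alpha u)))).add (hJ.star.const_mul (ft s (beta u)))
  have h := h1.sub h2
  have hc := Complex.continuous_conj
  have t1 := (tendsto_jost₁_atBot u s)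
  have t2 := (tendsto_jost₂_atBot u s)
  have t1' := (hc.tendsto _).comp t1
  have t2' := (hc.tendsto _).comp t2
  have r1 := (hc.tendsto _).comp ((tendsto_jost₁_atTop (rev u) s).comp tendsto_neg_atBot_atTop)
  have r2 := (hc.tendsto _).comp ((tendsto_jost₂_atTop (rev u) s).comp tendsto_neg_atBot_atTop)
  have hdet := alpha_beta_det u s
  have l1 := r1.sub ((t1.const_mul (conj (1 + ft s (alpha u)))).add (t2'.const_mul (ft s (beta u))))
  have l2 := r2.sub ((t2.const_mul (conj (1 + ft s (alpha u)))).add (t1'.const_mul (ft s (beta u))))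
  rw [show conj 1 - (conj (1 + ft s (alpha u)) * (1 + ft s (alpha u))
    + ft s (beta u) * conj (-ft s (beta u))) = 0 by
      rw [map_one, map_neg]; linear_combination -hdet] at l1
  rw [map_zero, show (0 : ℂ) - (conj (1 + ft s (alpha u)) * -ft s (beta u)
    + ft s (beta u) * conj (1 + ft s (alpha u))) = 0 by ring] at l2
  have hz := rotSol_eq_zero h t1 t2 l1 l2 x
  exact ⟨sub_eq_zero.1 hz.1, sub_eq_zero.1 hz.2⟩

theorem alpha_rev (u : X) : alpha (rev u) = alpha u := by
  refine ext_ft fun s => ?_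
  have hc := Complex.continuous_conj
  have r := (hc.tendsto _).comp ((tendsto_jost₁_atBot (rev u) s).comp tendsto_neg_atTop_atBot)
  have t := ((tendsto_jost₁_atTop u s).const_mul (conj (1 + ft s (alpha u)))).add
    (((hc.tendsto _).comp (tendsto_jost₂_atTop u s)).const_mul (ft s (beta u)))
  have := tendsto_nhds_unique r (t.congr fun x => (jost_rev u s x).1.symm)
  rw [map_zero, mul_zero, add_zero, mul_one] at this
  exact add_left_cancel (star_injective this)

theorem beta_rev (u : X) : beta (rev u) = -refl (beta u) := by
  refine ext_ft fun s => ?_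
  have hc := Complex.continuous_conj
  have r := (hc.tendsto _).comp ((tendsto_jost₂_atBot (rev u) s).comp tendsto_neg_atTop_atBot)
  have t := ((tendsto_jost₂_atTop u s).const_mul (conj (1 + ft s (alpha u)))).add
    (((hc.tendsto _).comp (tendsto_jost₁_atTop u s)).const_mul (ft s (beta u)))
  have := tendsto_nhds_unique r (t.congr fun x => (jost_rev u s x).2.symm)
  rw [map_one, mul_zero, zero_add, mul_one, map_neg] at this
  rw [map_neg, ft_refl, ← this, map_neg, Complex.conj_conj, neg_neg]

theorem coefA_rev (u : X) : coefA (rev u) = coefA u := by rw [coefA, coefA, alpha_rev]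

/-- In symbols the reversed potential has data -(conj a / a) conj r₊. The phase conj a / a depends
on r₊ only through a factorization problem, treated below. -/
theorem scat_rev (u : X) : scat (rev u) =
    -((coefA u * Ring.inverse (W.star (coefA u))) • refl (scat u)) := by
  have h : coefA u • refl (scat u) = refl (beta u) := by
    rw [← star_coefA_smul_scat, W.refl_smul, W.star_star]
  rw [mul_comm, mul_smul, h, scat, coefA_rev, beta_rev, smul_neg]

theorem SPlus_eq_ft (u : X) : SPlus u.toComplex = fun s => ft s (scat u) := by
  funext s; rw [SPlus_eq, ft_scat]

/-- The left reflection coefficient of u is the right one of the reversed potential; this reduces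
the second half of the theorem to the first. -/
theorem SMinus_eq_ft (u : X) : SMinus u.toComplex = fun s => ft s (scat (rev u)) := by
  funext s; rw [SMinus_eq, ft_scat, alpha_rev, beta_rev, map_neg, ft_refl]

/-! ### The Marchenko equations -/

/-- Multiplied by a, the expression becomes the reflected kernel of the reversed potential, by the
second identity of `jost_rev`. That kernel is supported in (-∞,x], and division by a preserves this.
-/
theorem marchenko₂ (u : X) (x : ℝ) :
    tail x (scat u + scat u * refl (ker₁ u x) + ker₂ u x) = 0 := by
  refine tail_eq_zero_of_star_coefA_smul (u := u) (g := refl (ker₂ (rev u) (-x)))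
    (ext_ft fun s => ?_) ?_
  · have h := (jost_rev u s x).2
    have hb := congrArg (ft s) (star_coefA_smul_scat u)
    rw [W.ft_smul, W.sym_star, sym_coefA] at hb
    rw [W.ft_smul, W.sym_star, sym_coefA, ft_refl, map_add (ft s), map_add (ft s), ft_mul, ft_refl]
    rw [jost₁, jost₂, jost₂, map_add (starRingEnd ℂ) 1 (ft s (ker₁ u x)), map_one] at h
    rw [h]
    linear_combination (1 + conj (ft s (ker₁ u x))) * hb
  · simpa using tail_refl_eq_zero (tail_ker₂ (rev u) (-x))

/-- The same argument with the first identity of `jost_rev`; subtracting `alpha u` accounts for a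
multiplying the constant 1. -/
theorem marchenko₁ (u : X) (x : ℝ) :
    tail 0 (scat u * refl (ker₂ u x) + ker₁ u x) = 0 := by
  refine tail_eq_zero_of_star_coefA_smul (u := u) (g := refl (ker₁ (rev u) (-x) - alpha u))
    (ext_ft fun s => ?_) ?_
  · have h := (jost_rev u s x).1
    have hb := congrArg (ft s) (star_coefA_smul_scat u)
    rw [W.ft_smul, W.sym_star, sym_coefA] at hb
    rw [W.ft_smul, W.sym_star, sym_coefA, ft_refl, map_add (ft s), map_sub, ft_mul, ft_refl, map_sub]
    rw [jost₁, jost₁, jost₂] at h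
    simp only [map_add (starRingEnd ℂ), map_one] at h hb ⊢
    linear_combination conj (ft s (ker₂ u x)) * hb - h
  · have := tail_refl_eq_zero (c := 0) (f := ker₁ (rev u) (-x) - alpha u)
      (by rw [map_sub, tail_ker₁, tail_alpha])
    simpa using this

/-! ### Correlations -/

/-- The `L²` inner product. -/
def ip (f g : X) : ℝ := inner ℝ (toL2 f) (toL2 g)

theorem ip_eq_integral (f g : X) : ip f g = ∫ x, g.toFun x * f.toFun x := by
  rw [ip, L2.inner_def]
  refine integral_congr_ae ?_
  filter_upwards [toL2_ae f, toL2_ae g] with x h1 h2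
  rw [h1, h2]
  simp

theorem abs_ip_le (f g : X) : |ip f g| ≤ ‖toL2 f‖ * ‖toL2 g‖ := abs_real_inner_le_norm _ _

theorem ip_sub_right (f g h : X) : ip f (g - h) = ip f g - ip f h := by
  rw [ip, map_sub, inner_sub_right]; rfl

theorem ip_sub_left (f g h : X) : ip (f - g) h = ip f h - ip g h := by
  rw [ip, map_sub, inner_sub_left]; rfl

theorem ip_comm (f g : X) : ip f g = ip g f := real_inner_comm _ _

theorem ip_comp (φ : ℝ → ℝ) (hφ : MeasurePreserving φ volume volume) (f g : X) :
    ip (comp φ hφ f) (comp φ hφ g) = ip f g := by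
  have h : ∀ f g : X, ip f g = (‖toL2 (f + g)‖ * ‖toL2 (f + g)‖ - ‖toL2 f‖ * ‖toL2 f‖
      - ‖toL2 g‖ * ‖toL2 g‖) / 2 := fun f g => by
    rw [ip, map_add]
    exact real_inner_eq_norm_add_mul_self_sub_norm_mul_self_sub_norm_mul_self_div_two _ _
  rw [h, h, ← map_add, norm_toL2_comp, norm_toL2_comp, norm_toL2_comp]

theorem transl_neg_transl (t : ℝ) (f : X) : transl (-t) (transl t f) = f := by
  refine ext_ft fun s => ?_
  rw [ft_transl, ft_transl, ← mul_assoc, ← Complex.exp_add]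
  push_cast
  rw [show -(I * s * -(t : ℂ)) + -(I * s * t) = 0 by ring, Complex.exp_zero, one_mul]

theorem ip_transl (t : ℝ) (f g : X) : ip f (transl t g) = ip (transl (-t) f) g := by
  conv_rhs => rw [← transl_neg_transl t g]
  exact (ip_comp _ _ f (transl t g)).symm

/-- `ip f` as a continuous linear map. -/
def ipL (f : X) : X →L[ℝ] ℝ := (innerSL ℝ (toL2 f)).comp toL2

theorem ipL_apply (f g : X) : ipL f g = ip f g := rfl

theorem ip_integral_smul_transl (f g h : X) :
    ip f (g * h) = ∫ t, g.toFun t * ip f (transl t h) := by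
  rw [mul_def, J_apply, ← ipL_apply,
    ← ContinuousLinearMap.integral_comp_comm _ (integrable_smul_transl 1 g _)]
  refine integral_congr_ae (Eventually.of_forall fun t => ?_)
  simp only [map_smul, ipL_apply, BoundedContinuousFunction.const_apply, one_mul, smul_eq_mul]

/-- For real functions the adjoint of convolution by g is convolution by its reflection. -/
theorem ip_mul (f g h : X) : ip f (g * h) = ip (refl g * f) h := by
  rw [ip_integral_smul_transl, ip_comm _ h, ip_integral_smul_transl,
    ← integral_neg_eq_self]
  refine integral_congr_ae ?_
  filter_upwards [toFun_refl g] with t ht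
  rw [ht, ip_transl, neg_neg, ip_comm]

/-- The indicator of a set of finite measure. -/
def ind (S : Set ℝ) (hS : MeasurableSet S) (h : volume S < ∞) : X :=
  ofMemLp (S.indicator fun _ => 1) (memLp_indicator_const 1 hS 1 (Or.inr h.ne))
    (memLp_indicator_const 2 hS 1 (Or.inr h.ne))

theorem toFun_ind {S : Set ℝ} (hS : MeasurableSet S) (h : volume S < ∞) :
    (ind S hS h).toFun =ᵐ[volume] S.indicator fun _ => 1 := toFun_ofMemLp _ _

theorem ip_ind {S : Set ℝ} (hS : MeasurableSet S) (h : volume S < ∞) (f : X) :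
    ip (ind S hS h) f = ∫ x in S, f.toFun x := by
  rw [ip_eq_integral, ← integral_indicator hS]
  refine integral_congr_ae ?_
  filter_upwards [toFun_ind hS h] with x hx
  rw [hx]
  by_cases hxS : x ∈ S <;> simp [hxS]

theorem continuous_transl_neg (f : X) : Continuous fun w : ℝ => transl (-w) f :=
  continuous_transl.comp (continuous_neg.prodMk continuous_const)

/-- The convolution with a reflected function is given by correlations, almost everywhere. -/
theorem toFun_mul_refl (f g : X) :
    (f * refl g).toFun =ᵐ[volume] fun w => ip (transl (-w) f) g := by
  have hcont : Continuous fun w : ℝ => ip (transl (-w) f) g := by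
    have : Continuous fun w : ℝ => ipL g (transl (-w) f) :=
      (ipL g).continuous.comp (continuous_transl_neg f)
    exact this.congr fun w => by rw [ipL_apply, ip_comm]
  have hbdd : ∀ w : ℝ, ‖ip (transl (-w) f) g‖ ≤ ‖toL2 f‖ * ‖toL2 g‖ := fun w => by
    rw [← norm_toL2_transl (-w) f]; exact abs_ip_le _ _
  -- Both sides are integrated over sets of finite measure; adjointness of convolution turns the
  -- pairing of the left side with an indicator into an integral of correlations.
  refine ae_eq_of_forall_setIntegral_eq_of_sigmaFinite
    (fun S _ _ => (f * refl g).integrable.integrableOn)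
    (fun S _ h => ?_) (fun S hS h => ?_)
  · have : IsFiniteMeasure (volume.restrict S) := ⟨by rwa [Measure.restrict_apply_univ]⟩
    exact Integrable.of_bound hcont.aestronglyMeasurable _ (Eventually.of_forall hbdd)
  · rw [← ip_ind hS h, mul_comm, ip_mul, refl_refl, ip_comm, mul_comm, ip_comm]
    have h1 := ip_mul g (refl (ind S hS h)) f
    rw [refl_refl] at h1
    rw [← h1, ip_integral_smul_transl, ← integral_indicator hS, ← integral_neg_eq_self]
    have h2 := (Measure.measurePreserving_neg (volume : Measure ℝ)).quasiMeasurePreserving.ae_eq_comp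
      (toFun_refl (ind S hS h))
    refine integral_congr_ae ?_
    filter_upwards [h2, toFun_ind hS h] with w h3 h4
    simp only [Function.comp_apply, neg_neg] at h3
    rw [h3, h4, ip_comm]
    by_cases hw : w ∈ S <;> simp [hw]

end X

namespace X

/-! ### Recovery of the potential from its scattering data -/

theorem ker₁_eq_marchenko (u : X) (x : ℝ) : ker₁ u x = -tail 0 (scat u * refl (ker₂ u x)) := by
  have h := marchenko₁ u x
  rw [map_add, tail_ker₁] at h
  exact eq_neg_of_add_eq_zero_right h

theorem ker₂_eq_marchenko (u : X) (x : ℝ) :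
    ker₂ u x = -tail x (scat u + scat u * refl (ker₁ u x)) := by
  have h := marchenko₂ u x
  rw [map_add, tail_ker₂] at h
  exact eq_neg_of_add_eq_zero_right h

/-- `ker₂` has two expressions, the Volterra one containing u and the Marchenko one containing `scat
u`; equating them compares the two on (x,∞). -/
theorem tail_sub_scat (u : X) (x : ℝ) :
    tail x (u - scat u - scat u * refl (ker₁ u x)) = -J 1 (tail x u) (ker₁ u) := by
  have h := ker₂_eq_marchenko u x
  rw [ker₂_apply, map_add] at h
  rw [map_sub, map_sub, eq_neg_iff_add_eq_zero]
  have h2 := neg_injective h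
  rw [sub_sub, ← h2]
  abel

/-- The continuous part of the potential, `x ↦ ∫₀^∞ F(x + z) k₁(x, z) dz`. -/
def corr (u : X) (x : ℝ) : ℝ := ip (transl (-x) (scat u)) (ker₁ u x)

theorem continuous_ip {Z : Type*} [TopologicalSpace Z] {f g : Z → X} (hf : Continuous f)
    (hg : Continuous g) : Continuous fun z => ip (f z) (g z) :=
  (toL2.continuous.comp hf).inner (toL2.continuous.comp hg)

theorem continuous_corr (u : X) : Continuous (corr u) :=
  continuous_ip (continuous_transl_neg _) (ker₁ u).continuous

theorem cut_eq_zero_of_tail {S : Set ℝ} (hS : MeasurableSet S) {f : X} (hf : tail 0 f = f)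
    (h : ∀ x ∈ S, x ≤ 0) : cut S hS f = 0 := by
  rw [← hf, tail, cut_cut]
  have : S ∩ Set.Ioi 0 = ∅ := Set.eq_empty_iff_forall_notMem.2 fun x hx =>
    absurd (h x hx.1) (not_le.2 hx.2)
  apply ext_ae
  filter_upwards [toFun_cut (hS.inter (measurableSet_Ioi (a := (0 : ℝ)))) f, toFun_zero]
    with x h1 h2
  rw [h1, h2, this, Set.indicator_empty]
  rfl

theorem norm_cut_mono {S T : Set ℝ} (hS : MeasurableSet S) (hT : MeasurableSet T) (h : S ⊆ T)
    (f : X) : ‖cut S hS f‖ ≤ ‖cut T hT f‖ := by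
  refine norm_le_of_ae ?_
  filter_upwards [toFun_cut hS f, toFun_cut hT f] with x h1 h2
  rw [h1, h2]
  by_cases hx : x ∈ S
  · rw [Set.indicator_of_mem hx, Set.indicator_of_mem (h hx)]
  · rw [Set.indicator_of_notMem hx, abs_zero]; exact abs_nonneg _

theorem setIntegral_abs_eq {S : Set ℝ} (hS : MeasurableSet S) (f : X) :
    ∫ x in S, |f.toFun x| = ‖toL1 (cut S hS f)‖ := by
  rw [norm_toL1_eq_integral, ← integral_indicator hS]
  refine integral_congr_ae ?_
  filter_upwards [toFun_cut hS f] with x hx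
  rw [hx]
  by_cases h : x ∈ S <;> simp [h]

/-- After translation by t > x, only the part of k₁(t) to the left of h is visible in (x, x+h], and
nothing at all if t > x + h. -/
theorem setIntegral_abs_J_le (u : X) {x h η : ℝ}
    (hη : ∀ t ∈ Set.Ioc x (x + h), ‖cut (Set.Iic h) measurableSet_Iic (ker₁ u t)‖ ≤ η) :
    ∫ w in Set.Ioc x (x + h), |(J 1 (tail x u) (ker₁ u)).toFun w| ≤
      η * ∫ t in Set.Ioc x (x + h), |u.toFun t| := by
  rw [setIntegral_abs_eq measurableSet_Ioc]
  refine (norm_toL1_le _).trans ?_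
  rw [J_apply, ← ContinuousLinearMap.integral_comp_comm _ (integrable_smul_transl 1 _ _)]
  refine (norm_integral_le_integral_norm _).trans ?_
  rw [← integral_const_mul, ← integral_indicator measurableSet_Ioc]
  refine integral_mono_of_nonneg (Eventually.of_forall fun t => norm_nonneg _)
    ((u.integrable.abs.const_mul η).indicator measurableSet_Ioc) ?_
  filter_upwards [toFun_tail x u] with t ht
  simp only [map_smul, norm_smul, ht, one_mul]
  rw [cut_transl, LinearIsometry.norm_map]
  by_cases h1 : x < t
  · rw [Set.indicator_of_mem (Set.mem_Ioi.2 h1)]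
    by_cases h2 : t ≤ x + h
    · rw [Set.indicator_of_mem (Set.mem_Ioc.2 ⟨h1, h2⟩), Real.norm_eq_abs, mul_comm]
      refine mul_le_mul_of_nonneg_right ((norm_cut_mono _ measurableSet_Iic ?_ _).trans
        (hη t ⟨h1, h2⟩)) (abs_nonneg _)
      intro z hz
      rw [Set.mem_preimage, Set.mem_Ioc] at hz
      rw [Set.mem_Iic]
      linarith [hz.2]
    · rw [Set.indicator_of_notMem fun hh => h2 (Set.mem_Ioc.1 hh).2,
        cut_eq_zero_of_tail _ (tail_ker₁ u t), norm_zero, mul_zero]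
      intro z hz
      rw [Set.mem_preimage, Set.mem_Ioc] at hz
      linarith [hz.2]
  · rw [Set.indicator_of_notMem fun hh => h1 (Set.mem_Ioi.1 hh),
      Set.indicator_of_notMem fun hh => h1 (Set.mem_Ioc.1 hh).1, norm_zero, zero_mul]

/-- On (x, x+h] the difference consists of the Volterra term and the error made by freezing the
kernel at x in the correlation; both are controlled by η. -/
theorem setIntegral_abs_sub_le (u : X) {x h η : ℝ} (hh : 0 ≤ h)
    (hη : ∀ t ∈ Set.Ioc x (x + h), ‖cut (Set.Iic h) measurableSet_Iic (ker₁ u t)‖ ≤ η)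
    (hη' : ∀ t ∈ Set.Ioc x (x + h), ‖ker₁ u x - ker₁ u t‖ ≤ η) :
    ∫ w in Set.Ioc x (x + h), |u.toFun w - (scat u).toFun w - corr u w| ≤
      η * (∫ t in Set.Ioc x (x + h), |u.toFun t|) + ‖scat u‖ * η * h := by
  have h2 : ∫ w in Set.Ioc x (x + h), |u.toFun w - (scat u).toFun w - corr u w| ≤
      ∫ w in Set.Ioc x (x + h), (|(J 1 (tail x u) (ker₁ u)).toFun w| + ‖scat u‖ * η) := by
    refine integral_mono_of_nonneg (Eventually.of_forall fun t => abs_nonneg _)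
      ((J 1 (tail x u) (ker₁ u)).integrable.abs.integrableOn.add
        (integrableOn_const (by simp))) ?_
    have e := toFun_tail x (u - scat u - scat u * refl (ker₁ u x))
    rw [tail_sub_scat] at e
    filter_upwards [ae_restrict_mem measurableSet_Ioc,
      ae_restrict_of_ae e, ae_restrict_of_ae (toFun_neg (J 1 (tail x u) (ker₁ u))),
      ae_restrict_of_ae (toFun_sub (u - scat u) (scat u * refl (ker₁ u x))),
      ae_restrict_of_ae (toFun_sub u (scat u)),
      ae_restrict_of_ae (toFun_mul_refl (scat u) (ker₁ u x))] with w hw e1 e2 e3 e4 e5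
    rw [e2, Set.indicator_of_mem (Set.mem_Ioi.2 hw.1), e3, Pi.sub_apply, e4, Pi.sub_apply, e5,
      Pi.neg_apply] at e1
    have e6 : u.toFun w - (scat u).toFun w - corr u w = -(J 1 (tail x u) (ker₁ u)).toFun w
        + ip (transl (-w) (scat u)) (ker₁ u x - ker₁ u w) := by
      rw [e1, ip_sub_right, corr]; ring
    rw [e6]
    refine (abs_add_le _ _).trans (add_le_add (abs_neg _).le ((abs_ip_le _ _).trans ?_))
    refine mul_le_mul ?_ ((norm_toL2_le _).trans (hη' w hw)) (norm_nonneg _) (norm_nonneg _)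
    rw [norm_toL2_transl]; exact norm_toL2_le _
  refine h2.trans ?_
  rw [integral_add (J 1 (tail x u) (ker₁ u)).integrable.abs.integrableOn
    (integrableOn_const (by simp))]
  refine add_le_add (setIntegral_abs_J_le u hη) (le_of_eq ?_)
  rw [setIntegral_const, measureReal_def, Real.volume_Ioc, add_sub_cancel_left,
    ENNReal.toReal_ofReal hh, smul_eq_mul, mul_comm]

/-- k₁ is continuous in x with values in X, and k₁(x), supported in [0,∞), has little norm on (-∞,h]
for small h. -/
theorem eventually_norm_cut_ker₁_le (u : X) (x : ℝ) {η : ℝ} (hη : 0 < η) :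
    ∀ᶠ h in 𝓝[>] (0 : ℝ), ∀ t ∈ Set.Ioc x (x + h),
      ‖cut (Set.Iic h) measurableSet_Iic (ker₁ u t)‖ ≤ η ∧ ‖ker₁ u x - ker₁ u t‖ ≤ η := by
  obtain ⟨δ, hδ, h1⟩ := Metric.continuousAt_iff.1 ((ker₁ u).continuous.continuousAt (x := x))
    (η / 2) (half_pos hη)
  have h2 : Tendsto (fun h => cut (Set.Iic h) measurableSet_Iic (ker₁ u x)) (𝓝 0) (𝓝 0) := by
    have := (continuous_tail (ker₁ u x)).tendsto 0 |>.const_sub (ker₁ u x)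
    rw [tail_ker₁, sub_self] at this
    exact this.congr fun h => sub_tail h _
  have h3 := (h2.mono_left (nhdsWithin_le_nhds (s := Set.Ioi 0))).eventually
    (Metric.ball_mem_nhds 0 (half_pos hη))
  filter_upwards [h3, self_mem_nhdsWithin, nhdsWithin_le_nhds (Metric.ball_mem_nhds (0 : ℝ) hδ)]
    with h h4 h5 h6 t ht
  have h7 : ‖ker₁ u t - ker₁ u x‖ < η / 2 := by
    rw [← dist_eq_norm]
    refine h1 ?_
    rw [Real.dist_eq, abs_of_pos (by linarith [ht.1])]
    rw [Metric.mem_ball, Real.dist_eq, sub_zero] at h6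
    linarith [ht.2, le_abs_self h]
  rw [dist_zero_right] at h4
  refine ⟨?_, by rw [norm_sub_rev]; linarith⟩
  have h8 : cut (Set.Iic h) measurableSet_Iic (ker₁ u t) =
      cut (Set.Iic h) measurableSet_Iic (ker₁ u t - ker₁ u x)
        + cut (Set.Iic h) measurableSet_Iic (ker₁ u x) := by rw [← map_add, sub_add_cancel]
  rw [h8]
  refine (norm_add_le _ _).trans ?_
  linarith [norm_cut_le (measurableSet_Iic (a := h)) (ker₁ u t - ker₁ u x)]

/-- The potential is the sum of its scattering data and a continuous function. -/
theorem toFun_eq_scat_add_corr (u : X) :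
    u.toFun =ᵐ[volume] fun x => (scat u).toFun x + corr u x := by
  have hloc : LocallyIntegrable (fun w => |u.toFun w - (scat u).toFun w - corr u w|) volume :=
    fun x => IntegrableAtFilter.norm (((u.integrable.sub (scat u).integrable).locallyIntegrable.sub
      (continuous_corr u).locallyIntegrable) x)
  filter_upwards [LocallyIntegrable.ae_hasDerivAt_integral hloc,
    LocallyIntegrable.ae_hasDerivAt_integral u.integrable.abs.locallyIntegrable] with x h1 h2
  have t1 := (h1 x).tendsto_slope_zero_right
  have t2 := (h2 x).tendsto_slope_zero_right
  simp only [intervalIntegral.integral_same, sub_zero, smul_eq_mul] at t1 t2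
  -- At a common Lebesgue point the estimate on (x, x+h] is divided by h and h tends to 0 from the
  -- right; afterwards η tends to 0.
  have hle : ∀ η > 0, |u.toFun x - (scat u).toFun x - corr u x| ≤
      η * (|u.toFun x| + ‖scat u‖) := by
    intro η hη
    have t3 := (t2.add_const ‖scat u‖).const_mul η
    refine le_of_tendsto_of_tendsto t1 t3 ?_
    filter_upwards [eventually_norm_cut_ker₁_le u x hη, self_mem_nhdsWithin] with h h3 h4
    have h4' : 0 < h := h4
    have h5 := setIntegral_abs_sub_le u h4'.le (fun t ht => (h3 t ht).1) fun t ht => (h3 t ht).2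
    rw [intervalIntegral.integral_of_le (by linarith), intervalIntegral.integral_of_le (by linarith),
      inv_mul_le_iff₀ h4']
    refine h5.trans_eq ?_
    field_simp
  have h0 : |u.toFun x - (scat u).toFun x - corr u x| ≤ 0 := by
    have t : Tendsto (fun η => η * (|u.toFun x| + ‖scat u‖)) (𝓝[>] (0 : ℝ)) (𝓝 0) := by
      have := (continuous_mul_const (|u.toFun x| + ‖scat u‖)).tendsto (0 : ℝ)
      rw [zero_mul] at this
      exact this.mono_left nhdsWithin_le_nhds
    exact ge_of_tendsto t (by filter_upwards [self_mem_nhdsWithin] with η hη using hle η hη)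
  have := abs_nonpos_iff.1 h0
  linarith

end X

namespace X

/-! ### Dependence of the kernels on the scattering data -/

theorem norm_toL2_mul_le {f : X} {ρ : ℝ} (h : ∀ s, ‖ft s f‖ ≤ ρ) (g : X) :
    ‖toL2 (f * g)‖ ≤ ρ * ‖toL2 g‖ :=
  norm_toL2_le_of_norm_ft_le ((norm_nonneg _).trans (h 0)) fun s => by
    rw [ft_mul, norm_mul]; exact mul_le_mul_of_nonneg_right (h s) (norm_nonneg _)

theorem norm_toL2_mul_refl_le {f : X} {ρ : ℝ} (h : ∀ s, ‖ft s f‖ ≤ ρ) (g : X) :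
    ‖toL2 (f * refl g)‖ ≤ ρ * ‖toL2 g‖ := by
  rw [← norm_toL2_refl g]; exact norm_toL2_mul_le h _

theorem norm_toL2_tail_le (c : ℝ) (f : X) : ‖toL2 (tail c f)‖ ≤ ‖toL2 f‖ := norm_toL2_cut_le _ f

theorem tail_sub_tail_eq_zero (x : ℝ) (f : X) : tail x (f - tail x f) = 0 := by
  rw [map_sub, tail_tail, max_self, sub_self]

/-- The reflection of g lives on (-∞,-c], so the part of f to the left of x contributes nothing
beyond x - c. This makes the Marchenko equations at x depend only on data to the right of x. -/
theorem tail_mul_refl {x c : ℝ} (f : X) {g : X} (hg : tail c g = g) :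
    tail (x - c) (f * refl g) = tail (x - c) (tail x f * refl g) := by
  rw [← sub_eq_zero, ← map_sub, ← sub_mul]
  exact tail_mul_eq_zero (tail_sub_tail_eq_zero x f) (tail_refl_eq_zero hg)

/-- In the Marchenko system, restriction and reflection do not increase the L² norm and convolution
with the data contracts it by ρ. -/
theorem norm_toL2_ker_le {u : X} {ρ M : ℝ} (hρ : ρ < 1) (h : ∀ s, ‖ft s (scat u)‖ ≤ ρ)
    (hM : ‖scat u‖ ≤ M) (x : ℝ) :
    ‖toL2 (ker₁ u x)‖ ≤ M / (1 - ρ) ∧ ‖toL2 (ker₂ u x)‖ ≤ M / (1 - ρ) := by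
  have h0 : 0 ≤ ρ := (norm_nonneg _).trans (h 0)
  have h1 : ‖toL2 (ker₁ u x)‖ ≤ ρ * ‖toL2 (ker₂ u x)‖ := by
    conv_lhs => rw [ker₁_eq_marchenko, map_neg, norm_neg]
    exact (norm_toL2_tail_le _ _).trans (norm_toL2_mul_refl_le h _)
  have h2 : ‖toL2 (ker₂ u x)‖ ≤ M + ρ * ‖toL2 (ker₁ u x)‖ := by
    conv_lhs => rw [ker₂_eq_marchenko, map_neg, norm_neg]
    refine (norm_toL2_tail_le _ _).trans ?_
    rw [map_add]
    exact (norm_add_le _ _).trans (add_le_add ((norm_toL2_le _).trans hM)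
      (norm_toL2_mul_refl_le h _))
  have hn1 := norm_nonneg (toL2 (ker₁ u x))
  have hn2 := norm_nonneg (toL2 (ker₂ u x))
  rw [le_div_iff₀ (by linarith), le_div_iff₀ (by linarith)]
  constructor <;> nlinarith

/-- The differences solve the Marchenko system of u with source terms linear in the difference of
data, where `tail_mul_refl` restricts that difference to (x,∞). The same contraction then applies.
-/
theorem norm_toL2_ker₁_sub_le {u v : X} {ρ M : ℝ} (hρ : ρ < 1) (hu : ∀ s, ‖ft s (scat u)‖ ≤ ρ)
    (hv : ∀ s, ‖ft s (scat v)‖ ≤ ρ) (hvM : ‖scat v‖ ≤ M) (x : ℝ) :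
    ‖toL2 (ker₁ u x - ker₁ v x)‖ ≤
      (1 + 2 * (M / (1 - ρ))) / (1 - ρ) * ‖tail x (scat u - scat v)‖ := by
  set d := ‖tail x (scat u - scat v)‖ with hd
  obtain ⟨b1, b2⟩ := norm_toL2_ker_le hρ hv hvM x
  have hft : ∀ s, ‖ft s (tail x (scat u - scat v))‖ ≤ d := fun s => norm_ft_le s _
  have e1 : ker₁ u x - ker₁ v x = -(tail 0 (scat u * refl (ker₂ u x - ker₂ v x))
      + tail 0 (tail x (scat u - scat v) * refl (ker₂ v x))) := by
    have h := tail_mul_refl (x := x) (scat u - scat v) (tail_ker₂ v x)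
    rw [sub_self] at h
    rw [← h, ← map_add, ker₁_eq_marchenko u, ker₁_eq_marchenko v, ← sub_eq_zero]
    have : scat u * refl (ker₂ u x - ker₂ v x) + (scat u - scat v) * refl (ker₂ v x) =
        scat u * refl (ker₂ u x) - scat v * refl (ker₂ v x) := by
      rw [map_sub, mul_sub, sub_mul]; abel
    rw [this, map_sub]; abel
  have e2 : ker₂ u x - ker₂ v x = -(tail x (scat u - scat v)
      + tail x (scat u * refl (ker₁ u x - ker₁ v x))
      + tail x (tail x (scat u - scat v) * refl (ker₁ v x))) := by
    have h := tail_mul_refl (x := x) (scat u - scat v) (tail_ker₁ v x)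
    rw [sub_zero] at h
    rw [← h, ← map_add, ← map_add, ker₂_eq_marchenko u, ker₂_eq_marchenko v, ← sub_eq_zero]
    have : scat u - scat v + scat u * refl (ker₁ u x - ker₁ v x)
        + (scat u - scat v) * refl (ker₁ v x) =
        scat u + scat u * refl (ker₁ u x) - (scat v + scat v * refl (ker₁ v x)) := by
      rw [map_sub, mul_sub, sub_mul]; abel
    rw [this, map_sub]; abel
  have n1 : ‖toL2 (ker₁ u x - ker₁ v x)‖ ≤ ρ * ‖toL2 (ker₂ u x - ker₂ v x)‖
      + d * (M / (1 - ρ)) := by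
    conv_lhs => rw [e1, map_neg, norm_neg, map_add]
    refine (norm_add_le _ _).trans (add_le_add
      ((norm_toL2_tail_le _ _).trans (norm_toL2_mul_refl_le hu _))
      ((norm_toL2_tail_le _ _).trans ((norm_toL2_mul_refl_le hft _).trans ?_)))
    exact mul_le_mul_of_nonneg_left b2 (norm_nonneg _)
  have n2 : ‖toL2 (ker₂ u x - ker₂ v x)‖ ≤ d + ρ * ‖toL2 (ker₁ u x - ker₁ v x)‖
      + d * (M / (1 - ρ)) := by
    conv_lhs => rw [e2, map_neg, norm_neg, map_add, map_add]
    refine (norm_add_le _ _).trans (add_le_add ((norm_add_le _ _).trans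
      (add_le_add (norm_toL2_le _) ((norm_toL2_tail_le _ _).trans (norm_toL2_mul_refl_le hu _))))
      ((norm_toL2_tail_le _ _).trans ((norm_toL2_mul_refl_le hft _).trans ?_)))
    exact mul_le_mul_of_nonneg_left b1 (norm_nonneg _)
  have hn := norm_nonneg (toL2 (ker₂ u x - ker₂ v x))
  rw [div_mul_eq_mul_div, le_div_iff₀ (by linarith)]
  nlinarith

theorem ip_tail (c : ℝ) (f g : X) : ip f (tail c g) = ip (tail c f) g := by
  rw [ip_eq_integral, ip_eq_integral]
  refine integral_congr_ae ?_
  filter_upwards [toFun_tail c f, toFun_tail c g] with x h1 h2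
  rw [h1, h2]
  by_cases h : x ∈ Set.Ioi c <;> simp [h]

/-- The continuous part of the potential at `x` depends, in a Lipschitz way, only on the
scattering data to the right of `x`. -/
theorem exists_abs_corr_sub_le {ρ : ℝ} (hρ : ρ < 1) {M : ℝ} (hM : 0 ≤ M) :
    ∃ C, 0 ≤ C ∧ ∀ u v : X, (∀ s, ‖ft s (scat u)‖ ≤ ρ) → (∀ s, ‖ft s (scat v)‖ ≤ ρ) →
      ‖scat u‖ ≤ M → ‖scat v‖ ≤ M → ∀ x,
        |corr u x - corr v x| ≤ C * ‖tail x (scat u - scat v)‖ := by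
  have hρ' : 0 < 1 - ρ := by linarith
  refine ⟨M / (1 - ρ) + M * ((1 + 2 * (M / (1 - ρ))) / (1 - ρ)), by positivity, ?_⟩
  intro u v hu hv huM hvM x
  have e : corr u x - corr v x = ip (transl (-x) (tail x (scat u - scat v))) (ker₁ u x)
      + ip (transl (-x) (scat v)) (ker₁ u x - ker₁ v x) := by
    have h : ip (transl (-x) (tail x (scat u - scat v))) (ker₁ u x)
        = ip (transl (-x) (scat u)) (ker₁ u x) - ip (transl (-x) (scat v)) (ker₁ u x) := by
      have h1 := tail_transl 0 (-x) (scat u - scat v)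
      rw [zero_sub, neg_neg] at h1
      rw [← h1, ← ip_tail, tail_ker₁, map_sub, ip_sub_left]
    rw [h, ip_sub_right, corr, corr]; ring
  rw [e, add_mul]
  refine (abs_add_le _ _).trans (add_le_add ?_ ?_)
  · refine (abs_ip_le _ _).trans ?_
    rw [norm_toL2_transl, mul_comm]
    exact mul_le_mul (norm_toL2_ker_le hρ hu huM x).1 (norm_toL2_le _) (norm_nonneg _)
      (by positivity)
  · refine (abs_ip_le _ _).trans ?_
    rw [norm_toL2_transl, mul_assoc]
    exact mul_le_mul ((norm_toL2_le _).trans hvM) (norm_toL2_ker₁_sub_le hρ hu hv hvM x)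
      (norm_nonneg _) hM

/-- For x > c the Lipschitz bound on `corr` has zero right-hand side, so both terms of u = `scat u`
+ `corr u` agree on (c,∞). -/
theorem tail_eq_of_tail_scat_eq {u v : X} {c : ℝ} (h : tail c (scat u) = tail c (scat v)) :
    tail c u = tail c v := by
  obtain ⟨ρ₁, h1, hu⟩ := exists_norm_ft_scat_le u
  obtain ⟨ρ₂, h2, hv⟩ := exists_norm_ft_scat_le v
  obtain ⟨C, -, hC⟩ := exists_abs_corr_sub_le (max_lt h1 h2)
    ((norm_nonneg (scat u)).trans (le_max_left _ ‖scat v‖))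
  have hC' := hC u v (fun s => (hu s).trans (le_max_left _ _))
    (fun s => (hv s).trans (le_max_right _ _)) (le_max_left _ _) (le_max_right _ _)
  apply ext_ae
  have e := toFun_tail c (scat u)
  rw [h] at e
  filter_upwards [toFun_tail c u, toFun_tail c v, toFun_eq_scat_add_corr u,
    toFun_eq_scat_add_corr v, e, toFun_tail c (scat v)] with x a1 a2 a3 a4 a5 a6
  rw [a1, a2]
  by_cases hx : x ∈ Set.Ioi c
  · rw [a5, Set.indicator_of_mem hx, Set.indicator_of_mem hx] at a6
    rw [Set.indicator_of_mem hx, Set.indicator_of_mem hx, a3, a4, a6]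
    have hx' : tail x (scat u - scat v) = 0 :=
      tail_eq_zero_of_le (le_of_lt (Set.mem_Ioi.1 hx)) (by rw [map_sub, h, sub_self])
    have := hC' x
    rw [hx', norm_zero, mul_zero] at this
    linarith [abs_nonpos_iff.1 this]
  · rw [Set.indicator_of_notMem hx, Set.indicator_of_notMem hx]

/-- On a half-line where the scattering data are small, the potential depends on them in a
Lipschitz way. -/
theorem exists_norm_tail_sub_le : ∃ δ > 0, ∀ (u v : X) (c : ℝ), ‖tail c (scat u)‖ < δ →
    ‖tail c (scat v)‖ < δ → ‖tail c (u - v)‖ ≤ 2 * ‖scat u - scat v‖ := by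
  have hs : HasStrictFDerivAt scat
      ((ContinuousLinearEquiv.refl ℝ X : X ≃L[ℝ] X) : X →L[ℝ] X) 0 := by
    have h := (analyticAt_scat 0).hasStrictFDerivAt
    rwa [hasFDerivAt_scat_zero.fderiv] at h
  -- Near 0 the map `scat` minus the identity is Lipschitz with constant 1/2, and all sufficiently
  -- small data are attained there.
  obtain ⟨S, hS, hA⟩ := hs.approximates_deriv_on_nhds (c := 1 / 2) (Or.inr (by norm_num))
  have himg : scat '' S ∈ 𝓝 (0 : X) := by
    have := hs.map_nhds_eq_of_equiv
    rw [scat_zero] at this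
    rw [← this]
    exact image_mem_map hS
  obtain ⟨δ, hδ, hball⟩ := Metric.mem_nhds_iff.1 himg
  refine ⟨δ, hδ, fun u v c hu hv => ?_⟩
  -- The truncated data are small even where the full data are not. They belong to potentials u₀, v₀
  -- near 0, which agree with u, v on (c,∞) by causality.
  obtain ⟨u₀, hu₀, eu⟩ := hball (mem_ball_zero_iff.2 hu)
  obtain ⟨v₀, hv₀, ev⟩ := hball (mem_ball_zero_iff.2 hv)
  have cu : tail c u₀ = tail c u := tail_eq_of_tail_scat_eq (by rw [eu, tail_tail, max_self])
  have cv : tail c v₀ = tail c v := tail_eq_of_tail_scat_eq (by rw [ev, tail_tail, max_self])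
  have h := hA u₀ hu₀ v₀ hv₀
  rw [eu, ev] at h
  have h1 : ‖u₀ - v₀‖ ≤ ‖tail c (scat u) - tail c (scat v)‖ + 1 / 2 * ‖u₀ - v₀‖ := by
    have e : u₀ - v₀ = (tail c (scat u) - tail c (scat v))
        - (tail c (scat u) - tail c (scat v) - (u₀ - v₀)) := by abel
    have h' : ‖tail c (scat u) - tail c (scat v) - (u₀ - v₀)‖ ≤ 1 / 2 * ‖u₀ - v₀‖ := by
      simpa using h
    conv_lhs => rw [e]
    exact (norm_sub_le _ _).trans (add_le_add le_rfl h')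
  rw [← map_sub] at h1
  have h2 := norm_tail_le c (scat u - scat v)
  have h3 : ‖tail c (u - v)‖ ≤ ‖u₀ - v₀‖ := by
    rw [map_sub, ← cu, ← cv, ← map_sub]; exact norm_tail_le c _
  linarith

end X

namespace X

/-! ### The scattering data of the reflected potential -/

/-- `1 - |F̂|²` in the Wiener algebra. -/
def defect (F : X) : W := 1 - W.ι F * W.ι (refl F)

theorem defect_mul (u : X) : defect (scat u) * (coefA u * W.star (coefA u)) = 1 :=
  one_sub_scat_mul u

theorem isUnit_defect {F : X} {ρ : ℝ} (hρ : ρ < 1) (h : ∀ s, ‖ft s F‖ ≤ ρ) :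
    IsUnit (defect F) := by
  have h0 : 0 ≤ ρ := (norm_nonneg _).trans (h 0)
  have e : defect F = 1 + W.ι (-(F * refl F)) := by
    rw [map_neg, ← W.ι_smul_eq_mul, W.ι_smul, defect]; ring
  rw [e]
  refine W.isUnit_one_add_ι (δ := 1 - ρ ^ 2) (by nlinarith) fun s => ?_
  rw [map_neg, ft_mul, ft_refl, Complex.mul_conj, Complex.normSq_eq_norm_sq]
  have h1 : ‖ft s F‖ ^ 2 ≤ ρ ^ 2 := pow_le_pow_left₀ (norm_nonneg _) (h s) 2
  have h2 : (1 + -((‖ft s F‖ ^ 2 : ℝ) : ℂ)) = ((1 - ‖ft s F‖ ^ 2 : ℝ) : ℂ) := by push_cast; ring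
  rw [h2, Complex.norm_real]
  exact (by linarith : 1 - ρ ^ 2 ≤ 1 - ‖ft s F‖ ^ 2).trans (le_abs_self _)

theorem continuous_defect : Continuous defect :=
  continuous_const.sub (W.ι.continuous.mul (W.ι.continuous.comp refl.continuous))

theorem norm_defect_sub_le {F G : X} {M : ℝ} (hF : ‖F‖ ≤ M) (hG : ‖G‖ ≤ M) :
    ‖defect F - defect G‖ ≤ 2 * M * ‖F - G‖ := by
  have e : defect F - defect G = -(W.ι F * W.ι (refl (F - G)) + W.ι (F - G) * W.ι (refl G)) := by
    simp only [defect, map_sub]; ring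
  rw [e, norm_neg]
  refine (norm_add_le _ _).trans ?_
  have h1 := norm_mul_le (W.ι F) (W.ι (refl (F - G)))
  have h2 := norm_mul_le (W.ι (F - G)) (W.ι (refl G))
  simp only [LinearIsometry.norm_map] at h1 h2
  nlinarith [norm_nonneg (F - G)]

/-- An a priori bound for a Riemann–Hilbert problem near the trivial one. -/
theorem norm_le_of_factorization {p e q : W} (hp₀ : W.fst p = 0)
    (hp : tail 0 (W.snd p) = W.snd p) (hq : tail 0 (W.snd q) = 0) (h : p + e + p * e = q)
    (he : ‖e‖ ≤ 1 / 2) : ‖p‖ ≤ 2 * ‖e‖ ∧ ‖q‖ ≤ 4 * ‖e‖ := by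
  have h1 : W.snd p = -tail 0 (W.snd (e + p * e)) := by
    rw [← h, add_assoc, W.snd_add, map_add, hp] at hq
    exact eq_neg_of_add_eq_zero_left hq
  have h2 : ‖p‖ ≤ ‖e‖ + ‖p‖ * ‖e‖ := by
    have e1 : ‖p‖ = ‖W.snd p‖ := by rw [W.norm_def, hp₀, abs_zero, zero_add]
    conv_lhs => rw [e1, h1, norm_neg]
    refine (norm_tail_le _ _).trans ((W.norm_snd_le _).trans ((norm_add_le _ _).trans ?_))
    exact add_le_add le_rfl (norm_mul_le _ _)
  have hp2 : ‖p‖ ≤ 2 * ‖e‖ := by nlinarith [norm_nonneg p]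
  refine ⟨hp2, ?_⟩
  rw [← h]
  refine (norm_add_le _ _).trans ((add_le_add (norm_add_le _ _) (norm_mul_le _ _)).trans ?_)
  nlinarith [norm_nonneg p, norm_nonneg e]

/-! ### Stability of the factorization 1 - |r|² = 1/(a conj a) -/

/-- The element with symbol `conj a / a`. -/
def phase (u : X) : W := coefA u * Ring.inverse (W.star (coefA u))

theorem fst_coefA (u : X) : W.fst (coefA u) = 1 := by
  rw [coefA, W.fst_add, W.fst_one, W.fst_ι, add_zero]

theorem fst_inverse_coefA (u : X) : W.fst (Ring.inverse (coefA u)) = 1 := by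
  have := congrArg W.fst (Ring.mul_inverse_cancel _ (isUnit_coefA u))
  rwa [W.fst_mul, fst_coefA, one_mul, W.fst_one] at this

/-- With a, b the elements `coefA` of u and v, the quotient b/a is causal and `star (a/b)`
anti-causal; their deviations p, q from 1 satisfy p + e + pe = q, so both are O(‖e‖). The phase is
multiplied by (1+p)(1+q), and 2‖e‖ + 4‖e‖ + 8‖e‖² ≤ 10‖e‖ for ‖e‖ ≤ 1/2. -/
theorem norm_phase_sub_le {u v : X}
    (he : ‖(defect (scat v) - defect (scat u)) * (coefA u * W.star (coefA u))‖ ≤ 1 / 2) :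
    ‖phase v - phase u‖ ≤ ‖phase u‖ *
      (10 * ‖(defect (scat v) - defect (scat u)) * (coefA u * W.star (coefA u))‖) := by
  set e := (defect (scat v) - defect (scat u)) * (coefA u * W.star (coefA u)) with hedef
  set a := coefA u
  set b := coefA v
  set ai := Ring.inverse a
  set bi := Ring.inverse b
  have haa : a * ai = 1 := Ring.mul_inverse_cancel _ (isUnit_coefA u)
  have hbb : b * bi = 1 := Ring.mul_inverse_cancel _ (isUnit_coefA v)
  have haa' : W.star a * W.star ai = 1 := by rw [← map_mul, haa, map_one]
  have hbb' : W.star b * W.star bi = 1 := by rw [← map_mul, hbb, map_one]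
  have hai : ai ∈ causal := inverse_coefA_mem_causal u
  have hbi : bi ∈ causal := inverse_coefA_mem_causal v
  set p := b * ai - 1 with hpdef
  set q := W.star (a * bi - 1) with hqdef
  have hp : p ∈ causal := sub_mem (mul_mem (coefA_mem_causal v) hai) (one_mem _)
  have hq : a * bi - 1 ∈ causal := sub_mem (mul_mem (coefA_mem_causal u) hbi) (one_mem _)
  have hp₀ : W.fst p = 0 := by
    rw [hpdef, W.fst_sub, W.fst_mul, fst_coefA, fst_inverse_coefA, W.fst_one]; norm_num
  have hq' : tail 0 (W.snd q) = 0 := by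
    have := tail_refl_eq_zero (mem_causal.1 hq)
    rwa [neg_zero, ← W.snd_star] at this
  have hDu : defect (scat u) * (a * W.star a) = 1 := defect_mul u
  have hDv : defect (scat v) * (b * W.star b) = 1 := defect_mul v
  have hfac : p + e + p * e = q := by
    have hDv' : defect (scat v) * b = W.star bi := by
      linear_combination (W.star bi) * hDv - defect (scat v) * b * hbb'
    rw [hqdef, map_sub, map_mul, map_one, hpdef, hedef]
    linear_combination W.star a * hDv' + (W.star a * b * defect (scat v)) * haa - b * ai * hDu
  obtain ⟨h1, h2⟩ := norm_le_of_factorization hp₀ hp hq' hfac he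
  have hphase : phase v - phase u = phase u * (p + q + p * q) := by
    rw [phase, phase, ← star_inverse_coefA, ← star_inverse_coefA, hqdef, map_sub, map_mul, map_one,
      hpdef]
    change b * W.star bi - a * W.star ai = a * W.star ai * _
    linear_combination (-(b * ai * a * W.star bi)) * haa' - (b * W.star bi) * haa
  rw [hphase]
  refine (norm_mul_le _ _).trans (mul_le_mul_of_nonneg_left ?_ (norm_nonneg _))
  refine (norm_add_le _ _).trans ((add_le_add (norm_add_le _ _) (norm_mul_le _ _)).trans ?_)
  nlinarith [norm_nonneg p, norm_nonneg q, norm_nonneg e]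

/-- The set of scattering data, `sup |F̂| < 1`. -/
def unitBall : Set X := {F | ∃ ρ < 1, ∀ s, ‖ft s F‖ ≤ ρ}

theorem mem_unitBall {F : X} : F ∈ unitBall ↔ ∃ ρ < 1, ∀ s, ‖ft s F‖ ≤ ρ := Iff.rfl

theorem scat_mem_unitBall (u : X) : scat u ∈ unitBall := exists_norm_ft_scat_le u

/-- By `scat_rev` only the phase must be controlled. The element with symbol |a|² is the inverse of
`defect` of the data, hence bounded near F uniformly over all potentials with such data, and
`norm_phase_sub_le` applies uniformly. -/
theorem exists_norm_scat_rev_sub_le {F : X} (hF : F ∈ unitBall) :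
    ∃ ε > 0, ∃ C, 0 ≤ C ∧ ∀ u v : X, ‖scat u - F‖ < ε → ‖scat v - F‖ < ε →
      ‖scat (rev u) - scat (rev v)‖ ≤ C * ‖scat u - scat v‖ := by
  obtain ⟨ρ, hρ, hFρ⟩ := hF
  obtain ⟨z, hz⟩ := isUnit_defect hρ hFρ
  have hinv : ContinuousAt (fun G : X => Ring.inverse (defect G)) F := by
    have h := NormedRing.inverse_continuousAt z
    rw [hz] at h
    exact ContinuousAt.comp' h continuous_defect.continuousAt
  obtain ⟨ε₁, hε₁, hb⟩ := Metric.eventually_nhds_iff.1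
    (hinv.norm.eventually (gt_mem_nhds (lt_add_one ‖Ring.inverse (defect F)‖)))
  set N := ‖Ring.inverse (defect F)‖ + 1 with hN
  have hN0 : 0 < N := by positivity
  set M := ‖F‖ + 1 with hM
  have hM0 : 0 < M := by positivity
  -- Two data within ε of F are at most 2ε apart, so the factorization error is at most 2M · 2ε · N
  -- ≤ 1/2.
  set ε := min ε₁ (min 1 (1 / (8 * M * N))) with hε
  have hε0 : 0 < ε := by positivity
  have hprod : ∀ u : X, ‖scat u - F‖ < ε → ‖coefA u * W.star (coefA u)‖ ≤ N := fun u hu => by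
    have h1 : coefA u * W.star (coefA u) = Ring.inverse (defect (scat u)) := by
      have hu' : IsUnit (defect (scat u)) := IsUnit.of_mul_eq_one _ (defect_mul u)
      have := congrArg (fun y => Ring.inverse (defect (scat u)) * y) (defect_mul u)
      simpa only [← mul_assoc, Ring.inverse_mul_cancel _ hu', one_mul, mul_one] using this
    rw [h1]
    exact (hb (by rw [dist_eq_norm]; exact hu.trans_le (min_le_left _ _))).le
  have hnorm : ∀ u : X, ‖scat u - F‖ < ε → ‖scat u‖ ≤ M := fun u hu => by
    have := norm_add_le (scat u - F) F
    rw [sub_add_cancel] at this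
    linarith [hu.trans_le ((min_le_right _ _).trans (min_le_left _ _))]
  have hphase : ∀ u v : X, ‖scat u - F‖ < ε → ‖scat v - F‖ < ε →
      ‖phase v - phase u‖ ≤ ‖phase u‖ * (20 * M * N * ‖scat u - scat v‖) := fun u v hu hv => by
    have h1 : ‖(defect (scat v) - defect (scat u)) * (coefA u * W.star (coefA u))‖ ≤
        2 * M * ‖scat u - scat v‖ * N := by
      refine (norm_mul_le _ _).trans (mul_le_mul ?_ (hprod u hu) (norm_nonneg _) (by positivity))
      rw [norm_sub_rev]
      exact norm_defect_sub_le (hnorm u hu) (hnorm v hv)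
    have h2 : ‖scat u - scat v‖ ≤ 2 * ε := by
      have := norm_sub_le (scat u - F) (scat v - F)
      rw [sub_sub_sub_cancel_right] at this
      linarith
    have h3 : 2 * M * ‖scat u - scat v‖ * N ≤ 1 / 2 := by
      have h4 : ε ≤ 1 / (8 * M * N) := (min_le_right _ _).trans (min_le_right _ _)
      rw [le_div_iff₀ (by positivity)] at h4
      have h5 := mul_le_mul_of_nonneg_left h2 (show 0 ≤ M * N by positivity)
      linarith
    refine (norm_phase_sub_le (h1.trans h3)).trans (mul_le_mul_of_nonneg_left ?_ (norm_nonneg _))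
    linarith
  -- One reference potential bounds all phases near F by comparison. If no data come close to F, the
  -- claim is vacuous.
  by_cases hex : ∃ w : X, ‖scat w - F‖ < ε
  · obtain ⟨w, hw⟩ := hex
    set K := ‖phase w‖ * (1 + 20 * M * N * (2 * ε)) with hK
    have hK0 : 0 ≤ K := by positivity
    have hKb : ∀ u : X, ‖scat u - F‖ < ε → ‖phase u‖ ≤ K := fun u hu => by
      have h1 := hphase w u hw hu
      have h2 : ‖scat w - scat u‖ ≤ 2 * ε := by
        have := norm_sub_le (scat w - F) (scat u - F)
        rw [sub_sub_sub_cancel_right] at this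
        linarith
      have h3 := norm_add_le (phase u - phase w) (phase w)
      rw [sub_add_cancel] at h3
      have h4 : ‖phase w‖ * (20 * M * N * ‖scat w - scat u‖) ≤
          ‖phase w‖ * (20 * M * N * (2 * ε)) := by gcongr
      rw [hK, mul_add, mul_one]
      linarith
    refine ⟨ε, hε0, K * (20 * M * N) * M + K, by positivity, fun u v hu hv => ?_⟩
    have e : scat (rev u) - scat (rev v) =
        (phase v - phase u) • refl (scat u) + phase v • refl (scat v - scat u) := by
      rw [scat_rev, scat_rev, map_sub, sub_smul, smul_sub]
      change -(phase u • _) - -(phase v • _) = _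
      abel
    rw [e, add_mul]
    refine (norm_add_le _ _).trans (add_le_add ?_ ?_)
    · refine (W.norm_smul_le' _ _).trans ?_
      rw [LinearIsometry.norm_map]
      have h1 := hphase u v hu hv
      have h2 : ‖phase v - phase u‖ ≤ K * (20 * M * N * ‖scat u - scat v‖) :=
        h1.trans (mul_le_mul_of_nonneg_right (hKb u hu) (by positivity))
      refine (mul_le_mul h2 (hnorm u hu) (norm_nonneg _) (by positivity)).trans_eq ?_
      ring
    · refine (W.norm_smul_le' _ _).trans ?_
      rw [LinearIsometry.norm_map, norm_sub_rev]
      exact mul_le_mul_of_nonneg_right (hKb v hv) (norm_nonneg _)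
  · exact ⟨ε, hε0, 0, le_rfl, fun u v hu _ => absurd ⟨u, hu⟩ hex⟩

theorem norm_sub_tail_neg (c : ℝ) (g : X) : ‖g - tail (-c) g‖ = ‖tail c (refl g)‖ := by
  have h := refl_tail (-c) g
  rw [neg_neg] at h
  rw [← LinearIsometry.norm_map refl (g - tail (-c) g), map_sub, h, sub_sub_cancel]

/-- The inverse of the scattering map is locally Lipschitz. -/
theorem exists_norm_sub_le {F : X} (hF : F ∈ unitBall) :
    ∃ ε > 0, ∃ C, 0 ≤ C ∧ ∀ u v : X, ‖scat u - F‖ < ε → ‖scat v - F‖ < ε →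
      ‖u - v‖ ≤ C * ‖scat u - scat v‖ := by
  obtain ⟨ε₀, hε₀, C, hC, hrev⟩ := exists_norm_scat_rev_sub_le hF
  obtain ⟨ρ, hρ, hFρ⟩ := hF
  obtain ⟨δ, hδ, htail⟩ := exists_norm_tail_sub_le
  -- The bounds serve, in order: validity of the reversed estimate; right tails below δ; left tails
  -- below δ, since 2Cε ≤ δ/4; norms at most ‖F‖ + 1; symbols at most (1 + ρ)/2.
  set ε := min ε₀ (min (δ / 2) (min (δ / (8 * (C + 1))) (min 1 ((1 - ρ) / 2)))) with hε
  have hρ' : 0 < (1 - ρ) / 2 := by linarith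
  have hε0 : 0 < ε := by positivity
  have e1 : ε ≤ ε₀ := min_le_left _ _
  have e2 : ε ≤ δ / 2 := (min_le_right _ _).trans (min_le_left _ _)
  have e3 : ε ≤ δ / (8 * (C + 1)) :=
    (min_le_right _ _).trans ((min_le_right _ _).trans (min_le_left _ _))
  have e4 : ε ≤ 1 := (min_le_right _ _).trans ((min_le_right _ _).trans
    ((min_le_right _ _).trans (min_le_left _ _)))
  have e5 : ε ≤ (1 - ρ) / 2 := (min_le_right _ _).trans ((min_le_right _ _).trans
    ((min_le_right _ _).trans (min_le_right _ _)))
  by_cases hex : ∃ w : X, ‖scat w - F‖ < ε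
  swap
  · exact ⟨ε, hε0, 0, le_rfl, fun u v hu _ => absurd ⟨u, hu⟩ hex⟩
  obtain ⟨w, hw⟩ := hex
  -- One c serves for all data near F: on the right through F itself, on the left through the
  -- reversed reference potential w.
  obtain ⟨c, hc0, hc1, hc2⟩ := ((eventually_ge_atTop (0 : ℝ)).and <|
    ((tendsto_tail_atTop F).norm.eventually
    (gt_mem_nhds (by rw [norm_zero]; exact half_pos hδ))).and
    ((tendsto_tail_atTop (scat (rev w))).norm.eventually
      (gt_mem_nhds (by rw [norm_zero]; exact half_pos hδ)))).exists
  have hnorm : ∀ u : X, ‖scat u - F‖ < ε → ‖scat u‖ ≤ ‖F‖ + 1 := fun u hu => by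
    have := norm_add_le (scat u - F) F
    rw [sub_add_cancel] at this
    linarith
  have hft : ∀ u : X, ‖scat u - F‖ < ε → ∀ s, ‖ft s (scat u)‖ ≤ (1 + ρ) / 2 := fun u hu s => by
    have h1 := norm_add_le (ft s (scat u - F)) (ft s F)
    rw [← map_add, sub_add_cancel] at h1
    linarith [norm_ft_le s (scat u - F), hFρ s]
  have hr : ∀ u : X, ‖scat u - F‖ < ε → ‖tail c (scat u)‖ < δ := fun u hu => by
    have h1 := norm_add_le (tail c (scat u - F)) (tail c F)
    rw [← map_add, sub_add_cancel] at h1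
    linarith [norm_tail_le c (scat u - F)]
  have hl : ∀ u : X, ‖scat u - F‖ < ε → ‖tail c (scat (rev u))‖ < δ := fun u hu => by
    have h1 := norm_add_le (tail c (scat (rev u) - scat (rev w))) (tail c (scat (rev w)))
    rw [← map_add, sub_add_cancel] at h1
    have h2 := norm_tail_le c (scat (rev u) - scat (rev w))
    have h3 := hrev u w (hu.trans_le e1) (hw.trans_le e1)
    have h4 : ‖scat u - scat w‖ ≤ 2 * ε := by
      have := norm_sub_le (scat u - F) (scat w - F)
      rw [sub_sub_sub_cancel_right] at this
      linarith
    have h5 : C * ‖scat u - scat w‖ ≤ C * (2 * ε) := mul_le_mul_of_nonneg_left h4 hC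
    rw [le_div_iff₀ (by linarith)] at e3
    nlinarith
  obtain ⟨C', hC', hcorr⟩ := exists_abs_corr_sub_le (ρ := (1 + ρ) / 2) (by linarith)
    (M := ‖F‖ + 1) (by positivity)
  have hSf : volume (Set.Ioc (-c) c) < ∞ := by rw [Real.volume_Ioc]; exact ENNReal.ofReal_lt_top
  set χ : X := ind (Set.Ioc (-c) c) measurableSet_Ioc hSf with hχ
  refine ⟨ε, hε0, 2 + 2 * C + (1 + C' * ‖χ‖), by positivity, fun u v hu hv => ?_⟩
  set d := ‖scat u - scat v‖ with hd
  have hR : ‖tail c (u - v)‖ ≤ 2 * d := htail u v c (hr u hu) (hr v hv)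
  have hL : ‖(u - v) - tail (-c) (u - v)‖ ≤ 2 * C * d := by
    rw [norm_sub_tail_neg]
    have h1 := htail (rev u) (rev v) c (hl u hu) (hl v hv)
    rw [show rev u - rev v = -refl (u - v) by rw [rev, rev, map_sub]; abel, map_neg, norm_neg] at h1
    linarith [hrev u v (hu.trans_le e1) (hv.trans_le e1)]
  -- On (-c,c] the potentials differ by their data and by the difference of the `corr` terms. The
  -- latter is uniformly at most C'd, which the indicator χ converts into a bound in X.
  have hMid : ‖tail (-c) (u - v) - tail c (u - v)‖ ≤ (1 + C' * ‖χ‖) * d := by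
    rw [tail_sub_tail (by linarith)]
    set P := cut (Set.Ioc (-c) c) measurableSet_Ioc with hP
    have h1 : ‖P (u - v) - P (scat u - scat v)‖ ≤ ‖(C' * d) • χ‖ := by
      rw [← map_sub]
      refine norm_le_of_ae ?_
      filter_upwards [toFun_cut (measurableSet_Ioc (a := -c) (b := c)) (u - v - (scat u - scat v)),
        toFun_sub (u - v) (scat u - scat v), toFun_sub u v, toFun_sub (scat u) (scat v),
        toFun_eq_scat_add_corr u, toFun_eq_scat_add_corr v, toFun_smul (C' * d) χ,
        toFun_ind (measurableSet_Ioc (a := -c) (b := c)) hSf] with x a1 a2 a3 a4 a5 a6 a7 a8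
      rw [a1, a7, Pi.smul_apply, a8]
      by_cases hx : x ∈ Set.Ioc (-c) c
      · rw [Set.indicator_of_mem hx, Set.indicator_of_mem hx, a2, Pi.sub_apply, a3, a4,
          Pi.sub_apply, Pi.sub_apply, a5, a6, smul_eq_mul, mul_one,
          abs_of_nonneg (mul_nonneg hC' (norm_nonneg _))]
        rw [show (scat u).toFun x + corr u x - ((scat v).toFun x + corr v x)
          - ((scat u).toFun x - (scat v).toFun x) = corr u x - corr v x by ring]
        exact (hcorr u v (hft u hu) (hft v hv) (hnorm u hu) (hnorm v hv) x).trans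
          (mul_le_mul_of_nonneg_left (norm_tail_le x _) hC')
      · rw [Set.indicator_of_notMem hx, Set.indicator_of_notMem hx, smul_zero]
    have h2 : ‖P (scat u - scat v)‖ ≤ d := norm_cut_le _ _
    have h3 := norm_add_le (P (u - v) - P (scat u - scat v)) (P (scat u - scat v))
    rw [sub_add_cancel] at h3
    rw [norm_smul, Real.norm_of_nonneg (mul_nonneg hC' (norm_nonneg _))] at h1
    linarith
  have hsum : u - v = tail c (u - v) + (tail (-c) (u - v) - tail c (u - v))
      + ((u - v) - tail (-c) (u - v)) := by abel
  have h1 := norm_add₃_le (a := tail c (u - v)) (b := tail (-c) (u - v) - tail c (u - v))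
    (c := (u - v) - tail (-c) (u - v))
  rw [← hsum] at h1
  linarith

end X

/-! ### A global inverse function theorem -/

section GlobalInverse

variable {E : Type*} [NormedAddCommGroup E] [NormedSpace ℝ E]

/-- A local Lipschitz bound for the inverse, near `F`. -/
def InverseLipschitzAt (T : E → E) (F : E) : Prop :=
  ∃ ε > 0, ∃ C, 0 ≤ C ∧ ∀ u v : E, ‖T u - F‖ < ε → ‖T v - F‖ < ε → ‖u - v‖ ≤ C * ‖T u - T v‖

/-- The Lipschitz bound is applied to difference quotients along u + tx as t tends to 0 from the
right. -/
theorem norm_le_mul_norm_fderiv {T : E → E} {u : E} (hT : DifferentiableAt ℝ T u) {C : ℝ}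
    (h : ∀ᶠ v in 𝓝 u, ‖v - u‖ ≤ C * ‖T v - T u‖) (x : E) : ‖x‖ ≤ C * ‖fderiv ℝ T u x‖ := by
  have hl : HasDerivAt (fun t : ℝ => T (u + t • x)) (fderiv ℝ T u x) 0 := by
    have h1 : HasDerivAt (fun t : ℝ => u + t • x) x 0 := by
      simpa using ((hasDerivAt_id (0 : ℝ)).smul_const x).const_add u
    have h2 : HasFDerivAt T (fderiv ℝ T u) (u + (0 : ℝ) • x) := by simpa using hT.hasFDerivAt
    exact h2.comp_hasDerivAt 0 h1
  have t1 := hl.tendsto_slope_zero_right.norm.const_mul C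
  refine ge_of_tendsto t1 ?_
  have hc : Tendsto (fun t : ℝ => u + t • x) (𝓝[>] 0) (𝓝 u) := by
    have : Continuous fun t : ℝ => u + t • x := by fun_prop
    have := this.tendsto 0
    rw [zero_smul, add_zero] at this
    exact this.mono_left nhdsWithin_le_nhds
  filter_upwards [hc.eventually h, self_mem_nhdsWithin] with t h3 h4
  have h4' : 0 < t := h4
  rw [add_sub_cancel_left, norm_smul, Real.norm_of_nonneg h4'.le] at h3
  rw [zero_add, zero_smul, add_zero, norm_smul, norm_inv, Real.norm_of_nonneg h4'.le,
    mul_left_comm, le_inv_mul_iff₀ h4']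
  exact h3

theorem exists_equiv_of_isUnit_fderiv {T : E → E} {u : E} (hT : AnalyticAt ℝ T u)
    (h : IsUnit (fderiv ℝ T u)) :
    ∃ i : E ≃L[ℝ] E, HasStrictFDerivAt T (i : E →L[ℝ] E) u := by
  obtain ⟨x, hx⟩ := h
  refine ⟨ContinuousLinearEquiv.unitsEquiv ℝ E x, ?_⟩
  have := hT.hasStrictFDerivAt
  rw [← hx] at this
  exact this

variable [CompleteSpace E]

theorem isUnit_of_norm_sub_lt {R : Type*} [NormedRing R] [CompleteSpace R] {x : Rˣ} {y : R} {C : ℝ}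
    (hC : ‖((x⁻¹ : Rˣ) : R)‖ ≤ C) (h : ‖(x : R) - y‖ * C < 1) : IsUnit y := by
  have h1 : ‖((x : R) - y) * ((x⁻¹ : Rˣ) : R)‖ < 1 :=
    ((norm_mul_le _ _).trans (mul_le_mul_of_nonneg_left hC (norm_nonneg _))).trans_lt h
  have h2 : IsUnit (1 - ((x : R) - y) * ((x⁻¹ : Rˣ) : R)) := (Units.oneSub _ h1).isUnit
  have h3 : y = (1 - ((x : R) - y) * ((x⁻¹ : Rˣ) : R)) * x := by
    rw [sub_mul, sub_mul, sub_mul, Units.mul_inv, one_mul, mul_assoc, Units.inv_mul, mul_one,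
      sub_sub_cancel]
  rw [h3]
  exact h2.mul x.isUnit

/-- The set where the derivative is invertible is open, and closed because near any limit point the
inverses are bounded by the local Lipschitz constant, so a small perturbation remains invertible.
The whole space is connected. -/
theorem isUnit_fderiv_of_inverseLipschitz {T : E → E} (hT : ∀ u, AnalyticAt ℝ T u) {u₀ : E}
    (h₀ : IsUnit (fderiv ℝ T u₀)) (hL : ∀ u, InverseLipschitzAt T (T u)) (u : E) :
    IsUnit (fderiv ℝ T u) := by
  have hcont : Continuous (fderiv ℝ T) := continuous_iff_continuousAt.2 fun u =>
    (hT u).fderiv.continuousAt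
  have hTc : Continuous T := continuous_iff_continuousAt.2 fun u => (hT u).continuousAt
  have hclopen : IsClopen {u | IsUnit (fderiv ℝ T u)} := by
    refine ⟨?_, Units.isOpen.preimage hcont⟩
    refine isClosed_of_closure_subset fun u hu => ?_
    obtain ⟨ε, hε, C, hC, hlip⟩ := hL u
    have hnear : ∀ᶠ v in 𝓝 u, ‖T v - T u‖ < ε := by
      have := hTc.continuousAt (x := u) (Metric.ball_mem_nhds (T u) hε)
      filter_upwards [this] with v hv
      rw [← dist_eq_norm]; exact hv
    have hder : ∀ᶠ v in 𝓝 u, ‖fderiv ℝ T v - fderiv ℝ T u‖ < (C + 1)⁻¹ := by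
      have := hcont.continuousAt (x := u) (Metric.ball_mem_nhds (fderiv ℝ T u)
        (show 0 < (C + 1)⁻¹ by positivity))
      filter_upwards [this] with v hv
      rw [← dist_eq_norm]; exact hv
    obtain ⟨v, hvU, hv1, hv2⟩ :=
      ((mem_closure_iff_frequently.1 hu).and_eventually (hnear.eventually_nhds.and hder)).exists
    obtain ⟨x, hx⟩ := (hvU : IsUnit (fderiv ℝ T v))
    have hlow := norm_le_mul_norm_fderiv (hT v).differentiableAt (C := C) (by
      filter_upwards [hv1] with w hw
      exact hlip w v hw hv1.self_of_nhds)
    refine isUnit_of_norm_sub_lt (x := x) (C := C) ?_ ?_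
    · refine ContinuousLinearMap.opNorm_le_bound _ hC fun y => ?_
      have h1 := hlow (((x⁻¹ : (E →L[ℝ] E)ˣ) : E →L[ℝ] E) y)
      have h2 : (x : E →L[ℝ] E) (((x⁻¹ : (E →L[ℝ] E)ˣ) : E →L[ℝ] E) y) = y := by
        rw [← mul_apply_eq_comp, Units.mul_inv]; rfl
      rwa [← hx, h2] at h1
    · rw [hx]
      calc ‖fderiv ℝ T v - fderiv ℝ T u‖ * C ≤ (C + 1)⁻¹ * C :=
            mul_le_mul_of_nonneg_right hv2.le hC
        _ < 1 := by rw [inv_mul_lt_iff₀ (by linarith)]; linarith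
  have := hclopen.eq_univ ⟨u₀, h₀⟩
  exact (this ▸ Set.mem_univ u : u ∈ {u | IsUnit (fderiv ℝ T u)})

/-- The range is open by the inverse function theorem. It is closed in Ω because the Lipschitz bound
makes preimages of a convergent sequence Cauchy. -/
theorem image_eq_of_inverseLipschitz {T : E → E} {Ω : Set E} (hΩ : IsPreconnected Ω)
    (hT : ∀ u, AnalyticAt ℝ T u) (hmaps : ∀ u, T u ∈ Ω) (hunit : ∀ u, IsUnit (fderiv ℝ T u))
    (hL : ∀ F ∈ Ω, InverseLipschitzAt T F) : Set.range T = Ω := by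
  refine Set.Subset.antisymm (Set.range_subset_iff.2 hmaps) ?_
  have hopen : IsOpen (Set.range T) := isOpen_iff_mem_nhds.2 (by
    rintro _ ⟨u, rfl⟩
    obtain ⟨i, hi⟩ := exists_equiv_of_isUnit_fderiv (hT u) (hunit u)
    rw [← hi.map_nhds_eq_of_equiv]
    exact range_mem_map)
  refine hΩ.subset_of_closure_inter_subset hopen ⟨T 0, hmaps 0, 0, rfl⟩ ?_
  rintro F ⟨hF, hFΩ⟩
  obtain ⟨ε, hε, C, hC, hlip⟩ := hL F hFΩ
  obtain ⟨y, hy, hlim⟩ := mem_closure_iff_seq_limit.1 hF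
  choose u hu using hy
  have hcauchy : CauchySeq u := by
    refine Metric.cauchySeq_iff.2 fun η hη => ?_
    obtain ⟨N, hN⟩ := Metric.tendsto_atTop.1 hlim (min ε (η / (2 * (C + 1))))
      (lt_min hε (by positivity))
    refine ⟨N, fun m hm n hn => ?_⟩
    have hm' := hN m hm
    have hn' := hN n hn
    have h1 := hlip (u m) (u n)
      (by rw [hu, ← dist_eq_norm]; exact hm'.trans_le (min_le_left _ _))
      (by rw [hu, ← dist_eq_norm]; exact hn'.trans_le (min_le_left _ _))
    rw [hu, hu, ← dist_eq_norm, ← dist_eq_norm] at h1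
    have h2 : dist (y m) (y n) < η / (C + 1) := by
      have a1 := hm'.trans_le (min_le_right _ _)
      have a2 := hn'.trans_le (min_le_right _ _)
      have a3 := dist_triangle_right (y m) (y n) F
      have a4 : η / (C + 1) = η / (2 * (C + 1)) + η / (2 * (C + 1)) := by field_simp; norm_num
      linarith
    rw [lt_div_iff₀ (by linarith)] at h2
    have h3 : C * dist (y m) (y n) ≤ (C + 1) * dist (y m) (y n) :=
      mul_le_mul_of_nonneg_right (by linarith) dist_nonneg
    linarith
  obtain ⟨w, hw⟩ := cauchySeq_tendsto_of_complete hcauchy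
  refine ⟨w, tendsto_nhds_unique (((hT w).continuousAt.tendsto).comp hw) ?_⟩
  exact hlim.congr fun n => (hu n).symm

/-- An analytic map with invertible derivative somewhere, whose inverse satisfies a local Lipschitz
bound at each point of a preconnected set containing the range, is bianalytic onto that set. -/
theorem exists_analytic_inverse {T : E → E} {Ω : Set E} (hΩ : IsPreconnected Ω)
    (hT : ∀ u, AnalyticAt ℝ T u) (hmaps : ∀ u, T u ∈ Ω) {u₀ : E} (h₀ : IsUnit (fderiv ℝ T u₀))
    (hL : ∀ F ∈ Ω, InverseLipschitzAt T F) :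
    ∃ G : E → E, Function.LeftInverse G T ∧ (∀ F ∈ Ω, T (G F) = F) ∧ AnalyticOnNhd ℝ G Ω := by
  have hunit := isUnit_fderiv_of_inverseLipschitz hT h₀ fun u => hL (T u) (hmaps u)
  have hrange := image_eq_of_inverseLipschitz hΩ hT hmaps hunit hL
  have hinj : Function.Injective T := fun u v huv => by
    obtain ⟨ε, hε, C, hC, hlip⟩ := hL (T u) (hmaps u)
    have := hlip u v (by rwa [sub_self, norm_zero]) (by rwa [← huv, sub_self, norm_zero])
    rw [huv, sub_self, norm_zero, mul_zero] at this
    exact sub_eq_zero.1 (norm_le_zero_iff.1 this)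
  have hleft : Function.LeftInverse (Function.invFun T) T := Function.leftInverse_invFun hinj
  refine ⟨Function.invFun T, hleft, fun F hF => ?_, fun F hF => ?_⟩
  · exact Function.invFun_eq (hrange.symm ▸ hF : F ∈ Set.range T)
  · obtain ⟨u, rfl⟩ : F ∈ Set.range T := hrange.symm ▸ hF
    obtain ⟨i, hi⟩ := exists_equiv_of_isUnit_fderiv (hT u) (hunit u)
    let R : OpenPartialHomeomorph E E := hi.toOpenPartialHomeomorph T
    have hu : u ∈ R.source := hi.mem_toOpenPartialHomeomorph_source
    have hR : (R : E → E) = T := hi.toOpenPartialHomeomorph_coe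
    have h1 : AnalyticAt ℝ R.symm (R u) := R.analyticAt_symm' (i := i) hu (hT u)
      hi.hasFDerivAt.fderiv
    rw [hR] at h1
    refine h1.congr ?_
    filter_upwards [R.open_target.mem_nhds (hR ▸ R.map_source hu : T u ∈ R.target)] with y hy
    have h2 : T (R.symm y) = y := by
      have := R.right_inv hy
      rwa [hR] at this
    conv_rhs => rw [← h2]
    exact (hleft _).symm

end GlobalInverse

/-! ### Inversion of the scattering map on the ball, and passage to the reversed potential -/

namespace X

theorem convex_unitBall : Convex ℝ unitBall := by
  rintro F ⟨ρ₁, h1, hF⟩ G ⟨ρ₂, h2, hG⟩ a b ha hb hab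
  refine ⟨max ρ₁ ρ₂, max_lt h1 h2, fun s => ?_⟩
  rw [map_add, map_smul, map_smul]
  refine (norm_add_le _ _).trans ?_
  rw [norm_smul, norm_smul, Real.norm_of_nonneg ha, Real.norm_of_nonneg hb]
  have e1 := mul_le_mul_of_nonneg_left ((hF s).trans (le_max_left ρ₁ ρ₂)) ha
  have e2 := mul_le_mul_of_nonneg_left ((hG s).trans (le_max_right ρ₁ ρ₂)) hb
  calc _ ≤ a * max ρ₁ ρ₂ + b * max ρ₁ ρ₂ := add_le_add e1 e2
    _ = max ρ₁ ρ₂ := by rw [← add_mul, hab, one_mul]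

theorem exists_scat_inverse : ∃ G : X → X, Function.LeftInverse G scat ∧
    (∀ F ∈ unitBall, scat (G F) = F) ∧ AnalyticOnNhd ℝ G unitBall :=
  exists_analytic_inverse convex_unitBall.isPreconnected analyticAt_scat scat_mem_unitBall
    (u₀ := 0) (by rw [hasFDerivAt_scat_zero.fderiv]; exact isUnit_one)
    fun _ hF => exists_norm_sub_le hF

/-- Integrability needs no estimate of the correlation: almost everywhere it is the difference of u
and its data. -/
theorem integrable_corr (u : X) : Integrable (corr u) volume := by
  refine (u.integrable.sub (scat u).integrable).congr ?_
  filter_upwards [toFun_eq_scat_add_corr u] with x hx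
  rw [Pi.sub_apply, hx, add_sub_cancel_left]

theorem mem_unitBall_iff (F : X) : F ∈ unitBall ↔ F.toXR ∈ XROne := by
  have hiff : F.toXR ∈ XROne ↔ (⨆ s : ℝ, ‖ft s F‖ₑ) < 1 := Iff.rfl
  rw [hiff, mem_unitBall]
  constructor
  · rintro ⟨ρ, hρ, h⟩
    have h0 : 0 ≤ ρ := (norm_nonneg _).trans (h 0)
    refine (iSup_le fun s => ?_).trans_lt (ENNReal.ofReal_lt_one.2 hρ)
    rw [← ofReal_norm]
    exact ENNReal.ofReal_le_ofReal (h s)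
  · intro h
    refine ⟨(⨆ s : ℝ, ‖ft s F‖ₑ).toReal, ?_, fun s => ?_⟩
    · rw [← ENNReal.toReal_one]
      exact ENNReal.toReal_strict_mono ENNReal.one_ne_top h
    · rw [← toReal_enorm]
      exact ENNReal.toReal_mono (h.trans ENNReal.one_lt_top).ne (le_iSup (fun s => ‖ft s F‖ₑ) s)

theorem refl_mem_unitBall {F : X} (h : F ∈ unitBall) : refl F ∈ unitBall := by
  obtain ⟨ρ, hρ, hF⟩ := h
  exact ⟨ρ, hρ, fun s => by rw [ft_refl, RCLike.norm_conj]; exact hF s⟩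

theorem analyticAt_refl (u : X) : AnalyticAt ℝ refl u := refl.toContinuousLinearMap.analyticAt u

theorem analyticAt_rev (u : X) : AnalyticAt ℝ rev u := (analyticAt_refl u).neg

theorem toFun_rev_ae (u : X) : (rev u).toFun =ᵐ[volume] fun x => -u.toFun (-x) := by
  filter_upwards [toFun_neg (refl u), toFun_refl u] with x h1 h2
  rw [rev, h1, Pi.neg_apply, h2]

theorem toFun_rev_eq_add_corr {u F : X} (h : scat u = refl F) :
    (rev u).toFun =ᵐ[volume] fun x => -F.toFun x + -corr u (-x) := by
  have h1 := (Measure.measurePreserving_neg (volume : Measure ℝ)).quasiMeasurePreserving.ae_eq_comp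
    (toFun_eq_scat_add_corr u)
  have h2 := (Measure.measurePreserving_neg (volume : Measure ℝ)).quasiMeasurePreserving.ae_eq_comp
    (toFun_refl F)
  filter_upwards [toFun_rev_ae u, h1, h2] with x e1 e2 e3
  simp only [Function.comp_apply, neg_neg] at e2 e3
  rw [e1, e2, h, e3]; ring

end X

end MiuraScattering

end

open MiuraScattering in
theorem corollary1 :
    -- the scattering matrix, hence `r₊` and `r₋`, is well defined, and `r₊`, `r₋` are in `L²`
    (∀ u : XR, (∀ s : ℝ, ∃! A, IsScatteringMatrix u.toComplex s A) ∧
      MemLp (SPlus u.toComplex) 2 volume ∧ MemLp (SMinus u.toComplex) 2 volume) ∧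
    -- the restriction of `𝓕₊ ∘ S₊`
    (∃ T G : XR → XR,
      (∀ u : XR, (T u).toComplex =ᵐ[volume] fourierPlus (SPlus u.toComplex)) ∧
      Set.BijOn T Set.univ XROne ∧ Set.InvOn G T Set.univ XROne ∧
      AnalyticOnNhd ℝ T Set.univ ∧ AnalyticOnNhd ℝ G XROne ∧
      ∃ Φ : XROne → L1C, ∀ F : XROne,
        (G F).toFun =ᵐ[volume] fun x => F.1.toFun x + (Φ F).1 x) ∧
    -- the restriction of `𝓕₋ ∘ S₋`
    (∃ T G : XR → XR,
      (∀ u : XR, (T u).toComplex =ᵐ[volume] fourierMinus (SMinus u.toComplex)) ∧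
      Set.BijOn T Set.univ XROne ∧ Set.InvOn G T Set.univ XROne ∧
      AnalyticOnNhd ℝ T Set.univ ∧ AnalyticOnNhd ℝ G XROne ∧
      ∃ Φ : XROne → L1C, ∀ F : XROne,
        (G F).toFun =ᵐ[volume] fun x => -F.1.toFun x + (Φ F).1 x) := by
  obtain ⟨G, hGT, hTG, hG⟩ := X.exists_scat_inverse
  have hone : ∀ F : XR, F ∈ XROne ↔ (id F : X) ∈ X.unitBall := fun F => (X.mem_unitBall_iff F).symm
  refine ⟨fun u => ⟨X.existsUnique_isScatteringMatrix u, ?_, ?_⟩, ?_, ?_⟩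
  · exact (X.SPlus_eq_ft u).symm ▸ X.memLp_two_ft (X.scat u)
  · exact (X.SMinus_eq_ft u).symm ▸ X.memLp_two_ft (X.scat (X.rev u))
  · refine ⟨X.scat, G, fun u => ?_, ⟨fun u _ => ?_, fun u _ v _ h => hGT.injective h,
      fun F hF => ⟨G F, Set.mem_univ _, hTG F ((hone F).1 hF)⟩⟩,
      ⟨fun u _ => hGT u, fun F hF => hTG F ((hone F).1 hF)⟩, fun u _ => X.analyticAt_scat u,
      fun F hF => hG F ((hone F).1 hF),
      fun F => ⟨⟨X.corr (G F.1), X.continuous_corr _⟩, X.integrable_corr _⟩, fun F => ?_⟩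
    · exact (X.SPlus_eq_ft u).symm ▸ X.toComplex_ae_fourierPlus (X.scat u)
    · exact (hone _).2 (X.scat_mem_unitBall u)
    · have h := X.toFun_eq_scat_add_corr (G F.1)
      rw [hTG F.1 ((hone F.1).1 F.2)] at h
      exact h
  -- The minus map is F ↦ F(-x) after `scat` after reversal u ↦ -u(-x). Both outer maps are linear
  -- isometric involutions preserving the domain and the ball, and the sign in the reversal produces
  -- -I.
  · have hrefl : ∀ F : XR, F ∈ XROne → X.refl F ∈ X.unitBall := fun F hF =>
      X.refl_mem_unitBall ((hone F).1 hF)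
    have hleft : ∀ u : X, X.rev (G (X.refl (X.refl (X.scat (X.rev u))))) = u := fun u => by
      rw [X.refl_refl, hGT, X.rev_rev]
    have hright : ∀ F : XR, F ∈ XROne →
        X.refl (X.scat (X.rev (X.rev (G (X.refl F))))) = F := fun F hF => by
      rw [X.rev_rev, hTG _ (hrefl F hF)]; exact X.refl_refl F
    refine ⟨fun u => X.refl (X.scat (X.rev u)), fun F => X.rev (G (X.refl F)), fun u => ?_,
      ⟨fun u _ => ?_, fun u _ v _ h => ?_, fun F hF => ⟨_, Set.mem_univ _, hright F hF⟩⟩,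
      ⟨fun u _ => hleft u, hright⟩, fun u _ => ?_, fun F hF => ?_,
      fun F => ⟨⟨fun x => -X.corr (G (X.refl F.1)) (-x), ?_⟩, ?_⟩, fun F => ?_⟩
    · exact (X.SMinus_eq_ft u).symm ▸ X.toComplex_refl_ae_fourierMinus (X.scat (X.rev u))
    · exact (hone _).2 (X.refl_mem_unitBall (X.scat_mem_unitBall _))
    · rw [← hleft u, ← hleft v]
      exact congrArg (fun F : X => X.rev (G (X.refl F))) h
    · exact (X.analyticAt_refl _).comp ((X.analyticAt_scat _).comp (X.analyticAt_rev u))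
    · exact (X.analyticAt_rev _).comp ((hG _ (hrefl F hF)).comp (X.analyticAt_refl F))
    · exact ((X.continuous_corr _).comp continuous_neg).neg
    · exact (X.integrable_corr _).comp_neg.neg
    · exact X.toFun_rev_eq_add_corr (hTG _ (hrefl F.1 F.2))
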